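/- **Setting.** Let $L,U,\nu,\mu,\tau>0$, $J\ge 1$, $\Omega=(0,L)^3$. For an ensemble $u_1,\dots,u_J$ of velocity fields write $\langle a\rangle_e=\frac1J\sum_{j}a_j$, $u_j'=u_j-\langle u\rangle_e$, $|u'|_e^2=\langle |u'|^2\rangle_e$, $\nu_{turb}=\mu\tau|u'|_e^2$, and, for $\phi(t)\ge 0$, $\langle\phi\rangle_\infty=\limsup_{T\to\infty}\frac1T\int_0^T\phi\,dt\in[0,\infty]$. Let the $u_j$ be weak solutions on $(0,\infty)$, with divergence free initial values $u_j^0\in L^2(\Omega)$, of $$u_t+u\cdot\nabla u-\nu\Delta u-\nabla\cdot(\nu_{turb}\nabla u)+\nabla p=0,\qquad \nabla\cdot u=0\quad\text{in }\Omega,$$ that are $L$-periodic in $x,y$ and satisfy $u=(0,0,0)$ at $z=0$ and $u=(U,0,0)$ at $z=L$ (so that, for every $T>0$, $u_j\in L^\infty(0,T;L^2)\cap L^2(0,T;H^1)$ and $\nu_{turb}|\nabla u_j|^2\in L^1((0,T)\times\Omega)$). Assume that every $u=u_j$ satisfies the energy inequality $$\tfrac12\tfrac{d}{dt}\|u\|^2+\int_\Omega[\nu+\nu_{turb}]|\nabla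 u|^2dx\le(u_t,\phi)+\int_\Omega[\nu+\nu_{turb}]\nabla u:\nabla\phi\,dx+(u\cdot\nabla u,\phi),$$ integrated over $[0,T]$ for almost every $T>0$, for every divergence free $\phi=\phi(x,y,z)$ with $\phi,\nabla\phi\in L^2(\Omega)$ that satisfies the same boundary conditions and for which the integrals on the right exist. Put $$\varepsilon_{model}(t)=\Big\langle\frac1{|\Omega|}\int_\Omega(\nu+\nu_{turb})|\nabla u|^2dx\Big\rangle_e,\quad \nu_{eff}=\frac{\langle\varepsilon_{model}\rangle_\infty}{\big\langle\langle|\Omega|^{-1}\int_\Omega|\nabla u|^2dx\rangle_e\big\rangle_\infty},\quad T^*=\frac LU,\quad \beta=\frac18\,\frac{\nu_{eff}}{UL},$$ $\mathcal S_\beta=\{0\le x\le L,\ 0\le y\le L,\ (1-\beta)L<z<L\}$ and $$C_{26}=\frac1{\sqrt3}\,\frac{2\,\Gamma(3)}{\Gamma(\frac12)\,\Gamma(\frac52)}=\frac{16}{3\sqrt3\,\pi}\approx0.98014 .$$ **Theorem.** The two long time averages that define $\nu_{eff}$ are finite and the denominator is positive. If $\beta\le1$, i.e. if the near wall region $\mathcal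 S_\beta$ does not extend below the bottom wall, then $$\langle\varepsilon_{model}\rangle_\infty\le\Big(\frac52+16\frac{\nu}{\nu_{eff}}\Big)\frac{U^3}{L}+\frac{\sqrt[3]3}{6}\,C_{26}^2\,\mu\,\frac{\tau}{T^*}\Big\langle\frac1{|\mathcal S_\beta|}\int_{\mathcal S_\beta}\nu_{eff}\Big\langle\Big|\frac{\partial u'}{\partial z}\Big|^2\Big\rangle_e dx\Big\rangle_\infty$$ and $$\langle\varepsilon_{model}\rangle_\infty\le\Big(\frac52+16\frac{\nu}{\nu_{eff}}\Big)\frac{U^3}{L}+\frac{\sqrt[3]3}{6}\,C_{26}^2\,\mu\,\frac{\tau}{T^*}\Big\langle\frac1{|\mathcal S_\beta|}\int_{\mathcal S_\beta}\nu_{eff}\big\langle|\nabla u|^2\big\rangle_e dx\Big\rangle_\infty .$$ -/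

import Mathlib

noncomputable section

open MeasureTheory Set Filter
open scoped ENNReal NNReal ContDiff

namespace EEV

/-- Points of space and velocities.  Only coordinates, sums of squares of coordinates and Lebesgue
measure are used below, so the choice of norm on `Fin 3 → ℝ` plays no role. -/
abbrev Vec := Fin 3 → ℝ

/-- Velocity gradients: `A i k` is the derivative of the `i`-th component in direction `k`. -/
abbrev Grad := Fin 3 → Fin 3 → ℝ

/-- Euclidean inner product. -/
def dot (v w : Vec) : ℝ := ∑ i, v i * w i

/-- Squared Euclidean length. -/
def normSq (v : Vec) : ℝ := ∑ i, v i ^ 2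

/-- The full contraction `A : B`. -/
def gradDot (A B : Grad) : ℝ := ∑ i, ∑ k, A i k * B i k

/-- Squared Frobenius length. -/
def gradSq (A : Grad) : ℝ := ∑ i, ∑ k, A i k ^ 2

/-- The convective term `(v · ∇) v`, where `A` is the gradient of `v`. -/
def convect (v : Vec) (A : Grad) : Vec := fun i => ∑ k, v k * A i k

/-- The parameters of the model: box side and length scale `L`, lid speed `U`, kinematic viscosity
`ν`, eddy viscosity coefficient `μ`, turbulence time scale `τ`. -/
structure Params where
  L : ℝ
  U : ℝ
  ν : ℝ
  μ : ℝ
  τ : ℝ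

/-- The flow domain `(0, L)³`; the coordinates `0, 1, 2` are `x, y, z`. -/
def box (L : ℝ) : Set Vec := Set.pi Set.univ fun _ => Ioo 0 L

/-- `L`-periodicity in `x` and in `y`. -/
def XYPeriodic {α : Type*} (L : ℝ) (f : Vec → α) : Prop :=
  ∀ x, f (x + Pi.single 0 L) = f x ∧ f (x + Pi.single 1 L) = f x

/-- The classical partial derivative in direction `k`. -/
def pderiv (k : Fin 3) (χ : Vec → ℝ) (x : Vec) : ℝ := fderiv ℝ χ x (Pi.single k 1)

/-- `f ∈ H¹((0,L)³)` with weak gradient `g`, with `L`-periodic traces in `x, y`, with trace `0` on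
the wall `z = 0` and with constant trace `a` on the wall `z = L`.  Weak derivatives and traces are
expressed together by Green's formula
`∫_Ω (f ∂ₖχ + gₖ χ) = ∫_∂Ω f χ nₖ`,
tested with all smooth `χ` that are `L`-periodic in `x, y` (and need not vanish on the walls):
the contributions of opposite side faces cancel, the wall `z = 0` contributes nothing, and the
wall `z = L` contributes `∫ a χ(x, y, L) dx dy` when `k` is the `z`-direction. -/
structure HasShearGradient (L a : ℝ) (f : Vec → ℝ) (g : Vec → Vec) : Prop where
  memLp : MemLp f 2 (volume.restrict (box L))
  grad_memLp : ∀ k, MemLp (fun x => g x k) 2 (volume.restrict (box L))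
  green : ∀ χ : Vec → ℝ, ContDiff ℝ ∞ χ → XYPeriodic L χ → ∀ k : Fin 3,
    ∫ x in box L, (f x * pderiv k χ x + g x k * χ x) =
      if k = 2 then ∫ x in Ioo 0 L, ∫ y in Ioo 0 L, a * χ ![x, y, L] else 0

/-- The velocity `(U, 0, 0)` of the upper wall. -/
def lid (U : ℝ) : Vec := ![U, 0, 0]

/-- `φ` is divergence free, `φ, ∇φ ∈ L²`, `∇φ = Φ`, and `φ` satisfies the shear boundary
conditions: `φ = 0` at `z = 0`, `φ = (U, 0, 0)` at `z = L`, periodic in `x, y`. -/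
structure IsShearField (L U : ℝ) (φ : Vec → Vec) (Φ : Vec → Grad) : Prop where
  grad : ∀ i, HasShearGradient L (lid U i) (fun x => φ x i) (fun x => Φ x i)
  div_free : ∀ᵐ x ∂(volume.restrict (box L)), ∑ i, Φ x i i = 0

/-- Ensemble average of real quantities. -/
def ensMean {J : ℕ} (a : Fin J → ℝ) : ℝ := (∑ j, a j) / J

/-- Ensemble average of nonnegative extended real quantities. -/
def ensMeanENN {J : ℕ} (a : Fin J → ℝ≥0∞) : ℝ≥0∞ := (∑ j, a j) / J

/-- The fluctuation `u′ = u - ⟨u⟩ₑ` of the `j`-th realization. -/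
def fluct {J : ℕ} (u : Fin J → ℝ → Vec → Vec) (j : Fin J) (t : ℝ) (x : Vec) : Vec :=
  fun i => u j t x i - ensMean fun l => u l t x i

/-- `∂u′/∂z` of the `j`-th realization, where `Du j` is the gradient of `u j`. -/
def fluctDz {J : ℕ} (Du : Fin J → ℝ → Vec → Grad) (j : Fin J) (t : ℝ) (x : Vec) : Vec :=
  fun i => Du j t x i 2 - ensMean fun l => Du l t x i 2

/-- The eddy viscosity `ν_turb = μ τ |u′|ₑ²`. -/
def nuTurb (p : Params) {J : ℕ} (u : Fin J → ℝ → Vec → Vec) (t : ℝ) (x : Vec) : ℝ :=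
  p.μ * p.τ * ensMean fun j => normSq (fluct u j t x)

/-- Divergence free smooth vector fields on space-time, `L`-periodic in `x, y`, vanishing near the
walls and for large times, but not necessarily at time `0`. -/
structure IsTestField (L : ℝ) (ψ : ℝ → Vec → Vec) : Prop where
  smooth : ContDiff ℝ ∞ fun q : ℝ × Vec => ψ q.1 q.2
  periodic : ∀ t, XYPeriodic L (ψ t)
  div_free : ∀ t x, ∑ i, pderiv i (fun y => ψ t y i) x = 0
  support : ∃ R δ : ℝ, 0 < δ ∧
    ∀ t x, (R < t ∨ x 2 < δ ∨ L - δ < x 2) → ψ t x = 0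

/-- `u j`, `j = 1, …, J`, with gradients `Du j` and square integrable divergence free initial
values `u₀ j`, are weak solutions on `(0, ∞)` of the ensemble eddy viscosity model
`u_t + u·∇u - ν Δu - ∇·(ν_turb ∇u) + ∇p = 0`, `∇·u = 0`, with the shear boundary conditions. The
pressure is eliminated by divergence free test fields. -/
structure IsWeakSolution (p : Params) {J : ℕ} (u₀ : Fin J → Vec → Vec)
    (u : Fin J → ℝ → Vec → Vec) (Du : Fin J → ℝ → Vec → Grad) : Prop where
  init_memLp : ∀ j i, MemLp (fun x => u₀ j x i) 2 (volume.restrict (box p.L))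
  init_div_free : ∀ j, ∀ χ : Vec → ℝ, ContDiff ℝ ∞ χ → XYPeriodic p.L χ →
    (∃ δ : ℝ, 0 < δ ∧ ∀ x : Vec, (x 2 < δ ∨ p.L - δ < x 2) → χ x = 0) →
    ∫ x in box p.L, ∑ i, u₀ j x i * pderiv i χ x = 0
  meas : ∀ j i, AEStronglyMeasurable (fun q : ℝ × Vec => u j q.1 q.2 i)
    (volume.restrict (Ioi 0 ×ˢ box p.L))
  grad_meas : ∀ j i k, AEStronglyMeasurable (fun q : ℝ × Vec => Du j q.1 q.2 i k)
    (volume.restrict (Ioi 0 ×ˢ box p.L))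
  /-- At almost every time, `u j t ∈ H¹` has gradient `Du j t`, is divergence free and satisfies
  the shear boundary conditions. -/
  shear : ∀ j, ∀ᵐ t ∂(volume.restrict (Ioi (0 : ℝ))), IsShearField p.L p.U (u j t) (Du j t)
  /-- `u j ∈ L^∞(0, T; L²)`. -/
  energy_bdd : ∀ j, ∀ T : ℝ, ∃ C : ℝ≥0, ∀ᵐ t ∂(volume.restrict (Ioc 0 T)),
    ∫⁻ x in box p.L, ENNReal.ofReal (normSq (u j t x)) ≤ C
  /-- `∇u j ∈ L²(0, T; L²)`. -/
  grad_sq_int : ∀ j, ∀ T : ℝ,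
    ∫⁻ t in Ioc 0 T, ∫⁻ x in box p.L, ENNReal.ofReal (gradSq (Du j t x)) < ⊤
  /-- `ν_turb |∇u j|² ∈ L¹((0, T) × Ω)`. -/
  turb_int : ∀ j, ∀ T : ℝ,
    ∫⁻ t in Ioc 0 T, ∫⁻ x in box p.L,
      ENNReal.ofReal (nuTurb p u t x * gradSq (Du j t x)) < ⊤
  /-- The momentum equation and the initial condition, in weak form. -/
  momentum : ∀ j, ∀ ψ : ℝ → Vec → Vec, IsTestField p.L ψ →
    ∫ t in Ioi (0 : ℝ), ∫ x in box p.L,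
      (-dot (u j t x) (fun i => deriv (fun s => ψ s x i) t)
        + (p.ν + nuTurb p u t x) * gradDot (Du j t x) (fun i k => pderiv k (fun y => ψ t y i) x)
        + dot (convect (u j t x) (Du j t x)) (ψ t x)) =
    ∫ x in box p.L, dot (u₀ j x) (ψ 0 x)

/-- The energy inequality
`½ d/dt ‖u‖² + ∫ (ν + ν_turb) |∇u|² ≤ (u_t, φ) + ∫ (ν + ν_turb) ∇u : ∇φ + (u·∇u, φ)`,
integrated over `[0, T]` for almost every `T > 0`, for every realization and every divergence free
`φ = φ(x, y, z)` with `φ, ∇φ ∈ L²` that satisfies the shear boundary conditions and for which the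
integrals on the right exist. -/
def EnergyInequality (p : Params) {J : ℕ} (u₀ : Fin J → Vec → Vec)
    (u : Fin J → ℝ → Vec → Vec) (Du : Fin J → ℝ → Vec → Grad) : Prop :=
  ∀ j, ∀ (φ : Vec → Vec) (Φ : Vec → Grad), IsShearField p.L p.U φ Φ →
    (∀ T : ℝ, IntegrableOn
      (fun q : ℝ × Vec => (p.ν + nuTurb p u q.1 q.2) * gradDot (Du j q.1 q.2) (Φ q.2))
      (Ioc 0 T ×ˢ box p.L)) →
    (∀ T : ℝ, IntegrableOn
      (fun q : ℝ × Vec => dot (convect (u j q.1 q.2) (Du j q.1 q.2)) (φ q.2))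
      (Ioc 0 T ×ˢ box p.L)) →
    ∀ᵐ T ∂(volume.restrict (Ioi (0 : ℝ))),
      1 / 2 * (∫ x in box p.L, normSq (u j T x))
        + (∫ t in Ioc 0 T, ∫ x in box p.L, (p.ν + nuTurb p u t x) * gradSq (Du j t x)) ≤
      1 / 2 * (∫ x in box p.L, normSq (u₀ j x))
        + (∫ x in box p.L, dot (fun i => u j T x i - u₀ j x i) (φ x))
        + (∫ t in Ioc 0 T, ∫ x in box p.L,
            (p.ν + nuTurb p u t x) * gradDot (Du j t x) (Φ x))
        + (∫ t in Ioc 0 T, ∫ x in box p.L, dot (convect (u j t x) (Du j t x)) (φ x))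

/-- The long time average `⟨f⟩_∞ = limsup_{T → ∞} (1/T) ∫₀ᵀ f(t) dt` of a nonnegative function. -/
def longTimeAvg (f : ℝ → ℝ≥0∞) : ℝ≥0∞ :=
  limsup (fun T : ℝ => (ENNReal.ofReal T)⁻¹ * ∫⁻ t in Ioc 0 T, f t) atTop

/-- The space average `|S|⁻¹ ∫_S f dx` of the nonnegative function `f`. -/
def spaceAvg (S : Set Vec) (f : Vec → ℝ) : ℝ≥0∞ :=
  (volume S)⁻¹ * ∫⁻ x in S, ENNReal.ofReal (f x)

/-- The energy dissipation rate `ε_model(t) = ⟨|Ω|⁻¹ ∫_Ω ν |∇u|² + ν_turb |∇u|² dx⟩ₑ`. -/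
def dissipation (p : Params) {J : ℕ} (u : Fin J → ℝ → Vec → Vec) (Du : Fin J → ℝ → Vec → Grad)
    (t : ℝ) : ℝ≥0∞ :=
  ensMeanENN fun j => spaceAvg (box p.L) fun x =>
    p.ν * gradSq (Du j t x) + nuTurb p u t x * gradSq (Du j t x)

/-- `⟨|Ω|⁻¹ ∫_Ω |∇u|² dx⟩ₑ`. -/
def meanGradSq (p : Params) {J : ℕ} (Du : Fin J → ℝ → Vec → Grad) (t : ℝ) : ℝ≥0∞ :=
  ensMeanENN fun j => spaceAvg (box p.L) fun x => gradSq (Du j t x)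

/-- The effective viscosity `ν_eff = ⟨ε_model⟩_∞ / ⟨⟨|Ω|⁻¹ ∫_Ω |∇u|² dx⟩ₑ⟩_∞`. -/
def nuEff (p : Params) {J : ℕ} (u : Fin J → ℝ → Vec → Vec) (Du : Fin J → ℝ → Vec → Grad) : ℝ :=
  (longTimeAvg (dissipation p u Du) / longTimeAvg (meanGradSq p Du)).toReal

/-- The effective Reynolds number `U L / ν_eff`. -/
def reEff (p : Params) {J : ℕ} (u : Fin J → ℝ → Vec → Vec) (Du : Fin J → ℝ → Vec → Grad) : ℝ :=
  p.U * p.L / nuEff p u Du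

/-- The relative thickness `β = (1/8) Re_eff⁻¹` of the near wall region. -/
def beta (p : Params) {J : ℕ} (u : Fin J → ℝ → Vec → Vec) (Du : Fin J → ℝ → Vec → Grad) : ℝ :=
  1 / 8 * (reEff p u Du)⁻¹

/-- The near wall region `S_β`. -/
def nearWall (L β : ℝ) : Set Vec :=
  {x | 0 ≤ x 0 ∧ x 0 ≤ L ∧ 0 ≤ x 1 ∧ x 1 ≤ L ∧ (1 - β) * L < x 2 ∧ x 2 < L}

/-- The large scale turnover time `T* = L / U`. -/
def turnover (p : Params) : ℝ := p.L / p.U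

/-- `⟨|S_β|⁻¹ ∫_{S_β} ν_eff ⟨|∂u′/∂z|²⟩ₑ dx⟩_∞`. -/
def wallFluct (p : Params) {J : ℕ} (u : Fin J → ℝ → Vec → Vec)
    (Du : Fin J → ℝ → Vec → Grad) : ℝ≥0∞ :=
  longTimeAvg fun t => spaceAvg (nearWall p.L (beta p u Du)) fun x =>
    nuEff p u Du * ensMean fun j => normSq (fluctDz Du j t x)

/-- `⟨|S_β|⁻¹ ∫_{S_β} ν_eff ⟨|∇u|²⟩ₑ dx⟩_∞`. -/
def wallGrad (p : Params) {J : ℕ} (u : Fin J → ℝ → Vec → Vec)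
    (Du : Fin J → ℝ → Vec → Grad) : ℝ≥0∞ :=
  longTimeAvg fun t => spaceAvg (nearWall p.L (beta p u Du)) fun x =>
    nuEff p u Du * ensMean fun j => gradSq (Du j t x)

/-- The constant `C_{rq}`, with `r' = r / (r - 1)` the conjugate exponent of `r`. -/
def hardyConst (r q : ℝ) : ℝ :=
  (r / (r - 1) / q) ^ (1 / r) *
    ((q - r) / r * Real.Gamma (r * q / (q - r)) /
      (Real.Gamma (r / (q - r)) * Real.Gamma (r * (q - 1) / (q - r))))

/-- `C₂₆ = 3^{-1/2} · 2 Γ(3) / (Γ(1/2) Γ(5/2)) ≈ 0.98014`. -/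
def C26 : ℝ := hardyConst 2 6

end EEV

end

noncomputable section

open MeasureTheory Set Filter
open scoped ENNReal NNReal ContDiff Topology

namespace EEV

/-! The energy inequality is tested with a background flow `(φ(z), 0, 0)` that lives only in a layer
of thickness `l` below the lid, where `φ` is `U` times the square of a linear ramp. The term `(u_t,
φ)` costs only a constant independent of `T`, which the time average removes. Half of the
dissipation absorbs the viscous term by Young's inequality. What is left is `½ ν φ'²`, which is
explicit, and `½ ν_turb φ'²`, a weighted integral of `|u'|²`.

The convective term is estimated without integrating by parts. Writing `u = (u - (U,0,0)) +
(U,0,0)`, the first part is small near the lid by a weighted Poincaré inequality, and the second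
pairs `φ` with `∂u₁/∂x`. Young's inequality turns both into at most `(κ/6) ∫|∇u|²` plus an explicit
term, provided `8Ul ≤ κ` (`viscous_add_convective_le`, `lintegral_budget_le`,
`half_lintegral_totalDissipation_le`).

For `κ = ν_eff` and `l = βL = ν_eff/(8U)`, the long time average of `κ∫|∇u|²` equals the averaged
dissipation `D` by the definition of `ν_eff`. So `D/2` is bounded by data plus `D/6`, and `D/6` may
be subtracted once `D < ∞`. The fluctuations vanish on the lid because all realizations share the
same boundary value. Cauchy–Schwarz on vertical lines therefore bounds `∫|u'|²φ'²` by `(U²/3)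
∫|∂u'/∂z|²` over the layer (`weightedFluct_le_slab`). This yields the constants `3/16` and `1/16`,
which are at most the stated `5/2` and `3^{1/3} C₂₆²/6`; `C₂₆` enters only through this numerical
comparison.

Finiteness of `D` must come first and cannot use `ν_eff`. There `κ = ν`, and `|u'|²` is bounded on
each vertical line by integrating `2 u'·∂u'/∂z`, so that `|u'|²` is at most `δ∫|u'|²|∂u'/∂z|² +
L/δ`. The product `|u'|²|∂u'/∂z|²` is controlled by the eddy dissipation, so a small `δ` allows
absorption (`weightedFluct_le_dissipation`, `longTimeAvg_totalDissipation_lt_top`).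

Everything on vertical lines rests on `HasShearGradient.lineRep`, which extracts from Green's
formula that a component is, on almost every line, its lid value minus the integral of its vertical
derivative up to the lid. -/

/-! ### Slicing the box into vertical lines; the divergence theorem on it. -/

/-- The horizontal cross section `(0, L)²` of the box. -/
def face (L : ℝ) : Set (Fin 2 → ℝ) := Set.pi Set.univ fun _ => Ioo 0 L

/-- The point with horizontal coordinates `y` and height `z`. -/
def ins (y : Fin 2 → ℝ) (z : ℝ) : Vec := ![y 0, y 1, z]

@[simp] lemma ins_two (y : Fin 2 → ℝ) (z : ℝ) : ins y z 2 = z := rfl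

lemma ins_eq_insertNth (y : Fin 2 → ℝ) (z : ℝ) :
    ins y z = Fin.insertNth (α := fun _ => ℝ) (2 : Fin 3) z y := by
  funext i
  fin_cases i
  · exact (Fin.insertNth_apply_succAbove (α := fun _ => ℝ) (2 : Fin 3) z y 0).symm
  · exact (Fin.insertNth_apply_succAbove (α := fun _ => ℝ) (2 : Fin 3) z y 1).symm
  · exact (Fin.insertNth_apply_same (α := fun _ => ℝ) (2 : Fin 3) z y).symm

/-- Splitting a point into its horizontal coordinates and its height. -/
def splitEquiv : (Fin 2 → ℝ) × ℝ ≃ᵐ Vec :=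
  MeasurableEquiv.prodComm.trans (MeasurableEquiv.piFinSuccAbove (fun _ => ℝ) (2 : Fin 3)).symm

lemma splitEquiv_apply (q : (Fin 2 → ℝ) × ℝ) : splitEquiv q = ins q.1 q.2 :=
  (ins_eq_insertNth q.1 q.2).symm

lemma measurePreserving_splitEquiv : MeasurePreserving splitEquiv volume volume :=
  ((volume_preserving_piFinSuccAbove (fun _ => ℝ) (2 : Fin 3)).symm _).comp
    Measure.measurePreserving_swap

lemma splitEquiv_preimage_box (L : ℝ) : splitEquiv ⁻¹' box L = face L ×ˢ Ioo 0 L := by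
  ext q
  simp [splitEquiv_apply, box, face, ins, Fin.forall_fin_succ, and_assoc]

lemma measurableSet_box (L : ℝ) : MeasurableSet (box L) :=
  MeasurableSet.univ_pi fun _ => measurableSet_Ioo

lemma measurableSet_face (L : ℝ) : MeasurableSet (face L) :=
  MeasurableSet.univ_pi fun _ => measurableSet_Ioo

lemma isOpen_box (L : ℝ) : IsOpen (box L) := isOpen_set_pi finite_univ fun _ _ => isOpen_Ioo

lemma mem_box {L : ℝ} {x : Vec} : x ∈ box L ↔ ∀ i, x i ∈ Ioo 0 L := by simp [box]

lemma measurePreserving_split_box (L : ℝ) :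
    MeasurePreserving splitEquiv
      ((volume.restrict (face L)).prod (volume.restrict (Ioo 0 L)))
      (volume.restrict (box L)) := by
  rw [Measure.prod_restrict, ← splitEquiv_preimage_box]
  exact measurePreserving_splitEquiv.restrict_preimage (measurableSet_box L)

instance isFiniteMeasure_box (L : ℝ) : IsFiniteMeasure (volume.restrict (box L)) :=
  ⟨by
    rw [Measure.restrict_apply_univ, box, Real.volume_pi_Ioo]
    exact ENNReal.prod_lt_top fun _ _ => ENNReal.ofReal_lt_top⟩

lemma volume_box {L : ℝ} (hL : 0 < L) : volume (box L) = ENNReal.ofReal (L ^ 3) := by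
  rw [box, Real.volume_pi_Ioo]
  simp [ENNReal.ofReal_pow hL.le]

lemma volume_face {L : ℝ} (hL : 0 < L) : volume (face L) = ENNReal.ofReal (L ^ 2) := by
  rw [face, Real.volume_pi_Ioo]
  simp [ENNReal.ofReal_pow hL.le]

lemma lintegral_box (L : ℝ) {F : Vec → ℝ≥0∞} (hF : AEMeasurable F (volume.restrict (box L))) :
    ∫⁻ x in box L, F x = ∫⁻ y in face L, ∫⁻ z in Ioo 0 L, F (ins y z) := by
  have h := (measurePreserving_split_box L).lintegral_comp_emb
    splitEquiv.measurableEmbedding F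
  rw [← h, lintegral_prod]
  · simp only [splitEquiv_apply]
  · exact hF.comp_quasiMeasurePreserving (measurePreserving_split_box L).quasiMeasurePreserving

lemma integrable_box_iff (L : ℝ) (F : Vec → ℝ) :
    IntegrableOn F (box L) ↔ Integrable (fun q : (Fin 2 → ℝ) × ℝ => F (ins q.1 q.2))
      ((volume.restrict (face L)).prod (volume.restrict (Ioo 0 L))) := by
  have h := (measurePreserving_split_box L).integrable_comp_emb
    splitEquiv.measurableEmbedding (g := F)
  rw [IntegrableOn, ← h]
  exact iff_of_eq (congrArg (fun f => Integrable f _) (funext fun q => by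
    simp [splitEquiv_apply]))

lemma integral_box (L : ℝ) {F : Vec → ℝ} :
    ∫ x in box L, F x = ∫ q, F (ins q.1 q.2)
      ∂((volume.restrict (face L)).prod (volume.restrict (Ioo 0 L))) := by
  have h := (measurePreserving_split_box L).integral_comp
    splitEquiv.measurableEmbedding F
  rw [← h]
  simp only [splitEquiv_apply]

lemma ae_box_iff (L : ℝ) {P : Vec → Prop} (h : ∀ᵐ x ∂volume.restrict (box L), P x) :
    ∀ᵐ y ∂volume.restrict (face L), ∀ᵐ z ∂volume.restrict (Ioo 0 L), P (ins y z) := by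
  have h1 := (measurePreserving_split_box L).quasiMeasurePreserving.ae h
  have h2 := Measure.ae_ae_of_ae_prod h1
  simpa only [splitEquiv_apply] using h2

/-- Integration over a horizontal cross section as an iterated integral. -/
lemma integral_face (L : ℝ) {F : (Fin 2 → ℝ) → ℝ} (hF : IntegrableOn F (face L)) :
    ∫ y in face L, F y = ∫ a in Ioo 0 L, ∫ b in Ioo 0 L, F ![a, b] := by
  have hmp : MeasurePreserving (MeasurableEquiv.finTwoArrow (α := ℝ)).symm
      ((volume.restrict (Ioo 0 L)).prod (volume.restrict (Ioo 0 L)))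
      (volume.restrict (face L)) := by
    have h := ((volume_preserving_finTwoArrow ℝ).symm _).restrict_preimage (measurableSet_face L)
    have hp : (MeasurableEquiv.finTwoArrow (α := ℝ)).symm ⁻¹' face L = Ioo 0 L ×ˢ Ioo 0 L := by
      ext q
      simp [face, Fin.forall_fin_succ]
    rw [hp] at h
    rwa [Measure.prod_restrict]
  have h := hmp.integral_comp (MeasurableEquiv.measurableEmbedding _) F
  have hi := (hmp.integrable_comp_emb (MeasurableEquiv.measurableEmbedding _) (g := F)).2 hF
  exact h.symm.trans (integral_prod _ hi)

/-- The fundamental theorem of calculus on the box in direction `k`. -/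
lemma integral_box_pderiv {L : ℝ} (hL : 0 < L) (k : Fin 3) {F : Vec → ℝ} (hF : ContDiff ℝ 1 F) :
    ∫ x in box L, pderiv k F x =
      ∫ y in face L, (F (k.insertNth (α := fun _ => ℝ) L y)
        - F (k.insertNth (α := fun _ => ℝ) 0 y)) := by
  have hle : (fun _ => 0 : Vec) ≤ fun _ => L := fun _ => hL.le
  have hc : Continuous fun x => pderiv k F x :=
    (hF.continuous_fderiv one_ne_zero).clm_apply continuous_const
  have hcI : Continuous fun y : Fin 2 → ℝ => (k.insertNth (α := fun _ => ℝ) L y : Vec) := by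
    fun_prop
  have hc0 : Continuous fun y : Fin 2 → ℝ => (k.insertNth (α := fun _ => ℝ) 0 y : Vec) := by
    fun_prop
  -- The divergence theorem for the vector field `F eₖ`: only the two faces orthogonal to direction
  -- `k` contribute.
  have key := integral_divergence_of_hasFDerivAt_off_countable' (fun _ => 0 : Vec) (fun _ => L)
    hle (fun i x => if i = k then F x else 0) (fun i x => if i = k then fderiv ℝ F x else 0) ∅
    countable_empty
    (fun i => by by_cases h : i = k <;> simp [h, hF.continuous.continuousOn, continuousOn_const])
    (fun x _ i => by
      by_cases h : i = k
      · simpa [h] using (hF.differentiable one_ne_zero x).hasFDerivAt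
      · simpa [h] using hasFDerivAt_const (0 : ℝ) x)
    (by
      have : (fun x : Vec => ∑ i, (if i = k then fderiv ℝ F x else 0) (Pi.single i 1))
          = fun x => pderiv k F x := by
        funext x
        rw [Finset.sum_eq_single k] <;> simp +contextual [pderiv]
      rw [this]
      exact hc.continuousOn.integrableOn_compact isCompact_Icc)
  have hface : ∀ G : (Fin 2 → ℝ) → ℝ,
      ∫ y in Icc ((fun _ => 0 : Vec) ∘ k.succAbove) ((fun _ => L : Vec) ∘ k.succAbove), G y
        = ∫ y in face L, G y := fun G =>
    setIntegral_congr_set Measure.univ_pi_Ioo_ae_eq_Icc.symm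
  have hfin : ∀ G : (Fin 2 → ℝ) → ℝ, Continuous G → IntegrableOn G (face L) := fun G hG =>
    (hG.continuousOn.integrableOn_compact (isCompact_Icc (a := fun _ => 0) (b := fun _ => L))).mono_set
      (fun y hy => ⟨fun i => (hy i trivial).1.le, fun i => (hy i trivial).2.le⟩)
  refine Eq.trans ?_
    (integral_sub (hfin _ (hF.continuous.comp hcI)) (hfin _ (hF.continuous.comp hc0))).symm
  rw [Finset.sum_eq_single k (by intro i _ hi; simp [hi]) (by simp)] at key
  simp only [if_true, hface] at key
  simp only [Function.comp_def]
  rw [← key]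
  refine (setIntegral_congr_set (Measure.univ_pi_Ioo_ae_eq_Icc
    (f := fun _ : Fin 3 => (0 : ℝ)) (g := fun _ => L))).trans
    (integral_congr_ae (ae_of_all _ fun x => ?_))
  dsimp only
  rw [Finset.sum_eq_single k] <;> simp +contextual [pderiv]

/-! ### Periodic test functions with prescribed vertical derivative. -/

/-- The `L`-periodization in direction `k` of a function that vanishes outside `0 < x k < L`. -/
def periodize {L : ℝ} (hL : 0 < L) (k : Fin 3) (f : Vec → ℝ) (x : Vec) : ℝ :=
  f (x - Pi.single k (toIcoDiv hL 0 (x k) • L))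

lemma periodize_add_same {L : ℝ} (hL : 0 < L) (k : Fin 3) (f : Vec → ℝ) (x : Vec) :
    periodize hL k f (x + Pi.single k L) = periodize hL k f x := by
  unfold periodize
  congr 1
  simp only [Pi.add_apply, Pi.single_eq_same, toIcoDiv_add_right]
  rw [add_smul, one_smul, Pi.single_add]
  abel

lemma periodize_add_of_ne {L : ℝ} (hL : 0 < L) {k l : Fin 3} (hkl : k ≠ l) {f : Vec → ℝ}
    (hf : ∀ x, f (x + Pi.single l L) = f x) (x : Vec) :
    periodize hL k f (x + Pi.single l L) = periodize hL k f x := by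
  unfold periodize
  simp only [Pi.add_apply, Pi.single_eq_of_ne hkl, add_zero]
  rw [add_sub_right_comm, hf]

lemma periodize_eq_self {L : ℝ} (hL : 0 < L) (k : Fin 3) (f : Vec → ℝ) {x : Vec}
    (hx : x k ∈ Ico 0 L) : periodize hL k f x = f x := by
  have : toIcoDiv hL 0 (x k) = 0 := toIcoDiv_eq_of_sub_zsmul_mem_Ico hL (by simpa using hx)
  simp [periodize, this]

/-- Near a point in the `m`-th period the periodization is the sum of the translates of `f` by `m -
1`, `m` and `m + 1` periods, because at each nearby point every translate other than the one
selected by `toIcoDiv` vanishes. A finite sum of smooth functions is smooth across the period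
boundary. -/
lemma contDiff_periodize {L : ℝ} (hL : 0 < L) (k : Fin 3) {f : Vec → ℝ} (hf : ContDiff ℝ ∞ f)
    (h0 : ∀ x : Vec, x k ∉ Ioo 0 L → f x = 0) : ContDiff ℝ ∞ (periodize hL k f) := by
  rw [contDiff_iff_contDiffAt]
  intro x
  set m : ℤ := toIcoDiv hL 0 (x k) with hm
  have hmx := sub_toIcoDiv_zsmul_mem_Ico hL 0 (x k)
  rw [← hm] at hmx
  simp only [zsmul_eq_mul, zero_add] at hmx
  have hopen : ∀ᶠ y in 𝓝 x, y k ∈ Ioo (((m : ℝ) - 1) * L) ((m + 2) * L) := by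
    refine (continuous_apply k).continuousAt.eventually (isOpen_Ioo.mem_nhds ?_)
    constructor <;> nlinarith [hmx.1, hmx.2]
  have heq : periodize hL k f =ᶠ[𝓝 x] fun y =>
      f (y - Pi.single k ((m - 1 : ℤ) • L)) + f (y - Pi.single k (m • L))
        + f (y - Pi.single k ((m + 1 : ℤ) • L)) := by
    filter_upwards [hopen] with y hy
    set n : ℤ := toIcoDiv hL 0 (y k) with hn
    have hny := sub_toIcoDiv_zsmul_mem_Ico hL 0 (y k)
    rw [← hn] at hny
    simp only [zsmul_eq_mul, zero_add] at hny
    have hz : ∀ l : ℤ, l ≠ n → f (y - Pi.single k (l • L)) = 0 := by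
      intro l hl
      apply h0
      simp only [Pi.sub_apply, Pi.single_eq_same, zsmul_eq_mul]
      rintro ⟨h1, h2⟩
      have hlt : ∀ a b : ℤ, (a : ℝ) * L < (b + 1) * L → a ≤ b := fun a b h => by
        have h' : (a : ℝ) < b + 1 := lt_of_mul_lt_mul_right h hL.le
        exact Int.lt_add_one_iff.1 (by exact_mod_cast h')
      exact hl (le_antisymm (hlt _ _ (by nlinarith [hny.1, hny.2]))
        (hlt _ _ (by nlinarith [hny.1, hny.2])))
    have hlt : ∀ a b : ℤ, (a : ℝ) * L < b * L → a < b := fun a b h => by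
      exact_mod_cast lt_of_mul_lt_mul_right h hL.le
    have h1 : m - 1 ≤ n := by
      have := hlt (m - 1) (n + 1) (by push_cast; nlinarith [hny.2, hy.1])
      omega
    have h2 : n ≤ m + 1 := by
      have := hlt n (m + 2) (by push_cast; nlinarith [hny.1, hy.2])
      omega
    have hn' : periodize hL k f y = f (y - Pi.single k (n • L)) := rfl
    rw [hn']
    obtain h | h | h : n = m - 1 ∨ n = m ∨ n = m + 1 := by omega
    · rw [hz m (by omega), hz (m + 1) (by omega), h]; ring
    · rw [hz (m - 1) (by omega), hz (m + 1) (by omega), h]; ring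
    · rw [hz (m - 1) (by omega), hz m (by omega), h]; ring
  refine ContDiffAt.congr_of_eventuallyEq ?_ heq
  fun_prop

/-- The primitive in direction `z` of a compactly supported function. -/
def zPrimitive (ψ : Vec → ℝ) (x : Vec) : ℝ := ∫ s in Iio (x 2), ψ (ins ![x 0, x 1] s)

lemma ins_self (x : Vec) : ins ![x 0, x 1] (x 2) = x := by
  funext i
  fin_cases i <;> rfl

lemma horizontal_ins (y : Fin 2 → ℝ) (z : ℝ) : ![ins y z 0, ins y z 1] = y := by
  funext i
  fin_cases i <;> rfl

lemma contDiff_ins : ContDiff ℝ ∞ fun q : (Fin 2 → ℝ) × ℝ => ins q.1 q.2 := by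
  rw [contDiff_pi]
  intro i
  fin_cases i <;> simp [ins] <;> fun_prop

lemma continuous_ins (y : Fin 2 → ℝ) : Continuous (ins y) :=
  contDiff_ins.continuous.comp (f := fun z : ℝ => (y, z)) (by fun_prop)

lemma hasCompactSupport_comp_ins {ψ : Vec → ℝ} (hc : HasCompactSupport ψ) (y : Fin 2 → ℝ) :
    HasCompactSupport fun z => ψ (ins y z) := by
  obtain ⟨R, hR⟩ := hc.isCompact.isBounded.subset_closedBall (0 : Vec)
  refine HasCompactSupport.intro (isCompact_closedBall (0 : ℝ) R) fun z hz => ?_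
  by_contra hne
  have := hR (subset_tsupport _ (Function.mem_support.2 hne))
  rw [mem_closedBall_zero_iff] at this
  exact hz (mem_closedBall_zero_iff.2 ((norm_le_pi_norm (ins _ z) 2).trans this))

/-- The primitive is the convolution in `z` of the Heaviside function with `ψ`, the horizontal
coordinates being parameters; convolution with a smooth compactly supported function is jointly
smooth. -/
lemma contDiff_zPrimitive {ψ : Vec → ℝ} (hψ : ContDiff ℝ ∞ ψ) (hc : HasCompactSupport ψ) :
    ContDiff ℝ ∞ (zPrimitive ψ) := by
  obtain ⟨R, hR⟩ := hc.isCompact.isBounded.subset_closedBall (0 : Vec)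
  have hloc : LocallyIntegrable (indicator (Ioi (0 : ℝ)) fun _ => (1 : ℝ)) volume :=
    (locallyIntegrable_const 1).indicator measurableSet_Ioi
  have hg : ContDiffOn ℝ ∞ (↿fun (y : Fin 2 → ℝ) (z : ℝ) => ψ (ins y z)) (univ ×ˢ univ) :=
    (hψ.comp contDiff_ins).contDiffOn
  have h := contDiffOn_convolution_right_with_param (n := ⊤) (ContinuousLinearMap.mul ℝ ℝ)
    (f := indicator (Ioi (0 : ℝ)) fun _ => (1 : ℝ)) (g := fun (y : Fin 2 → ℝ) (z : ℝ) => ψ (ins y z))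
    (s := univ) (k := Metric.closedBall (0 : ℝ) R) isOpen_univ (isCompact_closedBall _ _)
    (by
      intro y z _ hz
      by_contra hne
      have := hR (subset_tsupport _ (Function.mem_support.2 hne))
      rw [mem_closedBall_zero_iff] at this
      exact hz (mem_closedBall_zero_iff.2 ((norm_le_pi_norm (ins y z) 2).trans this)))
    hloc hg (μ := volume)
  rw [univ_prod_univ, contDiffOn_univ] at h
  have hlin : ContDiff ℝ ∞ fun x : Vec => ((![x 0, x 1], x 2) : (Fin 2 → ℝ) × ℝ) := by
    refine ContDiff.prodMk ?_ (by fun_prop)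
    rw [contDiff_pi]
    intro i
    fin_cases i <;> simp <;> fun_prop
  convert h.comp hlin using 1
  funext x
  simp only [Function.comp_def, convolution, ContinuousLinearMap.mul_apply']
  rw [zPrimitive, ← integral_indicator measurableSet_Iio,
    ← integral_sub_left_eq_self _ volume (x 2)]
  refine integral_congr_ae (ae_of_all _ fun t => ?_)
  by_cases ht : 0 < t <;> simp [indicator, ht]

lemma pderiv_zPrimitive {ψ : Vec → ℝ} (hψ : ContDiff ℝ ∞ ψ) (hc : HasCompactSupport ψ) (x : Vec) :
    pderiv 2 (zPrimitive ψ) x = ψ x := by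
  have hd : HasFDerivAt (zPrimitive ψ) (fderiv ℝ (zPrimitive ψ) x) x :=
    ((contDiff_zPrimitive hψ hc).differentiable (by simp) x).hasFDerivAt
  have hline : HasDerivAt (fun s : ℝ => ins ![x 0, x 1] s) (Pi.single 2 1) (x 2) := by
    rw [hasDerivAt_pi]
    intro i
    fin_cases i
    · simpa [ins] using hasDerivAt_const (x 2) (x 0)
    · simpa [ins] using hasDerivAt_const (x 2) (x 1)
    · simpa [ins] using hasDerivAt_id' (x 2)
  have h1 : HasDerivAt (fun s => zPrimitive ψ (ins ![x 0, x 1] s)) (pderiv 2 (zPrimitive ψ) x)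
      (x 2) := by
    have := HasFDerivAt.comp_hasDerivAt (x 2) (by rwa [ins_self]) hline
    exact this
  have hcont : Continuous fun s : ℝ => ψ (ins ![x 0, x 1] s) :=
    hψ.continuous.comp (continuous_ins _)
  have hint : Integrable (fun s : ℝ => ψ (ins ![x 0, x 1] s)) :=
    hcont.integrable_of_hasCompactSupport (hasCompactSupport_comp_ins hc _)
  have h2 : HasDerivAt (fun s => zPrimitive ψ (ins ![x 0, x 1] s)) (ψ x) (x 2) := by
    have hF : (fun s => zPrimitive ψ (ins ![x 0, x 1] s)) = fun s =>
        (∫ t in Iic (x 2), ψ (ins ![x 0, x 1] t)) + ∫ t in (x 2)..s, ψ (ins ![x 0, x 1] t) := by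
      funext s
      have : zPrimitive ψ (ins ![x 0, x 1] s) = ∫ t in Iic s, ψ (ins ![x 0, x 1] t) := by
        rw [integral_Iic_eq_integral_Iio]
        rfl
      rw [this, ← intervalIntegral.integral_Iic_sub_Iic hint.integrableOn hint.integrableOn]
      ring
    rw [hF]
    have := (intervalIntegral.integral_hasDerivAt_right (b := x 2) (hint.intervalIntegrable (a := x 2))
      (hcont.stronglyMeasurableAtFilter _ _) hcont.continuousAt).const_add
        (∫ t in Iic (x 2), ψ (ins ![x 0, x 1] t))
    rwa [ins_self] at this
  exact h1.unique h2

/-- Integrating in `z` keeps the horizontal support, which is what periodization in `x` and `y`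
needs. The vertical support is lost: at the lid the primitive is the full line integral of `ψ`, and
this is how the lid value enters Green's formula. -/
lemma zPrimitive_eq_zero {L : ℝ} {ψ : Vec → ℝ} (hs : tsupport ψ ⊆ box L) {k : Fin 3} (hk : k ≠ 2)
    {x : Vec} (hx : x k ∉ Ioo 0 L) : zPrimitive ψ x = 0 := by
  have : ∀ s, ψ (ins ![x 0, x 1] s) = 0 := by
    intro s
    by_contra hne
    have h := mem_box.1 (hs (subset_tsupport _ (Function.mem_support.2 hne))) k
    apply hx
    fin_cases k
    · exact h
    · exact h
    · exact absurd rfl hk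
  simp [zPrimitive, this]

lemma zPrimitive_eq {L : ℝ} {ψ : Vec → ℝ} (hs : tsupport ψ ⊆ box L) (y : Fin 2 → ℝ)
    (z : ℝ) :
    zPrimitive ψ (ins y z) = ∫ s in Ioo 0 L, indicator (Iio z) (fun s => ψ (ins y s)) s := by
  have h0 : ∀ s, s ∉ Ioo 0 L → ψ (ins y s) = 0 := by
    intro s hsL
    by_contra hne
    exact hsL (mem_box.1 (hs (subset_tsupport _ (Function.mem_support.2 hne))) 2)
  rw [setIntegral_eq_integral_of_forall_compl_eq_zero, integral_indicator measurableSet_Iio,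
    zPrimitive, horizontal_ins, ins_two]
  intro s hsL
  simp [indicator, h0 s hsL]

/-- A smooth function, `L`-periodic in `x, y`, whose `z`-derivative in the box is `ψ`. -/
def testPrimitive {L : ℝ} (hL : 0 < L) (ψ : Vec → ℝ) : Vec → ℝ :=
  periodize hL 0 (periodize hL 1 (zPrimitive ψ))

lemma testPrimitive_eq {L : ℝ} (hL : 0 < L) {ψ : Vec → ℝ}
    {x : Vec} (h0 : x 0 ∈ Ico 0 L) (h1 : x 1 ∈ Ico 0 L) :
    testPrimitive hL ψ x = zPrimitive ψ x := by
  rw [testPrimitive, periodize_eq_self _ _ _ h0, periodize_eq_self _ _ _ h1]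

lemma xyPeriodic_testPrimitive {L : ℝ} (hL : 0 < L) {ψ : Vec → ℝ} :
    XYPeriodic L (testPrimitive hL ψ) := fun x =>
  ⟨periodize_add_same hL 0 _ x,
    periodize_add_of_ne hL (by decide) (fun x => periodize_add_same hL 1 _ x) x⟩

lemma contDiff_testPrimitive {L : ℝ} (hL : 0 < L) {ψ : Vec → ℝ} (hψ : ContDiff ℝ ∞ ψ)
    (hc : HasCompactSupport ψ) (hs : tsupport ψ ⊆ box L) : ContDiff ℝ ∞ (testPrimitive hL ψ) := by
  refine contDiff_periodize hL 0 (contDiff_periodize hL 1 (contDiff_zPrimitive hψ hc)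
    fun x hx => zPrimitive_eq_zero hs (by decide) hx) fun x hx => ?_
  refine zPrimitive_eq_zero hs (k := 0) (by decide) ?_
  simpa using hx

lemma pderiv_testPrimitive {L : ℝ} (hL : 0 < L) {ψ : Vec → ℝ} (hψ : ContDiff ℝ ∞ ψ)
    (hc : HasCompactSupport ψ) {x : Vec} (hx : x ∈ box L) :
    pderiv 2 (testPrimitive hL ψ) x = ψ x := by
  have : testPrimitive hL ψ =ᶠ[𝓝 x] zPrimitive ψ := by
    filter_upwards [(isOpen_box L).mem_nhds hx] with y hy
    exact testPrimitive_eq hL (Ioo_subset_Ico_self (mem_box.1 hy 0))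
      (Ioo_subset_Ico_self (mem_box.1 hy 1))
  rw [← pderiv_zPrimitive hψ hc x, pderiv, this.fderiv_eq, pderiv]

/-! ### From Green's formula to a representation on vertical lines. -/

/-- Exchanging the last two variables of a triple product. -/
lemma measurePreserving_swapRight {α β γ : Type*} [MeasurableSpace α] [MeasurableSpace β]
    [MeasurableSpace γ] (μa : Measure α) (μb : Measure β) (μc : Measure γ) [SFinite μa]
    [SFinite μb] [SFinite μc] :
    MeasurePreserving (fun q : (α × β) × γ => ((q.1.1, q.2), q.1.2))
      ((μa.prod μb).prod μc) ((μa.prod μc).prod μb) := by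
  have h1 := measurePreserving_prodAssoc μa μb μc
  have h2 : MeasurePreserving (Prod.map id Prod.swap) (μa.prod (μb.prod μc))
      (μa.prod (μc.prod μb)) := (MeasurePreserving.id μa).prod Measure.measurePreserving_swap
  have h3 := (measurePreserving_prodAssoc μa μc μb).symm _
  exact h3.comp (h2.comp h1)

/-- The integral of `d` along the vertical segment from `x` to the upper wall. -/
def upperIntegral (L : ℝ) (d : Vec → ℝ) (x : Vec) : ℝ :=
  ∫ ζ in Ioo 0 L, indicator (Ioi (x 2)) (fun ζ => d (ins ![x 0, x 1] ζ)) ζ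

lemma integrable_upperIntegrand {L : ℝ} {d : Vec → ℝ} (hd : IntegrableOn d (box L)) :
    Integrable (fun q : ((Fin 2 → ℝ) × ℝ) × ℝ =>
      indicator (Ioi q.1.2) (fun ζ => d (ins q.1.1 ζ)) q.2)
      (((volume.restrict (face L)).prod (volume.restrict (Ioo 0 L))).prod
        (volume.restrict (Ioo 0 L))) := by
  have h1 := ((integrable_box_iff L d).1 hd).comp_fst (volume.restrict (Ioo 0 L))
  have h2 := (measurePreserving_swapRight (volume.restrict (face L)) (volume.restrict (Ioo 0 L))
    (volume.restrict (Ioo 0 L))).integrable_comp_of_integrable h1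
  have hm : MeasurableSet {q : ((Fin 2 → ℝ) × ℝ) × ℝ | q.1.2 < q.2} :=
    measurableSet_lt (by fun_prop) (by fun_prop)
  refine (h2.indicator hm).congr (ae_of_all _ fun q => ?_)
  simp [indicator]

lemma integrableOn_upperIntegral {L : ℝ} {d : Vec → ℝ} (hd : IntegrableOn d (box L)) :
    IntegrableOn (upperIntegral L d) (box L) := by
  rw [integrable_box_iff]
  refine (integrable_upperIntegrand hd).integral_prod_left.congr (ae_of_all _ fun q => ?_)
  simp only [upperIntegral, horizontal_ins, ins_two]

/-- Fubini on the triangle `s < ζ` of each vertical line: the roles of the height of `ψ` and the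
height of `d` are exchanged. -/
lemma integral_mul_zPrimitive {L : ℝ} {d : Vec → ℝ} (hd : IntegrableOn d (box L))
    {ψ : Vec → ℝ} (hψ : ContDiff ℝ ∞ ψ) (hc : HasCompactSupport ψ)
    (hs : tsupport ψ ⊆ box L) :
    ∫ x in box L, d x * zPrimitive ψ x = ∫ x in box L, ψ x * upperIntegral L d x := by
  obtain ⟨C, hC⟩ := hψ.continuous.bounded_above_of_compact_support hc
  have hK : Integrable (fun q : ((Fin 2 → ℝ) × ℝ) × ℝ =>
      ψ (ins q.1.1 q.1.2) * indicator (Ioi q.1.2) (fun ζ => d (ins q.1.1 ζ)) q.2)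
      (((volume.restrict (face L)).prod (volume.restrict (Ioo 0 L))).prod
        (volume.restrict (Ioo 0 L))) := by
    refine (integrable_upperIntegrand hd).bdd_mul (c := C) ?_ (ae_of_all _ fun q => hC _)
    exact ((hψ.continuous.comp contDiff_ins.continuous).comp
      continuous_fst).aestronglyMeasurable
  have hT := measurePreserving_swapRight (volume.restrict (face L)) (volume.restrict (Ioo 0 L))
    (volume.restrict (Ioo 0 L))
  have hK2 := hT.integrable_comp_of_integrable hK
  have hE := hT.integral_comp' (f := ⟨⟨fun q => ((q.1.1, q.2), q.1.2),
    fun q => ((q.1.1, q.2), q.1.2), fun _ => rfl, fun _ => rfl⟩, hT.measurable, hT.measurable⟩)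
    (fun q : ((Fin 2 → ℝ) × ℝ) × ℝ =>
      ψ (ins q.1.1 q.1.2) * indicator (Ioi q.1.2) (fun ζ => d (ins q.1.1 ζ)) q.2)
  rw [integral_box, integral_box]
  have hR := integral_prod _ hK
  have hLeft := integral_prod _ hK2
  calc _ = _ := integral_congr_ae (ae_of_all _ fun q => ?_)
    _ = _ := hLeft.symm
    _ = _ := hE
    _ = _ := hR
    _ = _ := integral_congr_ae (ae_of_all _ fun q => ?_)
  · dsimp only [Function.comp_def]
    rw [zPrimitive_eq hs q.1, ← integral_const_mul]
    refine integral_congr_ae (ae_of_all _ fun s => ?_)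
    by_cases h : s < q.2 <;> simp [indicator, h, mul_comm]
  · dsimp only
    rw [integral_const_mul, upperIntegral, horizontal_ins]
    rfl

/-- `f` vanishes in the sense of traces up to the constant `a` on the upper wall: on almost every
vertical line it is obtained by integrating its vertical derivative `d` from that wall. -/
structure LineRep (L a : ℝ) (f d : Vec → ℝ) : Prop where
  memLp : MemLp f 2 (volume.restrict (box L))
  deriv_memLp : MemLp d 2 (volume.restrict (box L))
  rep : ∀ᵐ y ∂volume.restrict (face L), ∀ᵐ z ∂volume.restrict (Ioo 0 L),
    f (ins y z) = a - ∫ ζ in z..L, d (ins y ζ)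

/-- For `ψ` supported in the box, Green's formula in direction `z` is tested with the periodized
vertical primitive of `ψ`. Its derivative gives `∫ ψ f`, Fubini turns the gradient term into `∫ ψ`
times the integral of `g₂` up to the lid, and the lid term is `a ∫ ψ`. Since `ψ` is arbitrary, `f -
a + ∫_z^L g₂ = 0` almost everywhere. -/
lemma HasShearGradient.lineRep {L a : ℝ} (hL : 0 < L) {f : Vec → ℝ} {g : Vec → Vec}
    (h : HasShearGradient L a f g) : LineRep L a f fun x => g x 2 := by
  refine ⟨h.memLp, h.grad_memLp 2, ?_⟩
  have hf : IntegrableOn f (box L) := h.memLp.integrable one_le_two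
  have hd : IntegrableOn (fun x => g x 2) (box L) := (h.grad_memLp 2).integrable one_le_two
  have hU := integrableOn_upperIntegral hd
  set W : Vec → ℝ := fun x => f x - a + upperIntegral L (fun x => g x 2) x with hW
  have hWi : IntegrableOn W (box L) := (hf.sub (integrable_const a)).add hU
  have hzero : ∀ᵐ x, x ∈ box L → W x = 0 := by
    refine (isOpen_box L).ae_eq_zero_of_integral_contDiff_smul_eq_zero
      hWi.locallyIntegrableOn fun ψ hψ hc hs => ?_
    obtain ⟨C, hC⟩ := hψ.continuous.bounded_above_of_compact_support hc
    have hm : AEStronglyMeasurable ψ (volume.restrict (box L)) :=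
      hψ.continuous.aestronglyMeasurable
    have hbd : ∀ᵐ x ∂volume.restrict (box L), ‖ψ x‖ ≤ C := ae_of_all _ hC
    have hsupp : ∀ x, x ∉ box L → ψ x • W x = 0 := fun x hx => by
      have : ψ x = 0 := by
        by_contra hne
        exact hx (hs (subset_tsupport _ (Function.mem_support.2 hne)))
      simp [this]
    rw [← setIntegral_eq_integral_of_forall_compl_eq_zero hsupp]
    have hχ := contDiff_testPrimitive hL hψ hc hs
    have hgreen := h.green _ hχ (xyPeriodic_testPrimitive hL) 2
    rw [if_pos rfl] at hgreen
    have hI1 : IntegrableOn (fun x => ψ x * f x) (box L) := hf.bdd_mul hm hbd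
    have hI2 : IntegrableOn (fun x => ψ x * upperIntegral L (fun x => g x 2) x) (box L) :=
      hU.bdd_mul hm hbd
    have hI3 : IntegrableOn (fun x => ψ x * a) (box L) := (integrable_const a).bdd_mul hm hbd
    have hψi : IntegrableOn ψ (box L) := by
      simpa [IntegrableOn] using (integrable_const (1 : ℝ)).bdd_mul hm hbd
    have hI4 : IntegrableOn (fun x => g x 2 * zPrimitive ψ x) (box L) := by
      have hcz : ContinuousOn (zPrimitive ψ) (Icc (fun _ => 0) fun _ => L) :=
        (contDiff_zPrimitive hψ hc).continuous.continuousOn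
      obtain ⟨M, hM⟩ := isCompact_Icc.exists_bound_of_continuousOn hcz
      refine hd.mul_bdd (c := M)
        (contDiff_zPrimitive hψ hc).continuous.aestronglyMeasurable ?_
      filter_upwards [ae_restrict_mem (measurableSet_box L)] with x hx
      exact hM x ⟨fun i => (mem_box.1 hx i).1.le, fun i => (mem_box.1 hx i).2.le⟩
    have hlhs : ∫ x in box L, (f x * pderiv 2 (testPrimitive hL ψ) x
          + g x 2 * testPrimitive hL ψ x)
        = (∫ x in box L, ψ x * f x)
          + ∫ x in box L, ψ x * upperIntegral L (fun x => g x 2) x := by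
      rw [← integral_mul_zPrimitive hd hψ hc hs, ← integral_add hI1 hI4]
      refine setIntegral_congr_fun (measurableSet_box L) fun x hx => ?_
      rw [pderiv_testPrimitive hL hψ hc hx, testPrimitive_eq hL
        (Ioo_subset_Ico_self (mem_box.1 hx 0)) (Ioo_subset_Ico_self (mem_box.1 hx 1))]
      ring
    -- At height `L` the primitive is the integral of `ψ` over the whole vertical line, so the lid
    -- integral becomes an integral over the box.
    have hrhs : ∫ x in Ioo 0 L, ∫ y in Ioo 0 L, a * testPrimitive hL ψ ![x, y, L]
        = ∫ x in box L, ψ x * a := by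
      rw [integral_mul_const, integral_box, integral_prod _ ((integrable_box_iff L ψ).1 hψi),
        integral_face L ((integrable_box_iff L ψ).1 hψi).integral_prod_left, mul_comm,
        ← integral_const_mul]
      refine setIntegral_congr_fun measurableSet_Ioo fun x hx => ?_
      dsimp only
      rw [← integral_const_mul]
      refine setIntegral_congr_fun measurableSet_Ioo fun y hy => ?_
      congr 1
      rw [testPrimitive_eq hL (Ioo_subset_Ico_self hx) (Ioo_subset_Ico_self hy)]
      refine (zPrimitive_eq hs ![x, y] L).trans ?_
      refine setIntegral_congr_fun measurableSet_Ioo fun s hs' => ?_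
      simp [indicator, hs'.2]
    rw [hlhs, hrhs] at hgreen
    have hsplit : ∫ x in box L, ψ x • W x = ((∫ x in box L, ψ x * f x)
        + ∫ x in box L, ψ x * upperIntegral L (fun x => g x 2) x) - ∫ x in box L, ψ x * a := by
      rw [← integral_add hI1 hI2, ← integral_sub (by exact hI1.add hI2) hI3]
      refine integral_congr_ae (ae_of_all _ fun x => ?_)
      simp only [hW, smul_eq_mul]
      ring
    rw [hsplit, hgreen, sub_self]
  have := ae_box_iff L ((ae_restrict_iff' (measurableSet_box L)).2 hzero)
  filter_upwards [this] with y hy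
  filter_upwards [hy, ae_restrict_mem measurableSet_Ioo] with z hz hzI
  have hup : upperIntegral L (fun x => g x 2) (ins y z) = ∫ ζ in z..L, g (ins y ζ) 2 := by
    rw [upperIntegral, horizontal_ins, ins_two, integral_indicator measurableSet_Ioi,
      Measure.restrict_restrict measurableSet_Ioi, intervalIntegral.integral_of_le hzI.2.le,
      integral_Ioc_eq_integral_Ioo]
    congr 2
    ext ζ
    simp only [mem_inter_iff, mem_Ioi, mem_Ioo]
    exact ⟨fun h => ⟨h.1, h.2.2⟩, fun h => ⟨h.1, hzI.1.trans h.1, h.2⟩⟩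
  rw [← hup]
  have : f (ins y z) - a + upperIntegral L (fun x => g x 2) (ins y z) = 0 := hz
  linarith

/-! ### One-dimensional estimates on a vertical line. -/

/-- Cauchy–Schwarz against the constant `1`, obtained from the nonnegativity of the variance of `d`
about its mean `c`. -/
lemma sq_intervalIntegral_le {d : ℝ → ℝ} {a b : ℝ} (hab : a < b)
    (hd : MemLp d 2 (volume.restrict (Ioc a b))) :
    (∫ t in a..b, d t) ^ 2 ≤ (b - a) * ∫ t in a..b, d t ^ 2 := by
  have hi : IntervalIntegrable d volume a b :=
    (intervalIntegrable_iff_integrableOn_Ioc_of_le hab.le).2 (hd.integrable one_le_two)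
  have hi2 : IntervalIntegrable (fun t => d t ^ 2) volume a b :=
    (intervalIntegrable_iff_integrableOn_Ioc_of_le hab.le).2 hd.integrable_sq
  set I := ∫ t in a..b, d t with hI
  have hba : 0 < b - a := sub_pos.2 hab
  set c := I / (b - a) with hc
  have hcb : c * (b - a) = I := div_mul_cancel₀ _ hba.ne'
  have h0 : 0 ≤ ∫ t in a..b, (d t - c) ^ 2 :=
    intervalIntegral.integral_nonneg hab.le fun t _ => sq_nonneg _
  have he : ∫ t in a..b, (d t - c) ^ 2
      = (∫ t in a..b, d t ^ 2) - 2 * c * I + c ^ 2 * (b - a) := by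
    have : (fun t => (d t - c) ^ 2) = fun t => (d t ^ 2 - 2 * c * d t) + c ^ 2 := by
      funext t; ring
    rw [this, intervalIntegral.integral_add (hi2.sub (hi.const_mul _)) intervalIntegrable_const,
      intervalIntegral.integral_sub hi2 (hi.const_mul _), intervalIntegral.integral_const_mul,
      intervalIntegral.integral_const, smul_eq_mul]
    ring
  rw [he] at h0
  nlinarith [mul_nonneg hba.le h0]

/-- The product rule for `V²`, where `V` is the primitive of `d` that vanishes at `b`. It is valid
for merely integrable `d` because `V` is absolutely continuous. -/
lemma sq_intervalIntegral_eq {d : ℝ → ℝ} {a b : ℝ} (hd : IntervalIntegrable d volume a b) :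
    (∫ t in a..b, d t) ^ 2 = ∫ x in a..b, 2 * (d x * ∫ t in x..b, d t) := by
  have hV := hd.absolutelyContinuousOnInterval_intervalIntegral (c := b) right_mem_uIcc
  have h := hV.integral_deriv_mul_eq_sub hV
  have hc : ∫ x in a..b, (deriv (fun x => ∫ t in b..x, d t) x * (∫ t in b..x, d t)
      + (∫ t in b..x, d t) * deriv (fun x => ∫ t in b..x, d t) x)
      = ∫ x in a..b, -(2 * (d x * ∫ t in x..b, d t)) := by
    apply intervalIntegral.integral_congr_ae
    filter_upwards [hd.ae_hasDerivAt_integral] with x hx hxI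
    rw [(hx (uIoc_subset_uIcc hxI) b right_mem_uIcc).deriv, intervalIntegral.integral_symm x b]
    ring
  rw [hc, intervalIntegral.integral_neg, intervalIntegral.integral_same,
    intervalIntegral.integral_symm a b] at h
  linarith

lemma restrict_Ioc_eq_restrict_Ioo (a b : ℝ) :
    (volume : Measure ℝ).restrict (Ioc a b) = volume.restrict (Ioo a b) :=
  Measure.restrict_congr_set Ioo_ae_eq_Ioc.symm

/-- As `v` vanishes at `L`, Cauchy–Schwarz gives `v(z)² ≤ (L - z) ∫_z^L d²`. Where the weight is
nonzero, the last integral only sees the wall layer, so the constant is the first moment of `w`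
about the lid. -/
lemma lintegral_sq_mul_weight_le {L l : ℝ} {v d w : ℝ → ℝ} (hl : 0 ≤ l)
    (hd : MemLp d 2 (volume.restrict (Ioo 0 L)))
    (hv : ∀ᵐ z ∂volume.restrict (Ioo 0 L), v z = -∫ ζ in z..L, d ζ)
    (hw : Continuous w) (hw0 : ∀ z, 0 ≤ w z) (hwl : ∀ z ≤ L - l, w z = 0) :
    ∫⁻ z in Ioo 0 L, ENNReal.ofReal (v z ^ 2 * w z) ≤
      ENNReal.ofReal (∫ z in (L - l)..L, (L - z) * w z) *
        ∫⁻ z in Ioo (L - l) L, ENNReal.ofReal (d z ^ 2) := by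
  set D := ∫⁻ z in Ioo (L - l) L, ENNReal.ofReal (d z ^ 2) with hD
  have hpt : ∀ᵐ z ∂volume.restrict (Ioo 0 L), ENNReal.ofReal (v z ^ 2 * w z) ≤
      indicator (Ioo (L - l) L) (fun z => ENNReal.ofReal ((L - z) * w z)) z * D := by
    filter_upwards [hv, ae_restrict_mem measurableSet_Ioo] with z hz hzI
    by_cases hzl : z ≤ L - l
    · simp [hwl z hzl]
    push Not at hzl
    rw [indicator_of_mem (show z ∈ Ioo (L - l) L from ⟨hzl, hzI.2⟩)]
    have hdz : MemLp d 2 (volume.restrict (Ioc z L)) := by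
      rw [restrict_Ioc_eq_restrict_Ioo]
      exact hd.mono_measure (Measure.restrict_mono (Ioo_subset_Ioo_left hzI.1.le) le_rfl)
    have h1 := sq_intervalIntegral_le hzI.2 hdz
    have h2 : ENNReal.ofReal (∫ ζ in z..L, d ζ ^ 2) ≤ D := by
      rw [intervalIntegral.integral_of_le hzI.2.le, ofReal_integral_eq_lintegral_ofReal
        hdz.integrable_sq (ae_of_all _ fun _ => sq_nonneg _), restrict_Ioc_eq_restrict_Ioo]
      exact lintegral_mono_set (Ioo_subset_Ioo_left hzl.le)
    calc ENNReal.ofReal (v z ^ 2 * w z)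
        ≤ ENNReal.ofReal ((L - z) * w z * ∫ ζ in z..L, d ζ ^ 2) := by
          apply ENNReal.ofReal_le_ofReal
          rw [hz, neg_sq]
          nlinarith [mul_le_mul_of_nonneg_right h1 (hw0 z)]
      _ = ENNReal.ofReal ((L - z) * w z) * ENNReal.ofReal (∫ ζ in z..L, d ζ ^ 2) :=
          ENNReal.ofReal_mul (mul_nonneg (sub_nonneg.2 hzI.2.le) (hw0 z))
      _ ≤ _ := by gcongr
  have hcw : Continuous fun z => (L - z) * w z := by fun_prop
  refine (lintegral_mono_ae hpt).trans ?_
  rw [lintegral_mul_const _ (by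
    exact (hcw.measurable.ennreal_ofReal).indicator measurableSet_Ioo)]
  gcongr
  rw [lintegral_indicator measurableSet_Ioo, Measure.restrict_restrict measurableSet_Ioo,
    intervalIntegral.integral_of_le (by linarith), ofReal_integral_eq_lintegral_ofReal
      (hcw.integrableOn_Ioc) ?_, restrict_Ioc_eq_restrict_Ioo]
  · exact lintegral_mono_set inter_subset_left
  · filter_upwards [ae_restrict_mem measurableSet_Ioc] with z hz
    exact mul_nonneg (sub_nonneg.2 hz.2) (hw0 z)

lemma two_mul_abs_le {s P δ : ℝ} (hδ : 0 < δ) (h : s ^ 2 ≤ P) : 2 * |s| ≤ δ * P + 1 / δ := by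
  have h1 : 0 ≤ (δ * |s| - 1) ^ 2 / δ := by positivity
  have h2 : (δ * |s| - 1) ^ 2 / δ = δ * s ^ 2 - 2 * |s| + 1 / δ := by
    field_simp
    rw [← sq_abs s]
    ring
  nlinarith

/-- A sup bound from `|v(z)|² = -2∫_z^L v·d`: Cauchy–Schwarz in the index bounds `(v·d)²` by
`|v|²|d|²`, and `two_mul_abs_le` makes this product appear linearly with a small factor `δ`. The
product has the homogeneity of the eddy dissipation, so it can be absorbed later. -/
lemma sum_sq_le_lintegral {ι : Type*} [Fintype ι] {L δ : ℝ} (hδ : 0 < δ) {v d : ι → ℝ → ℝ}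
    (hd : ∀ m, MemLp (d m) 2 (volume.restrict (Ioo 0 L)))
    (hv : ∀ m, ∀ᵐ z ∂volume.restrict (Ioo 0 L), v m z = -∫ ζ in z..L, d m ζ) :
    ∀ᵐ z ∂volume.restrict (Ioo 0 L), ENNReal.ofReal (∑ m, v m z ^ 2) ≤
      ∫⁻ ζ in Ioo 0 L,
        ENNReal.ofReal (δ * ((∑ m, v m ζ ^ 2) * ∑ m, d m ζ ^ 2) + 1 / δ) := by
  have hv' := ae_all_iff.2 hv
  filter_upwards [hv', ae_restrict_mem measurableSet_Ioo] with z hz hzI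
  have hii : ∀ m, IntervalIntegrable (d m) volume z L := fun m => by
    rw [intervalIntegrable_iff_integrableOn_Ioc_of_le hzI.2.le, IntegrableOn,
      restrict_Ioc_eq_restrict_Ioo]
    exact ((hd m).mono_measure
      (Measure.restrict_mono (Ioo_subset_Ioo_left hzI.1.le) le_rfl)).integrable one_le_two
  have hprod : ∀ m, IntervalIntegrable (fun x => 2 * (d m x * ∫ t in x..L, d m t)) volume z L := by
    intro m
    refine IntervalIntegrable.const_mul ((hii m).mul_continuousOn ?_) 2
    have := ((hii m).absolutelyContinuousOnInterval_intervalIntegral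
      (c := L) right_mem_uIcc).continuousOn.neg
    refine this.congr fun x _ => ?_
    exact intervalIntegral.integral_symm L x
  have hsum : ∑ m, v m z ^ 2 = ∫ x in Ioo z L, ∑ m, 2 * (d m x * ∫ t in x..L, d m t) := by
    rw [← integral_Ioc_eq_integral_Ioo, ← intervalIntegral.integral_of_le hzI.2.le,
      intervalIntegral.integral_finsetSum fun m _ => hprod m]
    refine Finset.sum_congr rfl fun m _ => ?_
    rw [hz m, neg_sq, sq_intervalIntegral_eq (hii m)]
  rw [hsum]
  calc ENNReal.ofReal (∫ x in Ioo z L, ∑ m, 2 * (d m x * ∫ t in x..L, d m t))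
      ≤ ‖∫ x in Ioo z L, ∑ m, 2 * (d m x * ∫ t in x..L, d m t)‖ₑ := Real.ofReal_le_enorm _
    _ ≤ ∫⁻ x in Ioo z L, ‖∑ m, 2 * (d m x * ∫ t in x..L, d m t)‖ₑ :=
        enorm_integral_le_lintegral_enorm _
    _ ≤ ∫⁻ ζ in Ioo z L,
        ENNReal.ofReal (δ * ((∑ m, v m ζ ^ 2) * ∑ m, d m ζ ^ 2) + 1 / δ) := by
      refine lintegral_mono_ae ?_
      filter_upwards [ae_restrict_of_ae_restrict_of_subset
        (Ioo_subset_Ioo_left hzI.1.le) hv'] with x hx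
      rw [Real.enorm_eq_ofReal_abs]
      apply ENNReal.ofReal_le_ofReal
      rw [← Finset.mul_sum, abs_mul, abs_two]
      apply two_mul_abs_le hδ
      have hcs := Finset.sum_mul_sq_le_sq_mul_sq Finset.univ (fun m => d m x)
        fun m => ∫ t in x..L, d m t
      refine hcs.trans_eq ?_
      rw [mul_comm]
      congr 1
      refine Finset.sum_congr rfl fun m _ => ?_
      rw [hx m, neg_sq]
    _ ≤ _ := lintegral_mono_set (Ioo_subset_Ioo_left hzI.1.le)

/-! ### The line estimates integrated over the cross section. -/

lemma ae_memLp_line {L : ℝ} {d : Vec → ℝ} (hd : MemLp d 2 (volume.restrict (box L))) :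
    ∀ᵐ y ∂volume.restrict (face L), MemLp (fun z => d (ins y z)) 2 (volume.restrict (Ioo 0 L)) := by
  have hm := (measurePreserving_split_box L).quasiMeasurePreserving
  have h1 := (hd.1.comp_quasiMeasurePreserving hm).prodMk_left
  have h2 := ((integrable_box_iff L _).1 hd.integrable_sq).prod_right_ae
  filter_upwards [h1, h2] with y hy1 hy2
  simp only [Function.comp_def, splitEquiv_apply] at hy1
  exact (memLp_two_iff_integrable_sq hy1).2 hy2

/-- The part of the box at distance less than `l` from the upper wall. -/
def slab (L l : ℝ) : Set Vec := box L ∩ {x | L - l < x 2}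

lemma lintegral_slab {L l : ℝ} (hlL : l ≤ L) {F : Vec → ℝ≥0∞}
    (hF : AEMeasurable F (volume.restrict (box L))) :
    ∫⁻ x in slab L l, F x = ∫⁻ y in face L, ∫⁻ z in Ioo (L - l) L, F (ins y z) := by
  have hm : MeasurableSet {x : Vec | L - l < x 2} :=
    measurableSet_lt measurable_const (measurable_pi_apply 2)
  have h : ∫⁻ x in slab L l, F x = ∫⁻ x in box L, indicator {x | L - l < x 2} F x := by
    rw [lintegral_indicator hm, Measure.restrict_restrict hm, slab, inter_comm]
  rw [h, lintegral_box L (hF.indicator hm)]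
  refine lintegral_congr fun y => ?_
  have : ∀ z, indicator {x : Vec | L - l < x 2} F (ins y z)
      = indicator (Ioi (L - l)) (fun z => F (ins y z)) z := fun z => rfl
  simp only [this]
  rw [lintegral_indicator measurableSet_Ioi, Measure.restrict_restrict measurableSet_Ioi]
  congr 2
  ext z
  simp only [mem_inter_iff, mem_Ioi, mem_Ioo]
  exact ⟨fun h => ⟨h.1, h.2.2⟩, fun h => ⟨h.1, by linarith [h.1], h.2⟩⟩

/-- Weighted Poincaré inequality near the upper wall. -/
lemma LineRep.lintegral_sq_mul_weight_le {L l a : ℝ} {f d : Vec → ℝ} {w : ℝ → ℝ}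
    (h : LineRep L a f d) (hl : 0 ≤ l) (hlL : l ≤ L)
    (hw : Continuous w) (hw0 : ∀ z, 0 ≤ w z) (hwl : ∀ z ≤ L - l, w z = 0) :
    ∫⁻ x in box L, ENNReal.ofReal ((f x - a) ^ 2 * w (x 2)) ≤
      ENNReal.ofReal (∫ z in (L - l)..L, (L - z) * w z) *
        ∫⁻ x in slab L l, ENNReal.ofReal (d x ^ 2) := by
  have hf := h.memLp.1.aemeasurable
  have hd := h.deriv_memLp.1.aemeasurable
  have hw' : AEMeasurable (fun x : Vec => w (x 2)) (volume.restrict (box L)) :=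
    (hw.comp (continuous_apply 2)).aemeasurable
  rw [lintegral_box L (AEMeasurable.ennreal_ofReal
      (by exact ((hf.sub_const a).pow_const 2).mul hw')), lintegral_slab hlL (by fun_prop),
    ← lintegral_const_mul' _ _ ENNReal.ofReal_ne_top]
  refine lintegral_mono_ae ?_
  filter_upwards [ae_memLp_line h.deriv_memLp, h.rep] with y hy1 hy2
  refine EEV.lintegral_sq_mul_weight_le (v := fun z => f (ins y z) - a) hl hy1 ?_ hw hw0 hwl
  filter_upwards [hy2] with z hz
  rw [hz]
  ring

/-- On each line the bound of `sum_sq_le_lintegral` does not depend on the height, so the weight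
contributes only its integral. -/
lemma lintegral_sum_sq_mul_weight_le {ι : Type*} [Fintype ι] {L δ : ℝ} (hδ : 0 < δ) (hL : 0 ≤ L)
    {f d : ι → Vec → ℝ} {w : ℝ → ℝ} (h : ∀ m, LineRep L 0 (f m) (d m))
    (hw : Continuous w) (hw0 : ∀ z, 0 ≤ w z) :
    ∫⁻ x in box L, ENNReal.ofReal ((∑ m, f m x ^ 2) * w (x 2)) ≤
      ENNReal.ofReal (∫ z in 0..L, w z) * ∫⁻ x in box L,
        ENNReal.ofReal (δ * ((∑ m, f m x ^ 2) * ∑ m, d m x ^ 2) + 1 / δ) := by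
  have hf := fun m => (h m).memLp.1.aemeasurable
  have hd := fun m => (h m).deriv_memLp.1.aemeasurable
  have hw' : AEMeasurable (fun x : Vec => w (x 2)) (volume.restrict (box L)) :=
    (hw.comp (continuous_apply 2)).aemeasurable
  have hq : AEMeasurable (fun x => ∑ m, f m x ^ 2) (volume.restrict (box L)) := by fun_prop
  rw [lintegral_box L (AEMeasurable.ennreal_ofReal (by exact hq.mul hw')), lintegral_box L (by fun_prop),
    ← lintegral_const_mul' _ _ ENNReal.ofReal_ne_top]
  refine lintegral_mono_ae ?_
  filter_upwards [ae_all_iff.2 fun m => ae_memLp_line (h m).deriv_memLp,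
    ae_all_iff.2 fun m => (h m).rep] with y hy1 hy2
  have hline := sum_sq_le_lintegral (L := L) hδ (v := fun m z => f m (ins y z)) hy1
    fun m => by
      filter_upwards [hy2 m] with z hz
      rw [hz]
      ring
  rw [intervalIntegral.integral_of_le hL, ofReal_integral_eq_lintegral_ofReal
    hw.integrableOn_Ioc (ae_of_all _ hw0), restrict_Ioc_eq_restrict_Ioo,
    ← lintegral_mul_const _ (by fun_prop)]
  refine lintegral_mono_ae ?_
  filter_upwards [hline] with z hz
  rw [ENNReal.ofReal_mul (Finset.sum_nonneg fun _ _ => sq_nonneg _), mul_comm]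
  exact mul_le_mul_right hz _

/-! ### The background flow. -/

/-- The function of `z` that vanishes below `L - l` and grows linearly to `1` at `z = L`. -/
def ramp (L l z : ℝ) : ℝ := max 0 ((z - (L - l)) / l)

lemma continuous_ramp (L l : ℝ) : Continuous (ramp L l) := by
  unfold ramp
  fun_prop

lemma ramp_eq_zero {L l z : ℝ} (hl : 0 < l) (hz : z ≤ L - l) : ramp L l z = 0 :=
  max_eq_left (div_nonpos_of_nonpos_of_nonneg (by linarith) hl.le)

lemma ramp_eq {L l z : ℝ} (hl : 0 < l) (hz : L - l ≤ z) : ramp L l z = (z - (L - l)) / l :=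
  max_eq_right (div_nonneg (by linarith) hl.le)

lemma ramp_top {L l : ℝ} (hl : 0 < l) : ramp L l L = 1 := by
  rw [ramp_eq hl (by linarith)]
  field_simp
  ring

/-- Squaring removes the kink of the ramp: the profile is `C¹`, and the divergence theorem applies
to it directly. -/
lemma hasDerivAt_max_zero_sq (t : ℝ) :
    HasDerivAt (fun s : ℝ => (max 0 s) ^ 2) (2 * max 0 t) t := by
  rcases lt_trichotomy t 0 with ht | rfl | ht
  · rw [max_eq_left ht.le, mul_zero]
    refine (hasDerivAt_const t (0 : ℝ)).congr_of_eventuallyEq ?_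
    filter_upwards [Iio_mem_nhds ht] with s hs
    rw [max_eq_left (le_of_lt hs)]
    simp
  · rw [max_self, mul_zero, hasDerivAt_iff_isLittleO]
    simp only [max_self, sub_zero, smul_zero, ne_eq, OfNat.ofNat_ne_zero, not_false_eq_true,
      zero_pow]
    refine Asymptotics.IsBigO.trans_isLittleO (g := fun s : ℝ => s ^ 2) ?_ ?_
    · refine Asymptotics.IsBigO.of_bound 1 (Eventually.of_forall fun s => ?_)
      rw [one_mul, norm_pow, norm_pow]
      gcongr
      rw [Real.norm_eq_abs, Real.norm_eq_abs, abs_of_nonneg (le_max_left _ _)]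
      exact max_le (abs_nonneg s) (le_abs_self s)
    · simpa using Asymptotics.isLittleO_pow_id (𝕜 := ℝ) one_lt_two
  · rw [max_eq_right ht.le]
    have h := hasDerivAt_pow 2 t
    norm_num at h
    refine h.congr_of_eventuallyEq ?_
    filter_upwards [Ioi_mem_nhds ht] with s hs
    rw [max_eq_right (le_of_lt hs)]

/-- The background velocity profile. -/
def profile (L U l z : ℝ) : ℝ := U * ramp L l z ^ 2

/-- The derivative of the background velocity profile. -/
def profile' (L U l z : ℝ) : ℝ := 2 * U / l * ramp L l z

lemma continuous_profile (L U l : ℝ) : Continuous (profile L U l) :=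
  continuous_const.mul ((continuous_ramp L l).pow 2)

lemma continuous_profile' (L U l : ℝ) : Continuous (profile' L U l) :=
  continuous_const.mul (continuous_ramp L l)

lemma hasDerivAt_profile (L U l z : ℝ) : HasDerivAt (profile L U l) (profile' L U l z) z := by
  have h1 : HasDerivAt (fun z => (z - (L - l)) / l) (1 / l) z :=
    ((hasDerivAt_id' z).sub_const _).div_const l
  have h2 := ((hasDerivAt_max_zero_sq ((z - (L - l)) / l)).comp z h1).const_mul U
  refine h2.congr_deriv ?_
  simp only [profile', ramp]
  ring

lemma profile_eq_zero {L U l z : ℝ} (hl : 0 < l) (hz : z ≤ L - l) : profile L U l z = 0 := by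
  simp [profile, ramp_eq_zero hl hz]

lemma profile'_eq_zero {L U l z : ℝ} (hl : 0 < l) (hz : z ≤ L - l) : profile' L U l z = 0 := by
  simp [profile', ramp_eq_zero hl hz]

lemma contDiff_profile (L U l : ℝ) : ContDiff ℝ 1 (profile L U l) := by
  rw [contDiff_one_iff_deriv]
  refine ⟨fun z => (hasDerivAt_profile L U l z).differentiableAt, ?_⟩
  have : deriv (profile L U l) = profile' L U l :=
    funext fun z => (hasDerivAt_profile L U l z).deriv
  rw [this]
  exact continuous_profile' L U l

/-- Integrals of functions supported near the wall, in terms of the distance from the inner edge of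
the wall layer. -/
lemma integral_ramp {L l : ℝ} (hl : 0 < l) (F : ℝ → ℝ → ℝ) :
    ∫ z in (L - l)..L, F z (ramp L l z) = ∫ s in (0 : ℝ)..l, F (s + (L - l)) (s / l) := by
  have h := intervalIntegral.integral_comp_add_right (a := 0) (b := l)
    (fun z => F z (ramp L l z)) (L - l)
  rw [zero_add, add_sub_cancel] at h
  rw [← h]
  refine intervalIntegral.integral_congr fun s hs => ?_
  rw [uIcc_of_le hl.le] at hs
  rw [ramp_eq hl (by linarith [hs.1])]
  congr 2
  ring

lemma integral_eq_integral_layer {L l : ℝ} (hlL : l ≤ L) {w : ℝ → ℝ} (hw : Continuous w)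
    (h0 : ∀ z ≤ L - l, w z = 0) : ∫ z in (0 : ℝ)..L, w z = ∫ z in (L - l)..L, w z := by
  rw [← intervalIntegral.integral_add_adjacent_intervals (hw.intervalIntegrable 0 (L - l))
    (hw.intervalIntegrable _ _)]
  have : ∫ z in (0 : ℝ)..(L - l), w z = 0 := by
    rw [intervalIntegral.integral_congr (g := fun _ => 0) fun z hz => ?_,
      intervalIntegral.integral_zero]
    rw [uIcc_of_le (by linarith)] at hz
    exact h0 z hz.2
  rw [this, zero_add]

lemma integral_profile'_sq {L U l : ℝ} (hl : 0 < l) (hlL : l ≤ L) :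
    ∫ z in (0 : ℝ)..L, profile' L U l z ^ 2 = 4 * U ^ 2 / (3 * l) := by
  rw [integral_eq_integral_layer hlL (by exact (continuous_profile' L U l).pow 2)
    fun z hz => by rw [profile'_eq_zero hl hz]; simp]
  refine (integral_ramp hl fun _ r => (2 * U / l * r) ^ 2).trans ?_
  have : (fun s : ℝ => (2 * U / l * (s / l)) ^ 2) = fun s => (4 * U ^ 2 / l ^ 4) * s ^ 2 := by
    funext s
    field_simp
    ring
  rw [this, intervalIntegral.integral_const_mul, integral_pow]
  field_simp
  norm_num

lemma integral_profile_sq {L U l : ℝ} (hl : 0 < l) (hlL : l ≤ L) :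
    ∫ z in (0 : ℝ)..L, profile L U l z ^ 2 = U ^ 2 * l / 5 := by
  rw [integral_eq_integral_layer hlL (by exact (continuous_profile L U l).pow 2)
    fun z hz => by rw [profile_eq_zero hl hz]; simp]
  refine (integral_ramp hl fun _ r => (U * r ^ 2) ^ 2).trans ?_
  have : (fun s : ℝ => (U * (s / l) ^ 2) ^ 2) = fun s => (U ^ 2 / l ^ 4) * s ^ 4 := by
    funext s
    field_simp
  rw [this, intervalIntegral.integral_const_mul, integral_pow]
  field_simp
  norm_num

/-- The Poincaré constant for the weight `φ'²`. It is independent of `l`, so the bound for the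
fluctuations does not deteriorate as the layer shrinks. -/
lemma integral_mul_profile'_sq {L U l : ℝ} (hl : 0 < l) :
    ∫ z in (L - l)..L, (L - z) * profile' L U l z ^ 2 = U ^ 2 / 3 := by
  refine (integral_ramp hl fun z r => (L - z) * (2 * U / l * r) ^ 2).trans ?_
  have : (fun s : ℝ => (L - (s + (L - l))) * (2 * U / l * (s / l)) ^ 2)
      = fun s => (4 * U ^ 2 / l ^ 3) * s ^ 2 - (4 * U ^ 2 / l ^ 4) * s ^ 3 := by
    funext s
    field_simp
    ring
  rw [this, intervalIntegral.integral_sub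
      (Continuous.intervalIntegrable (by fun_prop) _ _)
      (Continuous.intervalIntegrable (by fun_prop) _ _),
    intervalIntegral.integral_const_mul, intervalIntegral.integral_const_mul, integral_pow,
    integral_pow]
  field_simp
  norm_num
  ring

/-- The Poincaré constant for the weight `φ²`. Its factor `l²` is what makes the convective term
small in a thin layer. -/
lemma integral_mul_profile_sq {L U l : ℝ} (hl : 0 < l) :
    ∫ z in (L - l)..L, (L - z) * profile L U l z ^ 2 = U ^ 2 * l ^ 2 / 30 := by
  refine (integral_ramp hl fun z r => (L - z) * (U * r ^ 2) ^ 2).trans ?_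
  have : (fun s : ℝ => (L - (s + (L - l))) * (U * (s / l) ^ 2) ^ 2)
      = fun s => (U ^ 2 / l ^ 3) * s ^ 4 - (U ^ 2 / l ^ 4) * s ^ 5 := by
    funext s
    field_simp
    ring
  rw [this, intervalIntegral.integral_sub
      (Continuous.intervalIntegrable (by fun_prop) _ _)
      (Continuous.intervalIntegrable (by fun_prop) _ _),
    intervalIntegral.integral_const_mul, intervalIntegral.integral_const_mul, integral_pow,
    integral_pow]
  field_simp
  norm_num
  ring

/-- The background velocity field. -/
def background (L U l : ℝ) (x : Vec) : Vec := ![profile L U l (x 2), 0, 0]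

/-- The gradient of the background velocity field. -/
def backgroundGrad (L U l : ℝ) (x : Vec) : Grad := ![![0, 0, profile' L U l (x 2)], 0, 0]

lemma memLp_of_continuous {L : ℝ} {F : Vec → ℝ} (hF : Continuous F) :
    MemLp F 2 (volume.restrict (box L)) := by
  obtain ⟨M, hM⟩ := (isCompact_Icc (a := fun _ : Fin 3 => (0 : ℝ))
    (b := fun _ => L)).exists_bound_of_continuousOn hF.continuousOn
  refine MemLp.of_bound hF.aestronglyMeasurable M ?_
  filter_upwards [ae_restrict_mem (measurableSet_box L)] with x hx
  exact hM x ⟨fun i => (mem_box.1 hx i).1.le, fun i => (mem_box.1 hx i).2.le⟩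

lemma pderiv_profile_mul (L U l : ℝ) {χ : Vec → ℝ} (hχ : ContDiff ℝ ∞ χ) (k : Fin 3) (x : Vec) :
    pderiv k (fun x => profile L U l (x 2) * χ x) x =
      profile L U l (x 2) * pderiv k χ x
        + (if k = 2 then profile' L U l (x 2) else 0) * χ x := by
  have h1 : HasFDerivAt (fun x : Vec => profile L U l (x 2))
      (profile' L U l (x 2) • ContinuousLinearMap.proj (R := ℝ) (φ := fun _ : Fin 3 => ℝ) 2) x :=
    HasDerivAt.comp_hasFDerivAt (h₂ := profile L U l) (f := fun x : Vec => x 2) x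
      (hasDerivAt_profile L U l (x 2)) (hasFDerivAt_apply 2 x)
  have h2 := (hχ.differentiable (by simp) x).hasFDerivAt
  have h3 := h1.fun_mul h2
  rw [pderiv, HasFDerivAt.fderiv h3]
  simp only [add_apply, smul_apply, smul_eq_mul,
    ContinuousLinearMap.proj_apply, pderiv, Pi.single_apply]
  by_cases hk : k = 2
  · simp [hk, mul_comm]
  · simp [hk, Ne.symm hk]

/-- The divergence theorem for the profile times `χ`. In `x` and `y` the opposite faces cancel by
periodicity of `χ`; in `z` the bottom contributes nothing, since `l ≤ L` makes the profile vanish at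
`0`, and at the lid its value is `U`. -/
lemma hasShearGradient_profile {L U l : ℝ} (hL : 0 < L) (hl : 0 < l) (hlL : l ≤ L) :
    HasShearGradient L U (fun x => profile L U l (x 2))
      (fun x => ![0, 0, profile' L U l (x 2)]) where
  memLp := memLp_of_continuous ((continuous_profile L U l).comp (continuous_apply 2))
  grad_memLp k := by
    fin_cases k
    · exact memLp_of_continuous continuous_const
    · exact memLp_of_continuous continuous_const
    · exact memLp_of_continuous ((continuous_profile' L U l).comp (continuous_apply 2))
  green χ hχ hper k := by
    have hF : ContDiff ℝ 1 fun x : Vec => profile L U l (x 2) * χ x :=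
      ((contDiff_profile L U l).comp (contDiff_apply ℝ ℝ 2)).mul (hχ.of_le (by simp))
    have hstart : ∫ x in box L, (profile L U l (x 2) * pderiv k χ x
        + (![0, 0, profile' L U l (x 2)] : Vec) k * χ x)
        = ∫ x in box L, pderiv k (fun x => profile L U l (x 2) * χ x) x := by
      refine integral_congr_ae (ae_of_all _ fun x => ?_)
      dsimp only
      rw [pderiv_profile_mul L U l hχ]
      congr 2
      fin_cases k <;> simp
    rw [hstart, integral_box_pderiv hL k hF]
    have hins : ∀ y z, (Fin.insertNth (α := fun _ => ℝ) (2 : Fin 3) z y : Vec) = ins y z :=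
      fun y z => (ins_eq_insertNth y z).symm
    have hper' : ∀ k : Fin 3, ∀ y : Fin 2 → ℝ, (k.insertNth (α := fun _ => ℝ) L y : Vec)
        = k.insertNth (α := fun _ => ℝ) 0 y + Pi.single k L := by
      intro k y
      funext i
      rcases eq_or_ne i k with rfl | hik
      · simp
      · obtain ⟨j, rfl⟩ := Fin.exists_succAbove_eq hik
        simp
    by_cases hk : k = 2
    · subst hk
      rw [if_pos rfl]
      simp only [hins, ins_two]
      have h0 : profile L U l 0 = 0 := profile_eq_zero hl (by linarith)
      have h1 : profile L U l L = U := by simp [profile, ramp_top hl]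
      simp only [h0, h1, zero_mul, sub_zero]
      have hc : Continuous fun y : Fin 2 → ℝ => U * χ (ins y L) :=
        continuous_const.mul (hχ.continuous.comp
          (contDiff_ins.continuous.comp (f := fun y : Fin 2 → ℝ => (y, L)) (by fun_prop)))
      rw [integral_face L ((hc.continuousOn.integrableOn_compact
        (isCompact_Icc (a := fun _ => 0) (b := fun _ => L))).mono_set
        (fun y hy => ⟨fun i => (hy i trivial).1.le, fun i => (hy i trivial).2.le⟩))]
      rfl
    · rw [if_neg hk]
      have : ∀ y : Fin 2 → ℝ, profile L U l ((k.insertNth (α := fun _ => ℝ) L y : Vec) 2)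
          * χ (k.insertNth (α := fun _ => ℝ) L y)
          - profile L U l ((k.insertNth (α := fun _ => ℝ) 0 y : Vec) 2)
          * χ (k.insertNth (α := fun _ => ℝ) 0 y) = 0 := by
        intro y
        have h2 : (Pi.single k L : Vec) 2 = 0 := Pi.single_eq_of_ne (Ne.symm hk) _
        have h3 : χ (k.insertNth (α := fun _ => ℝ) 0 y + Pi.single k L)
            = χ (k.insertNth (α := fun _ => ℝ) 0 y) := by
          obtain rfl | rfl : k = 0 ∨ k = 1 := by omega
          · exact (hper _).1
          · exact (hper _).2
        rw [hper' k y, h3, Pi.add_apply, h2, add_zero, sub_self]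
      simp [this]

lemma hasShearGradient_zero (L : ℝ) : HasShearGradient L 0 (fun _ => 0) (fun _ => 0) where
  memLp := MemLp.zero
  grad_memLp _ := MemLp.zero
  green χ _ _ k := by simp

lemma isShearField_background {L U l : ℝ} (hL : 0 < L) (hl : 0 < l) (hlL : l ≤ L) :
    IsShearField L U (background L U l) (backgroundGrad L U l) where
  grad i := by
    fin_cases i
    · exact hasShearGradient_profile hL hl hlL
    · exact hasShearGradient_zero L
    · exact hasShearGradient_zero L
  div_free := ae_of_all _ fun x => by simp [backgroundGrad, Fin.sum_univ_three]

/-! ### Fluctuations about the ensemble mean. -/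

lemma sum_sub_ensMean_sq_le {J : ℕ} (a : Fin J → ℝ) :
    ∑ j, (a j - ensMean a) ^ 2 ≤ ∑ j, a j ^ 2 := by
  rcases Nat.eq_zero_or_pos J with rfl | hJ
  · simp
  have hJ' : (J : ℝ) ≠ 0 := by positivity
  have hs : ∑ j, a j = J * ensMean a := by
    rw [ensMean]
    field_simp
  have : ∑ j, (a j - ensMean a) ^ 2 = ∑ j, a j ^ 2 - J * ensMean a ^ 2 := by
    have h : ∀ j, (a j - ensMean a) ^ 2 = a j ^ 2 - 2 * ensMean a * a j + ensMean a ^ 2 :=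
      fun j => by ring
    simp only [h]
    rw [Finset.sum_add_distrib, Finset.sum_sub_distrib, ← Finset.mul_sum, hs]
    simp only [Finset.sum_const, Finset.card_univ, Fintype.card_fin, nsmul_eq_mul]
    ring
  rw [this]
  have : 0 ≤ (J : ℝ) * ensMean a ^ 2 := by positivity
  linarith

lemma normSq_nonneg (v : Vec) : 0 ≤ normSq v := Finset.sum_nonneg fun _ _ => sq_nonneg _

lemma gradSq_nonneg (A : Grad) : 0 ≤ gradSq A :=
  Finset.sum_nonneg fun _ _ => Finset.sum_nonneg fun _ _ => sq_nonneg _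

lemma sum_normSq_fluct_le {J : ℕ} (u : Fin J → ℝ → Vec → Vec) (t : ℝ) (x : Vec) :
    ∑ j, normSq (fluct u j t x) ≤ ∑ j, normSq (u j t x) := by
  simp only [normSq]
  rw [Finset.sum_comm, Finset.sum_comm (s := Finset.univ (α := Fin J))]
  exact Finset.sum_le_sum fun i _ => sum_sub_ensMean_sq_le fun j => u j t x i

lemma sum_normSq_fluctDz_le {J : ℕ} (Du : Fin J → ℝ → Vec → Grad) (t : ℝ) (x : Vec) :
    ∑ j, normSq (fluctDz Du j t x) ≤ ∑ j, gradSq (Du j t x) := by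
  have h : ∑ j, normSq (fluctDz Du j t x) ≤ ∑ j, ∑ i, Du j t x i 2 ^ 2 := by
    simp only [normSq]
    rw [Finset.sum_comm, Finset.sum_comm (s := Finset.univ (α := Fin J))]
    exact Finset.sum_le_sum fun i _ => sum_sub_ensMean_sq_le fun j => Du j t x i 2
  refine h.trans (Finset.sum_le_sum fun j _ => Finset.sum_le_sum fun i _ => ?_)
  exact Finset.single_le_sum (f := fun k => Du j t x i k ^ 2) (fun _ _ => sq_nonneg _)
    (Finset.mem_univ 2)

lemma nuTurb_nonneg {p : Params} (hμ : 0 < p.μ) (hτ : 0 < p.τ) {J : ℕ}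
    (u : Fin J → ℝ → Vec → Vec) (t : ℝ) (x : Vec) : 0 ≤ nuTurb p u t x :=
  mul_nonneg (mul_pos hμ hτ).le
    (div_nonneg (Finset.sum_nonneg fun _ _ => normSq_nonneg _) (Nat.cast_nonneg _))

lemma nuTurb_eq (p : Params) {J : ℕ} (u : Fin J → ℝ → Vec → Vec) (t : ℝ) (x : Vec) :
    nuTurb p u t x = p.μ * p.τ / J * ∑ j, normSq (fluct u j t x) := by
  rw [nuTurb, ensMean]
  ring

/-- The representation is affine in `f` and `d`, and the lid value `a` is common to all
realizations, so it cancels: fluctuations vanish on the lid. -/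
lemma LineRep.sub_ensMean {J : ℕ} (hJ : 0 < J) {L a : ℝ} {f d : Fin J → Vec → ℝ}
    (h : ∀ l, LineRep L a (f l) (d l)) (j : Fin J) :
    LineRep L 0 (fun x => f j x - ensMean fun l => f l x)
      (fun x => d j x - ensMean fun l => d l x) := by
  have hJ' : (J : ℝ) ≠ 0 := by positivity
  have hmem : ∀ f : Fin J → Vec → ℝ, (∀ l, MemLp (f l) 2 (volume.restrict (box L))) →
      MemLp (fun x => f j x - ensMean fun l => f l x) 2 (volume.restrict (box L)) := by
    intro f hf
    refine (hf j).sub ?_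
    have := (memLp_finsetSum Finset.univ fun l _ => hf l).const_mul (J : ℝ)⁻¹
    refine this.congr_norm ?_ (ae_of_all _ fun x => ?_)
    · exact (this.1).congr (ae_of_all _ fun x => by simp [ensMean, div_eq_inv_mul])
    · simp [ensMean, div_eq_inv_mul]
  refine ⟨hmem f fun l => (h l).memLp, hmem d fun l => (h l).deriv_memLp, ?_⟩
  filter_upwards [ae_all_iff.2 fun l => ae_memLp_line (h l).deriv_memLp,
    ae_all_iff.2 fun l => (h l).rep] with y hy1 hy2
  filter_upwards [ae_all_iff.2 hy2, ae_restrict_mem measurableSet_Ioo] with z hz hzI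
  have hii : ∀ l, IntervalIntegrable (fun ζ => d l (ins y ζ)) volume z L := fun l => by
    rw [intervalIntegrable_iff_integrableOn_Ioc_of_le hzI.2.le, IntegrableOn,
      restrict_Ioc_eq_restrict_Ioo]
    exact ((hy1 l).mono_measure
      (Measure.restrict_mono (Ioo_subset_Ioo_left hzI.1.le) le_rfl)).integrable one_le_two
  have hsum : IntervalIntegrable (fun ζ => ∑ l, d l (ins y ζ)) volume z L := by
    have := IntervalIntegrable.sum Finset.univ fun l _ => hii l
    rwa [Finset.sum_fn] at this
  simp only [ensMean]
  rw [intervalIntegral.integral_sub (hii j) (hsum.div_const _), intervalIntegral.integral_div,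
    intervalIntegral.integral_finsetSum fun l _ => hii l]
  simp only [hz]
  rw [Finset.sum_sub_distrib]
  simp only [Finset.sum_const, Finset.card_univ, Fintype.card_fin, nsmul_eq_mul]
  field_simp
  ring

/-! ### Estimates at a fixed time. -/

/-- The sum of `|∇u j|²` over the ensemble. -/
def sumGradSq {J : ℕ} (Du : Fin J → ℝ → Vec → Grad) (t : ℝ) (x : Vec) : ℝ :=
  ∑ j, gradSq (Du j t x)

/-- The sum of `|u′ j|²` over the ensemble. -/
def sumFluctSq {J : ℕ} (u : Fin J → ℝ → Vec → Vec) (t : ℝ) (x : Vec) : ℝ :=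
  ∑ j, normSq (fluct u j t x)

/-- The sum of `|∂u′ j/∂z|²` over the ensemble. -/
def sumFluctDzSq {J : ℕ} (Du : Fin J → ℝ → Vec → Grad) (t : ℝ) (x : Vec) : ℝ :=
  ∑ j, normSq (fluctDz Du j t x)

lemma sumGradSq_nonneg {J : ℕ} (Du : Fin J → ℝ → Vec → Grad) (t : ℝ) (x : Vec) :
    0 ≤ sumGradSq Du t x := Finset.sum_nonneg fun _ _ => gradSq_nonneg _

lemma sumFluctSq_nonneg {J : ℕ} (u : Fin J → ℝ → Vec → Vec) (t : ℝ) (x : Vec) :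
    0 ≤ sumFluctSq u t x := Finset.sum_nonneg fun _ _ => normSq_nonneg _

/-- The total dissipation of the ensemble at time `t`. -/
def totalDissipation (p : Params) {J : ℕ} (u : Fin J → ℝ → Vec → Vec)
    (Du : Fin J → ℝ → Vec → Grad) (t : ℝ) : ℝ≥0∞ :=
  ∫⁻ x in box p.L, ENNReal.ofReal ((p.ν + nuTurb p u t x) * sumGradSq Du t x)

/-- The total squared gradient of the ensemble at time `t`. -/
def totalGradSq (p : Params) {J : ℕ} (Du : Fin J → ℝ → Vec → Grad) (t : ℝ) : ℝ≥0∞ :=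
  ∫⁻ x in box p.L, ENNReal.ofReal (sumGradSq Du t x)

/-- The total squared fluctuation, weighted with the squared background gradient. -/
def weightedFluct (p : Params) (l : ℝ) {J : ℕ} (u : Fin J → ℝ → Vec → Vec) (t : ℝ) : ℝ≥0∞ :=
  ∫⁻ x in box p.L, ENNReal.ofReal (sumFluctSq u t x * profile' p.L p.U l (x 2) ^ 2)

section
variable {p : Params} {J : ℕ} {u : Fin J → ℝ → Vec → Vec} {Du : Fin J → ℝ → Vec → Grad} {t l : ℝ}

lemma lineRep_velocity (hL : 0 < p.L) (ht : ∀ j, IsShearField p.L p.U (u j t) (Du j t))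
    (j : Fin J) (i : Fin 3) :
    LineRep p.L (lid p.U i) (fun x => u j t x i) (fun x => Du j t x i 2) :=
  ((ht j).grad i).lineRep hL

lemma lineRep_fluct (hL : 0 < p.L) (ht : ∀ j, IsShearField p.L p.U (u j t) (Du j t))
    (j : Fin J) (i : Fin 3) :
    LineRep p.L 0 (fun x => fluct u j t x i) (fun x => fluctDz Du j t x i) :=
  LineRep.sub_ensMean (j.pos) (fun j => lineRep_velocity hL ht j i) j

/-- The weighted Poincaré inequality for each component of each fluctuation. This produces the near
wall integral of the theorem. -/
lemma weightedFluct_le_slab (hL : 0 < p.L) (ht : ∀ j, IsShearField p.L p.U (u j t) (Du j t))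
    (hl : 0 < l) (hlL : l ≤ p.L) :
    weightedFluct p l u t ≤ ENNReal.ofReal (p.U ^ 2 / 3) *
      ∫⁻ x in slab p.L l, ENNReal.ofReal (sumFluctDzSq Du t x) := by
  have hrep := lineRep_fluct hL ht
  have hw : Continuous fun z => profile' p.L p.U l z ^ 2 := (continuous_profile' _ _ _).pow 2
  have hf : ∀ j i, AEMeasurable (fun x => fluct u j t x i) (volume.restrict (box p.L)) :=
    fun j i => (hrep j i).memLp.1.aemeasurable
  have hd : ∀ j i, AEMeasurable (fun x => fluctDz Du j t x i) (volume.restrict (slab p.L l)) :=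
    fun j i => (hrep j i).deriv_memLp.1.aemeasurable.mono_measure
      (Measure.restrict_mono inter_subset_left le_rfl)
  have hw' : AEMeasurable (fun x : Vec => profile' p.L p.U l (x 2) ^ 2)
      (volume.restrict (box p.L)) := (hw.comp (continuous_apply 2)).aemeasurable
  have e1 : weightedFluct p l u t = ∑ j, ∑ i, ∫⁻ x in box p.L,
      ENNReal.ofReal ((fluct u j t x i - 0) ^ 2 * profile' p.L p.U l (x 2) ^ 2) := by
    have hm : ∀ j i, AEMeasurable (fun x => ENNReal.ofReal
        ((fluct u j t x i - 0) ^ 2 * profile' p.L p.U l (x 2) ^ 2))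
        (volume.restrict (box p.L)) := fun j i =>
      AEMeasurable.ennreal_ofReal (by exact (((hf j i).sub_const 0).pow_const 2).mul hw')
    simp only [← lintegral_finsetSum' _ fun i _ => hm _ i]
    rw [← lintegral_finsetSum' _ fun j _ => Finset.aemeasurable_fun_sum _ fun i _ => hm j i]
    refine lintegral_congr fun x => ?_
    simp only [sub_zero, sumFluctSq, normSq, Finset.sum_mul]
    rw [ENNReal.ofReal_sum_of_nonneg fun j _ => Finset.sum_nonneg fun i _ => by positivity]
    refine Finset.sum_congr rfl fun j _ => ?_
    rw [ENNReal.ofReal_sum_of_nonneg fun i _ => by positivity]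
  have e2 : ∫⁻ x in slab p.L l, ENNReal.ofReal (sumFluctDzSq Du t x)
      = ∑ j, ∑ i, ∫⁻ x in slab p.L l, ENNReal.ofReal (fluctDz Du j t x i ^ 2) := by
    have hm : ∀ j i, AEMeasurable (fun x => ENNReal.ofReal (fluctDz Du j t x i ^ 2))
        (volume.restrict (slab p.L l)) := fun j i =>
      AEMeasurable.ennreal_ofReal (by exact (hd j i).pow_const 2)
    simp only [← lintegral_finsetSum' _ fun i _ => hm _ i]
    rw [← lintegral_finsetSum' _ fun j _ => Finset.aemeasurable_fun_sum _ fun i _ => hm j i]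
    refine lintegral_congr fun x => ?_
    simp only [sumFluctDzSq, normSq]
    rw [ENNReal.ofReal_sum_of_nonneg fun j _ => Finset.sum_nonneg fun i _ => by positivity]
    refine Finset.sum_congr rfl fun j _ => ?_
    rw [ENNReal.ofReal_sum_of_nonneg fun i _ => by positivity]
  rw [e1, e2]
  simp only [Finset.mul_sum]
  refine Finset.sum_le_sum fun j _ => Finset.sum_le_sum fun i _ => ?_
  have := (hrep j i).lintegral_sq_mul_weight_le hl.le hlL hw (fun _ => sq_nonneg _)
    fun z hz => by rw [profile'_eq_zero hl hz]; simp
  rwa [integral_mul_profile'_sq hl] at this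

lemma lintegral_sub_lid_sq_le (hL : 0 < p.L) (ht : ∀ j, IsShearField p.L p.U (u j t) (Du j t))
    (hl : 0 < l) (hlL : l ≤ p.L) :
    ∫⁻ x in box p.L, ENNReal.ofReal
        ((∑ j, normSq (u j t x - lid p.U)) * profile p.L p.U l (x 2) ^ 2) ≤
      ENNReal.ofReal (p.U ^ 2 * l ^ 2 / 30) * totalGradSq p Du t := by
  have hrep := lineRep_velocity hL ht
  have hw : Continuous fun z => profile p.L p.U l z ^ 2 := (continuous_profile _ _ _).pow 2
  have hf : ∀ j i, AEMeasurable (fun x => u j t x i) (volume.restrict (box p.L)) :=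
    fun j i => (hrep j i).memLp.1.aemeasurable
  have hd : ∀ j i, AEMeasurable (fun x => Du j t x i 2) (volume.restrict (slab p.L l)) :=
    fun j i => (hrep j i).deriv_memLp.1.aemeasurable.mono_measure
      (Measure.restrict_mono inter_subset_left le_rfl)
  have hw' : AEMeasurable (fun x : Vec => profile p.L p.U l (x 2) ^ 2)
      (volume.restrict (box p.L)) := (hw.comp (continuous_apply 2)).aemeasurable
  have e1 : ∫⁻ x in box p.L, ENNReal.ofReal
        ((∑ j, normSq (u j t x - lid p.U)) * profile p.L p.U l (x 2) ^ 2)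
      = ∑ j, ∑ i, ∫⁻ x in box p.L,
      ENNReal.ofReal ((u j t x i - lid p.U i) ^ 2 * profile p.L p.U l (x 2) ^ 2) := by
    have hm : ∀ j i, AEMeasurable (fun x => ENNReal.ofReal
        ((u j t x i - lid p.U i) ^ 2 * profile p.L p.U l (x 2) ^ 2))
        (volume.restrict (box p.L)) := fun j i =>
      AEMeasurable.ennreal_ofReal (by exact (((hf j i).sub_const _).pow_const 2).mul hw')
    simp only [← lintegral_finsetSum' _ fun i _ => hm _ i]
    rw [← lintegral_finsetSum' _ fun j _ => Finset.aemeasurable_fun_sum _ fun i _ => hm j i]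
    refine lintegral_congr fun x => ?_
    simp only [normSq, Finset.sum_mul, Pi.sub_apply]
    rw [ENNReal.ofReal_sum_of_nonneg fun j _ => Finset.sum_nonneg fun i _ => by positivity]
    refine Finset.sum_congr rfl fun j _ => ?_
    rw [ENNReal.ofReal_sum_of_nonneg fun i _ => by positivity]
  have e2 : ∑ j, ∑ i, ∫⁻ x in slab p.L l, ENNReal.ofReal (Du j t x i 2 ^ 2)
      ≤ totalGradSq p Du t := by
    have hm : ∀ j i, AEMeasurable (fun x => ENNReal.ofReal (Du j t x i 2 ^ 2))
        (volume.restrict (slab p.L l)) := fun j i =>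
      AEMeasurable.ennreal_ofReal (by exact (hd j i).pow_const 2)
    simp only [← lintegral_finsetSum' _ fun i _ => hm _ i]
    rw [← lintegral_finsetSum' _ fun j _ => Finset.aemeasurable_fun_sum _ fun i _ => hm j i]
    refine (lintegral_mono_set inter_subset_left).trans (lintegral_mono fun x => ?_)
    simp only [sumGradSq, gradSq]
    rw [ENNReal.ofReal_sum_of_nonneg fun j _ => Finset.sum_nonneg fun i _ => by positivity]
    refine Finset.sum_le_sum fun j _ => ?_
    rw [ENNReal.ofReal_sum_of_nonneg fun i _ => by positivity]
    refine Finset.sum_le_sum fun i _ => ENNReal.ofReal_le_ofReal ?_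
    exact Finset.single_le_sum (f := fun k => Du j t x i k ^ 2) (fun _ _ => sq_nonneg _)
      (Finset.mem_univ 2)
  rw [e1]
  refine le_trans ?_ (mul_le_mul_right e2 _)
  simp only [Finset.mul_sum]
  refine Finset.sum_le_sum fun j _ => Finset.sum_le_sum fun i _ => ?_
  have := (hrep j i).lintegral_sq_mul_weight_le hl.le hlL hw (fun _ => sq_nonneg _)
    fun z hz => by rw [profile_eq_zero hl hz]; simp
  rwa [integral_mul_profile_sq hl] at this

/-- All components of all fluctuations are treated as one vector, so the product on the right is
`Σ|u'|² Σ|∂u'/∂z|²`. Since `Σ|u'|²` is `J/(μτ)` times `ν_turb`, the product is at most `J/(μτ)`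
times the eddy dissipation. Used only to show that the averages are finite. -/
lemma weightedFluct_le_dissipation (hL : 0 < p.L) (hν : 0 < p.ν) (hμ : 0 < p.μ) (hτ : 0 < p.τ)
    (hJ : 0 < J) (ht : ∀ j, IsShearField p.L p.U (u j t) (Du j t))
    (hl : 0 < l) (hlL : l ≤ p.L) {δ : ℝ} (hδ : 0 < δ) :
    weightedFluct p l u t ≤ ENNReal.ofReal (4 * p.U ^ 2 / (3 * l)) *
      (ENNReal.ofReal (δ * (J / (p.μ * p.τ))) * totalDissipation p u Du t
        + ENNReal.ofReal (p.L ^ 3 / δ)) := by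
  have hrep := lineRep_fluct hL ht
  have hw : Continuous fun z => profile' p.L p.U l z ^ 2 := (continuous_profile' _ _ _).pow 2
  have key := lintegral_sum_sq_mul_weight_le (ι := Fin J × Fin 3) hδ hL.le
    (f := fun m x => fluct u m.1 t x m.2) (d := fun m x => fluctDz Du m.1 t x m.2)
    (fun m => hrep m.1 m.2) hw (fun _ => sq_nonneg _)
  rw [integral_profile'_sq hl hlL] at key
  simp only [Fintype.sum_prod_type] at key
  refine key.trans (mul_le_mul_right ?_ _)
  have hvol : ENNReal.ofReal (p.L ^ 3 / δ) = ∫⁻ _ in box p.L, ENNReal.ofReal (1 / δ) := by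
    rw [lintegral_const, Measure.restrict_apply_univ, volume_box hL,
      ← ENNReal.ofReal_mul (by positivity)]
    congr 1
    ring
  rw [totalDissipation, ← lintegral_const_mul' _ _ ENNReal.ofReal_ne_top, hvol,
    ← lintegral_add_right _ measurable_const]
  refine lintegral_mono fun x => ?_
  have hc : 0 ≤ δ * (J / (p.μ * p.τ)) := by positivity
  have hDS := sum_normSq_fluctDz_le Du t x
  have hn := nuTurb_eq p u t x
  have hQ := sumFluctSq_nonneg u t x
  have hS := sumGradSq_nonneg Du t x
  have hnn := nuTurb_nonneg hμ hτ u t x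
  rw [← ENNReal.ofReal_mul hc, ← ENNReal.ofReal_add (by positivity) (by positivity)]
  apply ENNReal.ofReal_le_ofReal
  have hQn : sumFluctSq u t x = J / (p.μ * p.τ) * nuTurb p u t x := by
    rw [hn, sumFluctSq]
    have : (J : ℝ) ≠ 0 := by positivity
    field_simp
  have h1 : sumFluctSq u t x * sumFluctDzSq Du t x ≤ sumFluctSq u t x * sumGradSq Du t x :=
    mul_le_mul_of_nonneg_left hDS hQ
  have h2 : sumFluctSq u t x * sumGradSq Du t x
      ≤ J / (p.μ * p.τ) * ((p.ν + nuTurb p u t x) * sumGradSq Du t x) := by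
    rw [hQn, mul_assoc]
    have : 0 ≤ p.ν * sumGradSq Du t x := by positivity
    gcongr
    linarith
  have h3 : δ * (sumFluctSq u t x * sumFluctDzSq Du t x)
      ≤ δ * (J / (p.μ * p.τ)) * ((p.ν + nuTurb p u t x) * sumGradSq Du t x) := by
    rw [mul_assoc]
    exact mul_le_mul_of_nonneg_left (h1.trans h2) hδ.le
  exact add_le_add h3 le_rfl

lemma mul_totalGradSq_le (hν : 0 < p.ν) (hμ : 0 < p.μ) (hτ : 0 < p.τ) :
    ENNReal.ofReal p.ν * totalGradSq p Du t ≤ totalDissipation p u Du t := by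
  rw [totalGradSq, totalDissipation, ← lintegral_const_mul' _ _ ENNReal.ofReal_ne_top]
  refine lintegral_mono fun x => ?_
  rw [← ENNReal.ofReal_mul hν.le]
  apply ENNReal.ofReal_le_ofReal
  exact mul_le_mul_of_nonneg_right (by linarith [nuTurb_nonneg hμ hτ u t x])
    (sumGradSq_nonneg Du t x)

/-- Green's formula with `χ = 1` gives `∫ ∂u₁/∂z = U L²`; Jensen's inequality then bounds `∫|∇u|²`
below by its value for the linear shear `U/L`. This keeps the denominator of `ν_eff` positive. -/
lemma le_totalGradSq (hL : 0 < p.L) (hU : 0 < p.U)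
    (ht : ∀ j, IsShearField p.L p.U (u j t) (Du j t)) :
    ENNReal.ofReal (J * (p.U ^ 2 * p.L)) ≤ totalGradSq p Du t := by
  have hone : ∀ j, p.U * p.L ^ 2 = ∫ x in box p.L, Du j t x 0 2 := by
    intro j
    have h := ((ht j).grad 0).green (fun _ => 1) contDiff_const (fun x => ⟨rfl, rfl⟩) 2
    simp only [pderiv, fderiv_fun_const, Pi.zero_apply, zero_apply, mul_zero,
      mul_one, zero_add, if_true] at h
    rw [h]
    simp [lid, hL.le]
    ring
  have hpt : ∀ A B : ℝ, 2 * (B * A) - B ^ 2 ≤ A ^ 2 := fun A B => by nlinarith [sq_nonneg (A - B)]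
  have hint : ∀ j i k, MemLp (fun x => Du j t x i k) 2 (volume.restrict (box p.L)) :=
    fun j i k => ((ht j).grad i).grad_memLp k
  have hgi : ∀ j, IntegrableOn (fun x => gradSq (Du j t x)) (box p.L) := fun j =>
    integrable_finsetSum _ fun i _ => integrable_finsetSum _ fun k _ => (hint j i k).integrable_sq
  have hj : ∀ j, p.U ^ 2 * p.L ≤ ∫ x in box p.L, gradSq (Du j t x) := by
    intro j
    have hd := (hint j 0 2).integrable one_le_two
    have h1 : ∫ x in box p.L, (2 * (p.U / p.L * Du j t x 0 2) - (p.U / p.L) ^ 2)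
        ≤ ∫ x in box p.L, gradSq (Du j t x) := by
      refine integral_mono (((hd.const_mul _).const_mul _).sub (integrable_const _)) (hgi j)
        fun x => (hpt _ _).trans ?_
      refine le_trans ?_ (Finset.single_le_sum (f := fun i => ∑ k, Du j t x i k ^ 2)
        (fun _ _ => Finset.sum_nonneg fun _ _ => sq_nonneg _) (Finset.mem_univ 0))
      exact Finset.single_le_sum (f := fun k => Du j t x 0 k ^ 2) (fun _ _ => sq_nonneg _)
        (Finset.mem_univ 2)
    rw [integral_sub ((hd.const_mul _).const_mul _) (integrable_const _), integral_const_mul,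
      integral_const_mul, ← hone j, integral_const, smul_eq_mul, Measure.real,
      Measure.restrict_apply_univ, volume_box hL, ENNReal.toReal_ofReal (by positivity)] at h1
    refine le_trans (le_of_eq ?_) h1
    field_simp
    ring
  rw [totalGradSq, ← ofReal_integral_eq_lintegral_ofReal]
  · apply ENNReal.ofReal_le_ofReal
    simp only [sumGradSq]
    rw [integral_finsetSum _ fun j _ => hgi j]
    calc (J : ℝ) * (p.U ^ 2 * p.L) = ∑ _j : Fin J, p.U ^ 2 * p.L := by simp
      _ ≤ _ := Finset.sum_le_sum fun j _ => hj j
  · exact integrable_finsetSum _ fun j _ => hgi j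
  · exact ae_of_all _ fun x => sumGradSq_nonneg Du t x

end

/-! ### Integrability on space-time cylinders and the tested energy inequality. -/

lemma lintegral_cylinder (T L : ℝ) {h : ℝ × Vec → ℝ≥0∞}
    (hh : AEMeasurable h (volume.restrict (Ioc 0 T ×ˢ box L))) :
    ∫⁻ q in Ioc 0 T ×ˢ box L, h q = ∫⁻ t in Ioc 0 T, ∫⁻ x in box L, h (t, x) := by
  rw [Measure.volume_eq_prod, ← Measure.prod_restrict] at hh ⊢
  exact lintegral_prod _ hh

lemma integrableOn_cylinder {T L : ℝ} {h : ℝ × Vec → ℝ}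
    (hm : AEStronglyMeasurable h (volume.restrict (Ioc 0 T ×ˢ box L))) (h0 : ∀ q, 0 ≤ h q)
    (hfin : ∫⁻ t in Ioc 0 T, ∫⁻ x in box L, ENNReal.ofReal (h (t, x)) < ⊤) :
    IntegrableOn h (Ioc 0 T ×ˢ box L) := by
  rw [IntegrableOn, ← lintegral_ofReal_ne_top_iff_integrable hm (ae_of_all _ h0),
    lintegral_cylinder T L hm.aemeasurable.ennreal_ofReal]
  exact hfin.ne

lemma integral_cylinder {T L : ℝ} {h : ℝ × Vec → ℝ} (hi : IntegrableOn h (Ioc 0 T ×ˢ box L)) :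
    ∫ t in Ioc 0 T, ∫ x in box L, h (t, x) = ∫ q in Ioc 0 T ×ˢ box L, h q :=
  (setIntegral_prod h hi).symm

lemma ofReal_integral_cylinder {T L : ℝ} {h : ℝ × Vec → ℝ}
    (hi : IntegrableOn h (Ioc 0 T ×ˢ box L)) (h0 : ∀ q, 0 ≤ h q) :
    ENNReal.ofReal (∫ q in Ioc 0 T ×ˢ box L, h q)
      = ∫⁻ t in Ioc 0 T, ∫⁻ x in box L, ENNReal.ofReal (h (t, x)) := by
  rw [ofReal_integral_eq_lintegral_ofReal hi (ae_of_all _ h0),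
    lintegral_cylinder T L hi.1.aemeasurable.ennreal_ofReal]

instance isFiniteMeasure_cylinder (T L : ℝ) :
    IsFiniteMeasure ((volume : Measure (ℝ × Vec)).restrict (Ioc 0 T ×ˢ box L)) := by
  rw [Measure.volume_eq_prod, ← Measure.prod_restrict]
  infer_instance

lemma measurableSet_cylinder (T L : ℝ) :
    MeasurableSet (Ioc (0 : ℝ) T ×ˢ box L : Set (ℝ × Vec)) :=
  measurableSet_Ioc.prod (measurableSet_box L)

section
variable {p : Params} {J : ℕ} {u₀ : Fin J → Vec → Vec} {u : Fin J → ℝ → Vec → Vec}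
  {Du : Fin J → ℝ → Vec → Grad} {l : ℝ}

lemma IsWeakSolution.aestronglyMeasurable (h : IsWeakSolution p u₀ u Du) (T : ℝ) (j : Fin J)
    (i : Fin 3) : AEStronglyMeasurable (fun q : ℝ × Vec => u j q.1 q.2 i)
      (volume.restrict (Ioc 0 T ×ˢ box p.L)) :=
  (h.meas j i).mono_measure
    (Measure.restrict_mono (prod_mono Ioc_subset_Ioi_self subset_rfl) le_rfl)

lemma IsWeakSolution.aestronglyMeasurable_grad (h : IsWeakSolution p u₀ u Du) (T : ℝ) (j : Fin J)
    (i k : Fin 3) : AEStronglyMeasurable (fun q : ℝ × Vec => Du j q.1 q.2 i k)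
      (volume.restrict (Ioc 0 T ×ˢ box p.L)) :=
  (h.grad_meas j i k).mono_measure
    (Measure.restrict_mono (prod_mono Ioc_subset_Ioi_self subset_rfl) le_rfl)

lemma IsWeakSolution.aestronglyMeasurable_nuTurb (h : IsWeakSolution p u₀ u Du) (T : ℝ) :
    AEStronglyMeasurable (fun q : ℝ × Vec => nuTurb p u q.1 q.2)
      (volume.restrict (Ioc 0 T ×ˢ box p.L)) := by
  have hu := fun j i => (h.aestronglyMeasurable T j i).aemeasurable
  refine AEMeasurable.aestronglyMeasurable ?_
  unfold nuTurb ensMean normSq fluct ensMean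
  fun_prop

lemma IsWeakSolution.aestronglyMeasurable_gradSq (h : IsWeakSolution p u₀ u Du) (T : ℝ)
    (j : Fin J) : AEStronglyMeasurable (fun q : ℝ × Vec => gradSq (Du j q.1 q.2))
      (volume.restrict (Ioc 0 T ×ˢ box p.L)) := by
  have hd := fun j i k => (h.aestronglyMeasurable_grad T j i k).aemeasurable
  refine AEMeasurable.aestronglyMeasurable ?_
  unfold gradSq
  fun_prop

lemma IsWeakSolution.integrableOn_gradSq (h : IsWeakSolution p u₀ u Du) (T : ℝ) (j : Fin J) :
    IntegrableOn (fun q : ℝ × Vec => gradSq (Du j q.1 q.2)) (Ioc 0 T ×ˢ box p.L) :=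
  integrableOn_cylinder (h.aestronglyMeasurable_gradSq T j) (fun _ => gradSq_nonneg _)
    (h.grad_sq_int j T)

lemma IsWeakSolution.integrableOn_nuTurb_mul_gradSq (hμ : 0 < p.μ) (hτ : 0 < p.τ)
    (h : IsWeakSolution p u₀ u Du) (T : ℝ) (j : Fin J) :
    IntegrableOn (fun q : ℝ × Vec => nuTurb p u q.1 q.2 * gradSq (Du j q.1 q.2))
      (Ioc 0 T ×ˢ box p.L) :=
  integrableOn_cylinder
    ((h.aestronglyMeasurable_nuTurb T).mul (h.aestronglyMeasurable_gradSq T j))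
    (fun _ => mul_nonneg (nuTurb_nonneg hμ hτ _ _ _) (gradSq_nonneg _)) (h.turb_int j T)

lemma IsWeakSolution.integrableOn_dissipation (hμ : 0 < p.μ) (hτ : 0 < p.τ)
    (h : IsWeakSolution p u₀ u Du) (T : ℝ) (j : Fin J) :
    IntegrableOn (fun q : ℝ × Vec => (p.ν + nuTurb p u q.1 q.2) * gradSq (Du j q.1 q.2))
      (Ioc 0 T ×ˢ box p.L) := by
  simp only [add_mul]
  exact ((h.integrableOn_gradSq T j).const_mul _).add
    (h.integrableOn_nuTurb_mul_gradSq hμ hτ T j)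

lemma IsWeakSolution.integrableOn_normSq (h : IsWeakSolution p u₀ u Du) (T : ℝ) (j : Fin J) :
    IntegrableOn (fun q : ℝ × Vec => normSq (u j q.1 q.2)) (Ioc 0 T ×ˢ box p.L) := by
  refine integrableOn_cylinder ?_ (fun _ => normSq_nonneg _) ?_
  · have hu := fun j i => (h.aestronglyMeasurable T j i).aemeasurable
    refine AEMeasurable.aestronglyMeasurable ?_
    unfold normSq
    fun_prop
  · obtain ⟨C, hC⟩ := h.energy_bdd j T
    refine (lintegral_mono_ae hC).trans_lt ?_
    rw [lintegral_const, Measure.restrict_apply_univ, Real.volume_Ioc]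
    exact ENNReal.mul_lt_top ENNReal.coe_lt_top ENNReal.ofReal_lt_top

/-- `ν_turb` is dominated by the kinetic energy density of the ensemble, which is bounded in time.
-/
lemma IsWeakSolution.integrableOn_nuTurb (hμ : 0 < p.μ) (hτ : 0 < p.τ)
    (h : IsWeakSolution p u₀ u Du) (T : ℝ) :
    IntegrableOn (fun q : ℝ × Vec => nuTurb p u q.1 q.2) (Ioc 0 T ×ˢ box p.L) := by
  have hs : IntegrableOn (fun q : ℝ × Vec => p.μ * p.τ / J * ∑ j, normSq (u j q.1 q.2))
      (Ioc 0 T ×ˢ box p.L) :=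
    (integrable_finsetSum _ fun j _ => h.integrableOn_normSq T j).const_mul _
  refine hs.mono' (h.aestronglyMeasurable_nuTurb T) (ae_of_all _ fun q => ?_)
  rw [Real.norm_of_nonneg (nuTurb_nonneg hμ hτ _ _ _), nuTurb_eq]
  exact mul_le_mul_of_nonneg_left (sum_normSq_fluct_le u q.1 q.2)
    (div_nonneg (mul_pos hμ hτ).le (Nat.cast_nonneg _))

lemma exists_bound_height {L : ℝ} (T : ℝ) {w : ℝ → ℝ} (hw : Continuous w) :
    ∃ M, ∀ᵐ q ∂(volume.restrict (Ioc 0 T ×ˢ box L) : Measure (ℝ × Vec)), ‖w (q.2 2)‖ ≤ M := by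
  obtain ⟨M, hM⟩ := (isCompact_Icc (a := (0 : ℝ)) (b := L)).exists_bound_of_continuousOn
    hw.continuousOn
  refine ⟨M, ?_⟩
  filter_upwards [ae_restrict_mem (measurableSet_cylinder T L)] with q hq
  exact hM _ (Ioo_subset_Icc_self (mem_box.1 hq.2 2))

lemma aestronglyMeasurable_height {w : ℝ → ℝ} (hw : Continuous w) (μ : Measure (ℝ × Vec)) :
    AEStronglyMeasurable (fun q : ℝ × Vec => w (q.2 2)) μ :=
  (hw.comp (by fun_prop : Continuous fun q : ℝ × Vec => q.2 2)).aestronglyMeasurable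

lemma integrableOn_mul_height {L T : ℝ} {f : ℝ × Vec → ℝ} {w : ℝ → ℝ}
    (hf : IntegrableOn f (Ioc 0 T ×ˢ box L)) (hw : Continuous w) :
    IntegrableOn (fun q => f q * w (q.2 2)) (Ioc 0 T ×ˢ box L) := by
  obtain ⟨M, hM⟩ := exists_bound_height (L := L) T hw
  exact Integrable.mul_bdd hf (aestronglyMeasurable_height hw _) hM

lemma sq_le_gradSq (A : Grad) (i k : Fin 3) : A i k ^ 2 ≤ gradSq A :=
  (Finset.single_le_sum (f := fun k => A i k ^ 2) (fun _ _ => sq_nonneg _)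
    (Finset.mem_univ k)).trans
  (Finset.single_le_sum (f := fun i => ∑ k, A i k ^ 2)
    (fun _ _ => Finset.sum_nonneg fun _ _ => sq_nonneg _) (Finset.mem_univ i))

lemma sum_row_sq_le_gradSq (A : Grad) (i : Fin 3) : ∑ k, A i k ^ 2 ≤ gradSq A :=
  Finset.single_le_sum (f := fun i => ∑ k, A i k ^ 2)
    (fun _ _ => Finset.sum_nonneg fun _ _ => sq_nonneg _) (Finset.mem_univ i)

lemma gradDot_backgroundGrad (L U l : ℝ) (A : Grad) (x : Vec) :
    gradDot A (backgroundGrad L U l x) = A 0 2 * profile' L U l (x 2) := by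
  simp [gradDot, backgroundGrad, Fin.sum_univ_three]

lemma dot_background (L U l : ℝ) (v x : Vec) :
    dot v (background L U l x) = v 0 * profile L U l (x 2) := by
  simp [dot, background, Fin.sum_univ_three]

/-- Since `φ'` is bounded and `|∂u₁/∂z| ≤ |∇u|² + 1`, the dissipation density plus `ν + ν_turb`
dominates. This makes the background admissible in the energy inequality. -/
lemma IsWeakSolution.integrableOn_viscous (hν : 0 < p.ν) (hμ : 0 < p.μ) (hτ : 0 < p.τ)
    (h : IsWeakSolution p u₀ u Du) (T : ℝ) (j : Fin J) :
    IntegrableOn (fun q : ℝ × Vec => (p.ν + nuTurb p u q.1 q.2) *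
      gradDot (Du j q.1 q.2) (backgroundGrad p.L p.U l q.2)) (Ioc 0 T ×ˢ box p.L) := by
  simp only [gradDot_backgroundGrad, ← mul_assoc]
  refine integrableOn_mul_height ?_ (continuous_profile' _ _ _)
  have hdom : IntegrableOn (fun q : ℝ × Vec => (p.ν + nuTurb p u q.1 q.2) * gradSq (Du j q.1 q.2)
      + (p.ν + nuTurb p u q.1 q.2)) (Ioc 0 T ×ˢ box p.L) :=
    (h.integrableOn_dissipation hμ hτ T j).add
      ((integrable_const _).add (h.integrableOn_nuTurb hμ hτ T))
  refine Integrable.mono' hdom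
    ((aestronglyMeasurable_const.add (h.aestronglyMeasurable_nuTurb T)).mul
      (h.aestronglyMeasurable_grad T j 0 2)) (ae_of_all _ fun q => ?_)
  have hn : 0 ≤ p.ν + nuTurb p u q.1 q.2 := add_nonneg hν.le (nuTurb_nonneg hμ hτ _ _ _)
  rw [norm_mul, Real.norm_of_nonneg hn, Real.norm_eq_abs]
  have h1 : |Du j q.1 q.2 0 2| ≤ gradSq (Du j q.1 q.2) + 1 := by
    have := sq_le_gradSq (Du j q.1 q.2) 0 2
    rw [← sq_abs] at this
    nlinarith [sq_nonneg (|Du j q.1 q.2 0 2| - 1), abs_nonneg (Du j q.1 q.2 0 2)]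
  nlinarith [mul_le_mul_of_nonneg_left h1 hn]

lemma abs_convect_le (v : Vec) (A : Grad) (i : Fin 3) :
    |convect v A i| ≤ normSq v + gradSq A := by
  have h := sum_row_sq_le_gradSq A i
  simp only [convect, normSq, Fin.sum_univ_three] at h ⊢
  rw [abs_le]
  constructor <;>
  nlinarith [sq_nonneg (v 0 + A i 0), sq_nonneg (v 1 + A i 1), sq_nonneg (v 2 + A i 2),
    sq_nonneg (v 0 - A i 0), sq_nonneg (v 1 - A i 1), sq_nonneg (v 2 - A i 2),
    sq_nonneg (v 0), sq_nonneg (v 1), sq_nonneg (v 2), sq_nonneg (A i 0), sq_nonneg (A i 1),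
    sq_nonneg (A i 2)]

lemma IsWeakSolution.integrableOn_convective
    (h : IsWeakSolution p u₀ u Du) (T : ℝ) (j : Fin J) :
    IntegrableOn (fun q : ℝ × Vec => dot (convect (u j q.1 q.2) (Du j q.1 q.2))
      (background p.L p.U l q.2)) (Ioc 0 T ×ˢ box p.L) := by
  simp only [dot_background]
  refine integrableOn_mul_height ?_ (continuous_profile _ _ _)
  refine Integrable.mono' ((h.integrableOn_normSq T j).add (h.integrableOn_gradSq T j)) ?_
    (ae_of_all _ fun q => abs_convect_le _ _ _)
  have hu := fun i => (h.aestronglyMeasurable T j i).aemeasurable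
  have hd := fun i k => (h.aestronglyMeasurable_grad T j i k).aemeasurable
  refine AEMeasurable.aestronglyMeasurable ?_
  unfold convect
  fun_prop

/-- The part of the energy budget of the `j`-th realization that does not depend on time. -/
def energyConst (p : Params) {J : ℕ} (u₀ : Fin J → Vec → Vec) (l : ℝ) (j : Fin J) : ℝ :=
  1 / 2 * (∫ x in box p.L, normSq (u₀ j x)) + 1 / 2 * (∫ x in box p.L, profile p.L p.U l (x 2) ^ 2)
    - ∫ x in box p.L, u₀ j x 0 * profile p.L p.U l (x 2)

/-- The term `(u(T), φ)` is at most `½‖u(T)‖² + ½‖φ‖²`, and the kinetic energy on the left cancels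
the first summand. What remains outside the space-time integrals does not depend on `T`. -/
lemma integral_dissipation_le (hL : 0 < p.L) (hν : 0 < p.ν) (hμ : 0 < p.μ) (hτ : 0 < p.τ)
    (h : IsWeakSolution p u₀ u Du) (hen : EnergyInequality p u₀ u Du) (hl : 0 < l)
    (hlL : l ≤ p.L) (j : Fin J) :
    ∀ᵐ T ∂(volume.restrict (Ioi (0 : ℝ))),
      ∫ q in Ioc 0 T ×ˢ box p.L, (p.ν + nuTurb p u q.1 q.2) * gradSq (Du j q.1 q.2) ≤
        energyConst p u₀ l j
        + (∫ q in Ioc 0 T ×ˢ box p.L, (p.ν + nuTurb p u q.1 q.2) *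
            gradDot (Du j q.1 q.2) (backgroundGrad p.L p.U l q.2))
        + ∫ q in Ioc 0 T ×ˢ box p.L, dot (convect (u j q.1 q.2) (Du j q.1 q.2))
            (background p.L p.U l q.2) := by
  filter_upwards [hen j _ _ (isShearField_background hL hl hlL)
    (fun T => h.integrableOn_viscous hν hμ hτ T j) (fun T => h.integrableOn_convective T j),
    h.shear j] with T hT hshear
  rw [← integral_cylinder (h.integrableOn_dissipation hμ hτ T j),
    ← integral_cylinder (h.integrableOn_viscous hν hμ hτ T j),
    ← integral_cylinder (h.integrableOn_convective T j)]
  have hu : ∀ i, MemLp (fun x => u j T x i) 2 (volume.restrict (box p.L)) :=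
    fun i => (hshear.grad i).memLp
  have hu2 : IntegrableOn (fun x => normSq (u j T x)) (box p.L) :=
    integrable_finsetSum _ fun i _ => (hu i).integrable_sq
  have hφ : MemLp (fun x : Vec => profile p.L p.U l (x 2)) 2 (volume.restrict (box p.L)) :=
    memLp_of_continuous ((continuous_profile _ _ _).comp (continuous_apply 2))
  have hu0φ : IntegrableOn (fun x => u₀ j x 0 * profile p.L p.U l (x 2)) (box p.L) :=
    (h.init_memLp j 0).integrable_mul hφ
  have huφ : IntegrableOn (fun x => u j T x 0 * profile p.L p.U l (x 2)) (box p.L) :=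
    (hu 0).integrable_mul hφ
  have hb : ∫ x in box p.L, dot (fun i => u j T x i - u₀ j x i) (background p.L p.U l x) ≤
      ∫ x in box p.L, ((1 / 2 * normSq (u j T x) + 1 / 2 * profile p.L p.U l (x 2) ^ 2)
        - u₀ j x 0 * profile p.L p.U l (x 2)) := by
    refine integral_mono ?_ (((hu2.const_mul _).add (hφ.integrable_sq.const_mul _)).sub hu0φ)
      fun x => ?_
    · simp only [dot_background, sub_mul]
      exact huφ.sub hu0φ
    · dsimp only
      rw [dot_background]
      have : u j T x 0 ^ 2 ≤ normSq (u j T x) :=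
        Finset.single_le_sum (f := fun i => u j T x i ^ 2) (fun _ _ => sq_nonneg _)
          (Finset.mem_univ 0)
      nlinarith [sq_nonneg (u j T x 0 - profile p.L p.U l (x 2))]
  rw [integral_sub (by exact (hu2.const_mul _).add (hφ.integrable_sq.const_mul _)) hu0φ,
    integral_add (hu2.const_mul _) (hφ.integrable_sq.const_mul _), integral_const_mul,
    integral_const_mul] at hb
  unfold energyConst
  linarith

end

/-! ### The energy budget. -/

lemma mul_le_weighted_sq {a : ℝ} (ha : 0 < a) (x y : ℝ) :
    x * y ≤ a / 2 * x ^ 2 + 1 / (2 * a) * y ^ 2 := by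
  have h : 0 ≤ (a * x - y) ^ 2 / (2 * a) := by positivity
  have h2 : (a * x - y) ^ 2 / (2 * a) = a / 2 * x ^ 2 + 1 / (2 * a) * y ^ 2 - x * y := by
    field_simp
    ring
  linarith

/-- Young's inequality three times: with equal weights for the viscous term, with parameter `A` for
transport by `v - lid U`, which is small near the lid, and with parameter `B` for transport by the
lid velocity, which only sees `G 0 0`. -/
lemma viscous_add_convective_le {n A B U r r' : ℝ} (hn : 0 ≤ n) (hA : 0 < A) (hB : 0 < B)
    (v : Vec) (G : Grad) :
    n * (G 0 2 * r') + convect v G 0 * r ≤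
      1 / 2 * (n * gradSq G) + 1 / 2 * (n * r' ^ 2) + (A + B) / 2 * gradSq G
        + 1 / (2 * A) * (normSq (v - lid U) * r ^ 2) + U ^ 2 / (2 * B) * r ^ 2 := by
  have h1 : n * (G 0 2 * r') ≤ n * (1 / 2 * gradSq G + 1 / 2 * r' ^ 2) := by
    apply mul_le_mul_of_nonneg_left _ hn
    nlinarith [sq_nonneg (G 0 2 - r'), sq_le_gradSq G 0 2]
  have h2 := fun k => mul_le_weighted_sq hA (G 0 k) ((v k - lid U k) * r)
  have h3 := mul_le_weighted_sq hB (G 0 0) (U * r)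
  have h4 := mul_le_mul_of_nonneg_left (sum_row_sq_le_gradSq G 0) (half_pos hA).le
  have h5 := mul_le_mul_of_nonneg_left (sq_le_gradSq G 0 0) (half_pos hB).le
  have e1 : convect v G 0 * r = ∑ k, G 0 k * ((v k - lid U k) * r) + G 0 0 * (U * r) := by
    simp [convect, Fin.sum_univ_three, lid]
    ring
  have e2 : 1 / (2 * A) * (normSq (v - lid U) * r ^ 2)
      = ∑ k, 1 / (2 * A) * ((v k - lid U k) * r) ^ 2 := by
    simp only [normSq, Pi.sub_apply, Finset.sum_mul, Finset.mul_sum, mul_pow]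
  have e3 : U ^ 2 / (2 * B) * r ^ 2 = 1 / (2 * B) * (U * r) ^ 2 := by ring
  have h6 := Finset.sum_le_sum fun k (_ : k ∈ Finset.univ) => h2 k
  rw [Finset.sum_add_distrib, ← Finset.mul_sum] at h6
  rw [e1, e2, e3]
  linarith

/-- A pointwise bound for the right hand side of the energy inequality, summed over the ensemble,
apart from half of the dissipation. -/
def budget (p : Params) (l A B : ℝ) {J : ℕ} (u : Fin J → ℝ → Vec → Vec)
    (Du : Fin J → ℝ → Vec → Grad) (t : ℝ) (x : Vec) : ℝ :=
  J * (p.ν / 2 * profile' p.L p.U l (x 2) ^ 2 + p.U ^ 2 / (2 * B) * profile p.L p.U l (x 2) ^ 2)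
    + p.μ * p.τ / 2 * (sumFluctSq u t x * profile' p.L p.U l (x 2) ^ 2)
    + (A + B) / 2 * sumGradSq Du t x
    + 1 / (2 * A) * ((∑ j, normSq (u j t x - lid p.U)) * profile p.L p.U l (x 2) ^ 2)

section
variable {p : Params} {J : ℕ} {u₀ : Fin J → Vec → Vec} {u : Fin J → ℝ → Vec → Vec}
  {Du : Fin J → ℝ → Vec → Grad} {l A B : ℝ}

lemma sum_viscous_add_convective_le (hν : 0 < p.ν) (hμ : 0 < p.μ) (hτ : 0 < p.τ) (hA : 0 < A)
    (hB : 0 < B) (t : ℝ) (x : Vec) :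
    ∑ j, ((p.ν + nuTurb p u t x) * gradDot (Du j t x) (backgroundGrad p.L p.U l x)
        + dot (convect (u j t x) (Du j t x)) (background p.L p.U l x)) ≤
      1 / 2 * ((p.ν + nuTurb p u t x) * sumGradSq Du t x) + budget p l A B u Du t x := by
  have hn : 0 ≤ p.ν + nuTurb p u t x := add_nonneg hν.le (nuTurb_nonneg hμ hτ _ _ _)
  have h := Finset.sum_le_sum fun j (_ : j ∈ Finset.univ) =>
    viscous_add_convective_le (U := p.U) (r := profile p.L p.U l (x 2))
      (r' := profile' p.L p.U l (x 2)) hn hA hB (u j t x) (Du j t x)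
  simp only [gradDot_backgroundGrad, dot_background]
  refine h.trans (le_of_eq ?_)
  -- Summing `ν_turb φ'²` over the ensemble cancels the `1/J` in `ν_turb`, which needs `J ≠ 0`; the
  -- empty ensemble is trivial.
  rcases Nat.eq_zero_or_pos J with rfl | hJ
  · simp [budget, sumGradSq, sumFluctSq]
  have hJ' : (J : ℝ) ≠ 0 := by positivity
  simp only [Finset.sum_add_distrib, ← Finset.mul_sum, ← Finset.sum_mul, Finset.sum_const,
    Finset.card_univ, Fintype.card_fin, nsmul_eq_mul, budget, sumGradSq, sumFluctSq]
  rw [nuTurb_eq]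
  field_simp
  ring

lemma budget_nonneg (hν : 0 < p.ν) (hμ : 0 < p.μ) (hτ : 0 < p.τ) (hA : 0 < A) (hB : 0 < B)
    (t : ℝ) (x : Vec) : 0 ≤ budget p l A B u Du t x := by
  have h1 := sumFluctSq_nonneg u t x
  have h2 := sumGradSq_nonneg Du t x
  have h3 : 0 ≤ ∑ j, normSq (u j t x - lid p.U) := Finset.sum_nonneg fun _ _ => normSq_nonneg _
  unfold budget
  positivity

lemma IsWeakSolution.integrableOn_sumGradSq (h : IsWeakSolution p u₀ u Du) (T : ℝ) :
    IntegrableOn (fun q : ℝ × Vec => sumGradSq Du q.1 q.2) (Ioc 0 T ×ˢ box p.L) :=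
  integrable_finsetSum _ fun j _ => h.integrableOn_gradSq T j

lemma IsWeakSolution.aestronglyMeasurable_sumFluctSq (h : IsWeakSolution p u₀ u Du) (T : ℝ) :
    AEStronglyMeasurable (fun q : ℝ × Vec => sumFluctSq u q.1 q.2)
      (volume.restrict (Ioc 0 T ×ˢ box p.L)) := by
  have hu := fun j i => (h.aestronglyMeasurable T j i).aemeasurable
  refine AEMeasurable.aestronglyMeasurable ?_
  unfold sumFluctSq normSq fluct ensMean
  fun_prop

lemma IsWeakSolution.integrableOn_budget (h : IsWeakSolution p u₀ u Du) (T : ℝ) :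
    IntegrableOn (fun q : ℝ × Vec => budget p l A B u Du q.1 q.2) (Ioc 0 T ×ˢ box p.L) := by
  have hp : Continuous fun z => profile p.L p.U l z ^ 2 := (continuous_profile _ _ _).pow 2
  have hp' : Continuous fun z => profile' p.L p.U l z ^ 2 := (continuous_profile' _ _ _).pow 2
  have h1 : Continuous fun z => J * (p.ν / 2 * profile' p.L p.U l z ^ 2
      + p.U ^ 2 / (2 * B) * profile p.L p.U l z ^ 2) := by fun_prop
  have hns : IntegrableOn (fun q : ℝ × Vec => ∑ j, normSq (u j q.1 q.2)) (Ioc 0 T ×ˢ box p.L) :=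
    integrable_finsetSum _ fun j _ => h.integrableOn_normSq T j
  have hfl : IntegrableOn (fun q : ℝ × Vec => sumFluctSq u q.1 q.2) (Ioc 0 T ×ˢ box p.L) := by
    refine hns.mono' (h.aestronglyMeasurable_sumFluctSq T) (ae_of_all _ fun q => ?_)
    rw [Real.norm_of_nonneg (sumFluctSq_nonneg _ _ _)]
    exact sum_normSq_fluct_le u q.1 q.2
  have hlid : IntegrableOn (fun q : ℝ × Vec => ∑ j, normSq (u j q.1 q.2 - lid p.U))
      (Ioc 0 T ×ˢ box p.L) := by
    refine integrable_finsetSum _ fun j _ => ?_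
    refine Integrable.mono' (((h.integrableOn_normSq T j).const_mul 2).add
      (integrable_const (2 * normSq (lid p.U)))) ?_ (ae_of_all _ fun q => ?_)
    · have hu := fun i => (h.aestronglyMeasurable T j i).aemeasurable
      refine AEMeasurable.aestronglyMeasurable ?_
      simp only [normSq, Pi.sub_apply]
      fun_prop
    · rw [Real.norm_of_nonneg (normSq_nonneg _)]
      simp only [normSq, Pi.sub_apply, Finset.mul_sum, Pi.add_apply]
      rw [← Finset.sum_add_distrib]
      exact Finset.sum_le_sum fun i _ => by nlinarith [sq_nonneg (u j q.1 q.2 i + lid p.U i)]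
  have hone := integrableOn_mul_height (L := p.L) (T := T) (f := fun _ => (1 : ℝ))
    (integrable_const _) h1
  simp only [one_mul] at hone
  exact ((hone.add ((integrableOn_mul_height hfl hp').const_mul _)).add
    ((h.integrableOn_sumGradSq T).const_mul _)).add
    ((integrableOn_mul_height hlid hp).const_mul _)

lemma IsWeakSolution.integrableOn_sumDissipation (hμ : 0 < p.μ) (hτ : 0 < p.τ)
    (h : IsWeakSolution p u₀ u Du) (T : ℝ) :
    IntegrableOn (fun q : ℝ × Vec => (p.ν + nuTurb p u q.1 q.2) * sumGradSq Du q.1 q.2)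
      (Ioc 0 T ×ˢ box p.L) := by
  simp only [sumGradSq, Finset.mul_sum]
  exact integrable_finsetSum _ fun j _ => h.integrableOn_dissipation hμ hτ T j

lemma half_integral_sumDissipation_le (hL : 0 < p.L) (hν : 0 < p.ν) (hμ : 0 < p.μ) (hτ : 0 < p.τ)
    (h : IsWeakSolution p u₀ u Du) (hen : EnergyInequality p u₀ u Du) (hl : 0 < l)
    (hlL : l ≤ p.L) (hA : 0 < A) (hB : 0 < B) :
    ∀ᵐ T ∂(volume.restrict (Ioi (0 : ℝ))),
      1 / 2 * (∫ q in Ioc 0 T ×ˢ box p.L, (p.ν + nuTurb p u q.1 q.2) * sumGradSq Du q.1 q.2) ≤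
        ∑ j, energyConst p u₀ l j + ∫ q in Ioc 0 T ×ˢ box p.L, budget p l A B u Du q.1 q.2 := by
  filter_upwards [ae_all_iff.2 (integral_dissipation_le hL hν hμ hτ h hen hl hlL)] with T hT
  have hv := fun j => h.integrableOn_viscous (l := l) hν hμ hτ T j
  have hc := fun j => h.integrableOn_convective (l := l) T j
  have hD := h.integrableOn_sumDissipation hμ hτ T
  have hs := Finset.sum_le_sum fun j (_ : j ∈ Finset.univ) => hT j
  rw [← integral_finsetSum _ fun j _ => h.integrableOn_dissipation hμ hτ T j] at hs
  simp only [← Finset.mul_sum] at hs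
  have hmono : ∫ q in Ioc 0 T ×ˢ box p.L, ∑ j, ((p.ν + nuTurb p u q.1 q.2) *
        gradDot (Du j q.1 q.2) (backgroundGrad p.L p.U l q.2)
        + dot (convect (u j q.1 q.2) (Du j q.1 q.2)) (background p.L p.U l q.2))
      ≤ ∫ q in Ioc 0 T ×ˢ box p.L, (1 / 2 * ((p.ν + nuTurb p u q.1 q.2) * sumGradSq Du q.1 q.2)
        + budget p l A B u Du q.1 q.2) :=
    integral_mono (integrable_finsetSum _ fun j _ => (hv j).add (hc j))
      ((hD.const_mul _).add (h.integrableOn_budget T))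
      fun q => sum_viscous_add_convective_le hν hμ hτ hA hB q.1 q.2
  rw [integral_finsetSum _ (fun j _ => by exact (hv j).add (hc j)),
    integral_add (hD.const_mul _) (h.integrableOn_budget T), integral_const_mul] at hmono
  have hsplit : ∀ j, ∫ q in Ioc 0 T ×ˢ box p.L, ((p.ν + nuTurb p u q.1 q.2) *
        gradDot (Du j q.1 q.2) (backgroundGrad p.L p.U l q.2)
        + dot (convect (u j q.1 q.2) (Du j q.1 q.2)) (background p.L p.U l q.2))
      = (∫ q in Ioc 0 T ×ˢ box p.L, (p.ν + nuTurb p u q.1 q.2) *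
          gradDot (Du j q.1 q.2) (backgroundGrad p.L p.U l q.2))
        + ∫ q in Ioc 0 T ×ˢ box p.L, dot (convect (u j q.1 q.2) (Du j q.1 q.2))
            (background p.L p.U l q.2) := fun j => integral_add (hv j) (hc j)
  simp only [hsplit, Finset.sum_add_distrib] at hmono hs
  simp only [sumGradSq] at hmono ⊢
  linarith

lemma lintegral_box_height {L : ℝ} (hL : 0 < L) {w : ℝ → ℝ} (hw : Continuous w)
    (h0 : ∀ z, 0 ≤ w z) :
    ∫⁻ x in box L, ENNReal.ofReal (w (x 2)) = ENNReal.ofReal (L ^ 2 * ∫ z in (0 : ℝ)..L, w z) := by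
  rw [lintegral_box L (F := fun x => ENNReal.ofReal (w (x 2)))
    (hw.comp (continuous_apply 2)).measurable.ennreal_ofReal.aemeasurable]
  simp only [ins_two]
  rw [lintegral_const, Measure.restrict_apply_univ, volume_face hL,
    ENNReal.ofReal_mul (by positivity), mul_comm, intervalIntegral.integral_of_le hL.le,
    ofReal_integral_eq_lintegral_ofReal hw.integrableOn_Ioc (ae_of_all _ h0),
    restrict_Ioc_eq_restrict_Ioo]

/-- The explicit profile terms are integrated exactly, and the `u - lid` term is converted by the
weighted Poincaré inequality into a multiple of `∫|∇u|²`. The fluctuation term is kept, because it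
is estimated in two different ways later. -/
lemma lintegral_budget_le (hL : 0 < p.L) (hν : 0 < p.ν) (hμ : 0 < p.μ) (hτ : 0 < p.τ)
    (hl : 0 < l) (hlL : l ≤ p.L) (hA : 0 < A) (hB : 0 < B) {t : ℝ}
    (ht : ∀ j, IsShearField p.L p.U (u j t) (Du j t)) :
    ∫⁻ x in box p.L, ENNReal.ofReal (budget p l A B u Du t x) ≤
      ENNReal.ofReal (J * p.L ^ 2 * (2 * p.ν * p.U ^ 2 / (3 * l) + p.U ^ 4 * l / (10 * B)))
        + ENNReal.ofReal (p.μ * p.τ / 2) * weightedFluct p l u t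
        + ENNReal.ofReal ((A + B) / 2 + p.U ^ 2 * l ^ 2 / (60 * A)) * totalGradSq p Du t := by
  have hp : Continuous fun z => profile p.L p.U l z ^ 2 := (continuous_profile _ _ _).pow 2
  have hp' : Continuous fun z => profile' p.L p.U l z ^ 2 := (continuous_profile' _ _ _).pow 2
  have h1 : Continuous fun z => J * (p.ν / 2 * profile' p.L p.U l z ^ 2
      + p.U ^ 2 / (2 * B) * profile p.L p.U l z ^ 2) := by fun_prop
  have e1 : ∫⁻ x in box p.L, ENNReal.ofReal (J * (p.ν / 2 * profile' p.L p.U l (x 2) ^ 2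
      + p.U ^ 2 / (2 * B) * profile p.L p.U l (x 2) ^ 2)) =
      ENNReal.ofReal (J * p.L ^ 2 * (2 * p.ν * p.U ^ 2 / (3 * l) + p.U ^ 4 * l / (10 * B))) := by
    rw [lintegral_box_height hL h1 fun z => by positivity, intervalIntegral.integral_const_mul,
      intervalIntegral.integral_add ((hp'.intervalIntegrable _ _).const_mul _)
        ((hp.intervalIntegrable _ _).const_mul _), intervalIntegral.integral_const_mul,
      intervalIntegral.integral_const_mul, integral_profile'_sq hl hlL,
      integral_profile_sq hl hlL]
    congr 1
    field_simp
    ring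
  have hu : ∀ j i, AEMeasurable (fun x => u j t x i) (volume.restrict (box p.L)) :=
    fun j i => ((ht j).grad i).memLp.1.aemeasurable
  have hd : ∀ j i k, AEMeasurable (fun x => Du j t x i k) (volume.restrict (box p.L)) :=
    fun j i k => (((ht j).grad i).grad_memLp k).1.aemeasurable
  have mG : AEMeasurable (fun x => sumGradSq Du t x) (volume.restrict (box p.L)) := by
    unfold sumGradSq gradSq
    fun_prop
  have mQ : AEMeasurable (fun x => sumFluctSq u t x) (volume.restrict (box p.L)) := by
    unfold sumFluctSq normSq fluct ensMean
    fun_prop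
  have mw : AEMeasurable (fun x : Vec => profile' p.L p.U l (x 2) ^ 2)
      (volume.restrict (box p.L)) := (hp'.comp (continuous_apply 2)).aemeasurable
  have mc : Measurable fun x : Vec => J * (p.ν / 2 * profile' p.L p.U l (x 2) ^ 2
      + p.U ^ 2 / (2 * B) * profile p.L p.U l (x 2) ^ 2) :=
    (h1.comp (continuous_apply 2)).measurable
  have hsplit : ∀ x, ENNReal.ofReal (budget p l A B u Du t x) =
      ENNReal.ofReal (J * (p.ν / 2 * profile' p.L p.U l (x 2) ^ 2
        + p.U ^ 2 / (2 * B) * profile p.L p.U l (x 2) ^ 2))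
      + (ENNReal.ofReal (p.μ * p.τ / 2)
          * ENNReal.ofReal (sumFluctSq u t x * profile' p.L p.U l (x 2) ^ 2)
        + (ENNReal.ofReal ((A + B) / 2) * ENNReal.ofReal (sumGradSq Du t x)
          + ENNReal.ofReal (1 / (2 * A)) * ENNReal.ofReal
            ((∑ j, normSq (u j t x - lid p.U)) * profile p.L p.U l (x 2) ^ 2))) := by
    intro x
    have h1 := sumFluctSq_nonneg u t x
    have h2 := sumGradSq_nonneg Du t x
    have h3 : 0 ≤ ∑ j, normSq (u j t x - lid p.U) :=
      Finset.sum_nonneg fun _ _ => normSq_nonneg _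
    rw [← ENNReal.ofReal_mul (by positivity), ← ENNReal.ofReal_mul (by positivity),
      ← ENNReal.ofReal_mul (by positivity), ← ENNReal.ofReal_add (by positivity) (by positivity),
      ← ENNReal.ofReal_add (by positivity) (by positivity),
      ← ENNReal.ofReal_add (by positivity) (by positivity), budget]
    congr 1
    ring
  simp only [hsplit]
  rw [lintegral_add_left mc.ennreal_ofReal, e1, lintegral_add_left'
      (AEMeasurable.const_mul (AEMeasurable.ennreal_ofReal (by exact mQ.mul mw)) _),
    lintegral_add_left' (mG.ennreal_ofReal.const_mul _),
    lintegral_const_mul' _ _ ENNReal.ofReal_ne_top, lintegral_const_mul' _ _ ENNReal.ofReal_ne_top,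
    lintegral_const_mul' _ _ ENNReal.ofReal_ne_top, ← add_assoc]
  refine add_le_add le_rfl ?_
  refine (add_le_add le_rfl (mul_le_mul_right (lintegral_sub_lid_sq_le hL ht hl hlL) _)).trans ?_
  rw [← mul_assoc, ← ENNReal.ofReal_mul (by positivity)]
  change _ * totalGradSq p Du t + _ ≤ _
  rw [← add_mul, ← ENNReal.ofReal_add (by positivity) (by positivity)]
  refine mul_le_mul_left (ENNReal.ofReal_le_ofReal (le_of_eq ?_)) _
  field_simp
  ring

/-- The energy bound, summed over the ensemble and integrated in time. -/
lemma half_lintegral_totalDissipation_le (hL : 0 < p.L) (hU : 0 < p.U) (hν : 0 < p.ν)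
    (hμ : 0 < p.μ) (hτ : 0 < p.τ)
    (h : IsWeakSolution p u₀ u Du) (hen : EnergyInequality p u₀ u Du) (hl : 0 < l)
    (hlL : l ≤ p.L) {κ : ℝ} (hκ : 0 < κ) (hlκ : 8 * (p.U * l) ≤ κ) :
    ∃ K : ℝ, 0 ≤ K ∧ ∀ T, 0 < T →
      ENNReal.ofReal (1 / 2) * ∫⁻ t in Ioc 0 T, totalDissipation p u Du t ≤
        ENNReal.ofReal (K + T * (J * p.L ^ 2 *
          (2 * p.ν * p.U ^ 2 / (3 * l) + p.U ^ 4 * l / (2 * κ))))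
        + ENNReal.ofReal (p.μ * p.τ / 2) * (∫⁻ t in Ioc 0 T, weightedFluct p l u t)
        + ENNReal.ofReal (κ / 6) * ∫⁻ t in Ioc 0 T, totalGradSq p Du t := by
  -- With `A = κ/8` and `B = κ/5` the gradient coefficient is `13κ/80` plus at most `κ/480` from the
  -- Poincaré term, that is `79κ/480 ≤ κ/6`. The choice of `B` turns `U⁴l/(10B)` into `U⁴l/(2κ)`.
  have hA : 0 < κ / 8 := by positivity
  have hB : 0 < κ / 5 := by positivity
  refine ⟨max 0 (∑ j, energyConst p u₀ l j), le_max_left _ _, ?_⟩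
  set K := max 0 (∑ j, energyConst p u₀ l j) with hK
  set c := J * p.L ^ 2 * (2 * p.ν * p.U ^ 2 / (3 * l) + p.U ^ 4 * l / (2 * κ)) with hc
  have hc0 : 0 ≤ c := by positivity
  have hgood : ∀ᵐ t ∂(volume.restrict (Ioi (0 : ℝ))),
      ∀ j, IsShearField p.L p.U (u j t) (Du j t) := ae_all_iff.2 h.shear
  set R : ℝ → ℝ≥0∞ := fun T => ENNReal.ofReal (K + T * c)
        + ENNReal.ofReal (p.μ * p.τ / 2) * (∫⁻ t in Ioc 0 T, weightedFluct p l u t)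
        + ENNReal.ofReal (κ / 6) * ∫⁻ t in Ioc 0 T, totalGradSq p Du t with hR
  have hRmono : ∀ S T, S ≤ T → R S ≤ R T := by
    intro S T hST
    simp only [hR]
    have : Ioc 0 S ⊆ Ioc 0 T := Ioc_subset_Ioc_right hST
    gcongr
  have hae : ∀ᵐ T ∂(volume.restrict (Ioi (0 : ℝ))),
      ENNReal.ofReal (1 / 2) * ∫⁻ t in Ioc 0 T, totalDissipation p u Du t ≤ R T := by
    filter_upwards [half_integral_sumDissipation_le hL hν hμ hτ h hen hl hlL hA hB,
      ae_restrict_mem measurableSet_Ioi] with T hT hT0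
    have hD := h.integrableOn_sumDissipation hμ hτ T
    have hb := h.integrableOn_budget (l := l) (A := κ / 8) (B := κ / 5) T
    have e1 := ofReal_integral_cylinder hD fun q => mul_nonneg
      (add_nonneg hν.le (nuTurb_nonneg hμ hτ u q.1 q.2)) (sumGradSq_nonneg Du q.1 q.2)
    have e2 := ofReal_integral_cylinder hb fun q => budget_nonneg hν hμ hτ hA hB q.1 q.2
    simp only [totalDissipation]
    rw [← e1, ← ENNReal.ofReal_mul (by norm_num)]
    refine (ENNReal.ofReal_le_ofReal (hT.trans (add_le_add (le_max_right 0 _) le_rfl))).trans ?_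
    refine ENNReal.ofReal_add_le.trans ?_
    rw [e2]
    have hgoodT : ∀ᵐ t ∂(volume.restrict (Ioc 0 T)),
        ∀ j, IsShearField p.L p.U (u j t) (Du j t) :=
      ae_restrict_of_ae_restrict_of_subset Ioc_subset_Ioi_self hgood
    have hstep : ∫⁻ t in Ioc 0 T, ∫⁻ x in box p.L,
        ENNReal.ofReal (budget p l (κ / 8) (κ / 5) u Du t x) ≤
        ∫⁻ t in Ioc 0 T, (ENNReal.ofReal c
          + ENNReal.ofReal (p.μ * p.τ / 2) * weightedFluct p l u t
          + ENNReal.ofReal (κ / 6) * totalGradSq p Du t) := by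
      refine lintegral_mono_ae ?_
      filter_upwards [hgoodT] with t ht
      refine (lintegral_budget_le hL hν hμ hτ hl hlL hA hB ht).trans ?_
      refine add_le_add (add_le_add (ENNReal.ofReal_le_ofReal (le_of_eq ?_)) le_rfl)
        (mul_le_mul_left (ENNReal.ofReal_le_ofReal ?_) _)
      · rw [hc]
        congr 2
        field_simp
        norm_num
      · have hUl : 0 < p.U * l := mul_pos hU hl
        have : p.U ^ 2 * l ^ 2 / (60 * (κ / 8)) ≤ κ / 480 := by
          rw [div_le_div_iff₀ (by positivity) (by norm_num)]
          nlinarith [mul_self_le_mul_self (by positivity) hlκ]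
        linarith
    -- Splitting the integral of the three summands needs only this one and the constant to be
    -- measurable in time.
    have mG : AEMeasurable (fun t => totalGradSq p Du t) (volume.restrict (Ioc 0 T)) := by
      have hm := (h.integrableOn_sumGradSq T).1.aemeasurable.ennreal_ofReal
      rw [Measure.volume_eq_prod, ← Measure.prod_restrict] at hm
      exact hm.lintegral_prod_right'
    refine (add_le_add le_rfl hstep).trans ?_
    rw [lintegral_add_right' _ (mG.const_mul _), lintegral_add_left measurable_const,
      lintegral_const_mul' _ _ ENNReal.ofReal_ne_top,
      lintegral_const_mul' _ _ ENNReal.ofReal_ne_top, lintegral_const,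
      Measure.restrict_apply_univ, Real.volume_Ioc, sub_zero, ← ENNReal.ofReal_mul hc0,
      ← add_assoc, ← add_assoc, ← ENNReal.ofReal_add (le_max_left _ _)
        (mul_nonneg hc0 (le_of_lt hT0)), mul_comm c T]
  intro T hT0
  -- Passage from almost every `T` to every `T`: the left side is the supremum over earlier times `S
  -- < T`, between `S` and `T` there is a good time, and both sides are monotone.
  have hIoo : ∫⁻ t in Ioc 0 T, totalDissipation p u Du t
      = ∫⁻ t in ⋃ n : ℕ, Ioc 0 (T - 1 / (n + 1)), totalDissipation p u Du t := by
    rw [restrict_Ioc_eq_restrict_Ioo]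
    congr 2
    ext t
    simp only [mem_Ioo, mem_iUnion, mem_Ioc]
    constructor
    · rintro ⟨h1, h2⟩
      obtain ⟨n, hn⟩ := exists_nat_one_div_lt (sub_pos.2 h2)
      exact ⟨n, h1, by linarith⟩
    · rintro ⟨n, h1, h2⟩
      exact ⟨h1, h2.trans_lt (sub_lt_self _ Nat.one_div_pos_of_nat)⟩
  rw [hIoo, setLIntegral_iUnion_of_directed, ENNReal.mul_iSup]
  · refine iSup_le fun n => ?_
    set S := T - 1 / ((n : ℝ) + 1) with hS
    have hST : max 0 S < T := max_lt hT0 (sub_lt_self _ Nat.one_div_pos_of_nat)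
    have hpos : (volume.restrict (Ioi (0 : ℝ))) (Ioo (max 0 S) T) ≠ 0 := by
      rw [Measure.restrict_apply measurableSet_Ioo, inter_eq_left.2
        (show Ioo (max 0 S) T ⊆ Ioi 0 from fun x hx => (le_max_left 0 S).trans_lt hx.1), Real.volume_Ioo]
      simpa using hST
    obtain ⟨T', hT', hT'2⟩ := ((frequently_ae_mem_iff.2 hpos).and_eventually hae).exists
    calc _ ≤ ENNReal.ofReal (1 / 2) * ∫⁻ t in Ioc 0 T', totalDissipation p u Du t := by
          have : Ioc 0 S ⊆ Ioc 0 T' := Ioc_subset_Ioc_right ((le_max_right 0 S).trans hT'.1.le)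
          gcongr
      _ ≤ R T' := hT'2
      _ ≤ R T := hRmono _ _ hT'.2.le
  · refine directed_of_isDirected_le fun m n hmn => Ioc_subset_Ioc_right ?_
    have := Nat.one_div_le_one_div (α := ℝ) hmn
    linarith

end

/-! ### Long time averages. -/

lemma limsup_add_le_ennreal {α : Type*} {F : Filter α} (u v : α → ℝ≥0∞) :
    limsup (fun x => u x + v x) F ≤ limsup u F + limsup v F := by
  refine ENNReal.le_of_forall_pos_le_add fun ε hε hlt => ?_
  have hu := (ENNReal.add_lt_top.1 hlt).1.ne
  have hv := (ENNReal.add_lt_top.1 hlt).2.ne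
  have hε2 : (ε : ℝ≥0∞) / 2 ≠ 0 := by simp [hε.ne']
  refine limsup_le_of_le (by isBoundedDefault) ?_
  filter_upwards [eventually_lt_of_limsup_lt (ENNReal.lt_add_right hu hε2),
    eventually_lt_of_limsup_lt (ENNReal.lt_add_right hv hε2)] with x hx hy
  calc u x + v x ≤ (limsup u F + ε / 2) + (limsup v F + ε / 2) := add_le_add hx.le hy.le
    _ = limsup u F + limsup v F + ε := by rw [add_add_add_comm, ENNReal.add_halves]

lemma longTimeAvg_mono {f g : ℝ → ℝ≥0∞} (h : ∀ᵐ t ∂(volume.restrict (Ioi (0 : ℝ))), f t ≤ g t) :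
    longTimeAvg f ≤ longTimeAvg g := by
  refine limsup_le_limsup (Eventually.of_forall fun T => mul_le_mul_right (lintegral_mono_ae
    (ae_restrict_of_ae_restrict_of_subset Ioc_subset_Ioi_self h)) _)

lemma longTimeAvg_congr {f g : ℝ → ℝ≥0∞} (h : ∀ᵐ t ∂(volume.restrict (Ioi (0 : ℝ))), f t = g t) :
    longTimeAvg f = longTimeAvg g :=
  le_antisymm (longTimeAvg_mono (h.mono fun _ => le_of_eq))
    (longTimeAvg_mono (h.mono fun _ => ge_of_eq))

lemma longTimeAvg_const_mul {c : ℝ≥0∞} (hc : c ≠ ⊤) (f : ℝ → ℝ≥0∞) :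
    longTimeAvg (fun t => c * f t) = c * longTimeAvg f := by
  rw [longTimeAvg, longTimeAvg, ← ENNReal.limsup_const_mul_of_ne_top hc]
  refine congrArg (fun F => limsup F atTop) (funext fun T => ?_)
  rw [lintegral_const_mul' _ _ hc, mul_left_comm]

lemma longTimeAvg_const (c : ℝ≥0∞) : longTimeAvg (fun _ => c) = c := by
  have : (fun T : ℝ => (ENNReal.ofReal T)⁻¹ * ∫⁻ _ in Ioc 0 T, c) =ᶠ[atTop] fun _ => c := by
    filter_upwards [eventually_gt_atTop 0] with T hT
    rw [lintegral_const, Measure.restrict_apply_univ, Real.volume_Ioc, sub_zero, mul_comm,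
      mul_assoc, ENNReal.mul_inv_cancel (by simpa using hT) ENNReal.ofReal_ne_top, mul_one]
  rw [longTimeAvg, limsup_congr this, limsup_const]

/-- After division by `T` the constant `K` disappears in the limit; the limsup is subadditive and
commutes with finite factors. -/
lemma longTimeAvg_le_of_integrated {f g h : ℝ → ℝ≥0∞} {a b c : ℝ≥0∞} (ha : a ≠ ⊤) (hb : b ≠ ⊤)
    (hc : c ≠ ⊤) {K C : ℝ}
    (H : ∀ T, 0 < T → a * ∫⁻ t in Ioc 0 T, f t ≤ ENNReal.ofReal (K + T * C)
      + b * (∫⁻ t in Ioc 0 T, g t) + c * ∫⁻ t in Ioc 0 T, h t) :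
    a * longTimeAvg f ≤ ENNReal.ofReal C + b * longTimeAvg g + c * longTimeAvg h := by
  have hlim : limsup (fun T : ℝ => ENNReal.ofReal (K * T⁻¹ + C)) atTop = ENNReal.ofReal C := by
    refine Tendsto.limsup_eq ((ENNReal.continuous_ofReal.tendsto C).comp ?_)
    simpa using (tendsto_inv_atTop_zero.const_mul K).add_const C
  rw [longTimeAvg, longTimeAvg, longTimeAvg, ← ENNReal.limsup_const_mul_of_ne_top ha,
    ← ENNReal.limsup_const_mul_of_ne_top hb, ← ENNReal.limsup_const_mul_of_ne_top hc, ← hlim]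
  refine le_trans ?_ (add_le_add (limsup_add_le_ennreal _ _) le_rfl)
  refine le_trans ?_ (limsup_add_le_ennreal _ _)
  refine limsup_le_limsup ?_
  filter_upwards [eventually_gt_atTop 0] with T hT
  have h1 : ENNReal.ofReal (K * T⁻¹ + C) = (ENNReal.ofReal T)⁻¹ * ENNReal.ofReal (K + T * C) := by
    rw [← ENNReal.ofReal_inv_of_pos hT, ← ENNReal.ofReal_mul (by positivity)]
    congr 1
    field_simp
  rw [h1, mul_left_comm a, mul_left_comm b, mul_left_comm c, ← mul_add, ← mul_add]
  exact mul_le_mul_right (H T hT) _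

lemma cancel_sixth {D Y : ℝ≥0∞} (hD : D ≠ ⊤)
    (h : ENNReal.ofReal (1 / 2) * D ≤ Y + ENNReal.ofReal (1 / 6) * D) :
    ENNReal.ofReal (1 / 3) * D ≤ Y := by
  have e : ENNReal.ofReal (1 / 2) = ENNReal.ofReal (1 / 3) + ENNReal.ofReal (1 / 6) := by
    rw [← ENNReal.ofReal_add (by norm_num) (by norm_num)]
    norm_num
  rw [e, add_mul] at h
  exact (ENNReal.add_le_add_iff_right (ENNReal.mul_ne_top ENNReal.ofReal_ne_top hD)).1 h

/-! ### The near wall region, normalizations and finiteness. -/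

/-- The two sets differ only on the side faces. The condition `β ≤ 1` keeps the near wall region
above the bottom wall; otherwise it would leave the box. -/
lemma slab_ae_eq_nearWall {L β : ℝ} (hL : 0 < L) (hβ : β ≤ 1) :
    slab L (β * L) =ᵐ[volume] nearWall L β := by
  have h1 : slab L (β * L)
      = Set.pi univ (![Ioo 0 L, Ioo 0 L, Ioo ((1 - β) * L) L] : Fin 3 → Set ℝ) := by
    ext x
    have : L - β * L = (1 - β) * L := by ring
    have h0 : 0 ≤ (1 - β) * L := mul_nonneg (sub_nonneg.2 hβ) hL.le
    simp only [slab, box, mem_inter_iff, Set.mem_pi, mem_univ, true_implies, mem_ofPred_eq,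
      Fin.forall_fin_succ, this, Matrix.cons_val_zero, Matrix.cons_val_succ, mem_Ioo]
    simp
    constructor
    · rintro ⟨⟨a, b, c⟩, d⟩
      exact ⟨a, b, d, c.2⟩
    · rintro ⟨a, b, d, c⟩
      exact ⟨⟨a, b, h0.trans_lt d, c⟩, d⟩
  have h2 : nearWall L β
      = Set.pi univ (![Icc 0 L, Icc 0 L, Ioo ((1 - β) * L) L] : Fin 3 → Set ℝ) := by
    ext x
    simp [nearWall, Fin.forall_fin_succ, and_assoc]
  rw [h1, h2]
  refine Measure.ae_eq_set_pi fun i _ => ?_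
  fin_cases i
  · exact Ioo_ae_eq_Icc
  · exact Ioo_ae_eq_Icc
  · exact ae_eq_refl _

lemma volume_nearWall {L β : ℝ} (hL : 0 < L) :
    volume (nearWall L β) = ENNReal.ofReal (β * L ^ 3) := by
  have h2 : nearWall L β
      = Set.pi univ (![Icc 0 L, Icc 0 L, Ioo ((1 - β) * L) L] : Fin 3 → Set ℝ) := by
    ext x
    simp [nearWall, Fin.forall_fin_succ, and_assoc]
  rw [h2, volume_pi_pi]
  simp only [Fin.prod_univ_three, Matrix.cons_val_zero, Matrix.cons_val_one, Matrix.cons_val]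
  rw [Real.volume_Icc, Real.volume_Ioo, ← ENNReal.ofReal_mul (by linarith),
    ← ENNReal.ofReal_mul (by nlinarith)]
  congr 1
  ring

section
variable {p : Params} {J : ℕ} {u₀ : Fin J → Vec → Vec} {u : Fin J → ℝ → Vec → Vec}
  {Du : Fin J → ℝ → Vec → Grad}

lemma ensMeanENN_spaceAvg_box (hL : 0 < p.L) (hJ : 0 < J) {f : Fin J → Vec → ℝ}
    (hf : ∀ j, AEMeasurable (f j) (volume.restrict (box p.L))) (h0 : ∀ j x, 0 ≤ f j x) :
    ensMeanENN (fun j => spaceAvg (box p.L) (f j)) =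
      ENNReal.ofReal (1 / (J * p.L ^ 3)) * ∫⁻ x in box p.L, ENNReal.ofReal (∑ j, f j x) := by
  have hJ' : (0 : ℝ) < J := by exact_mod_cast hJ
  simp only [ensMeanENN, spaceAvg]
  rw [← Finset.mul_sum, ← lintegral_finsetSum' _ fun j _ => (hf j).ennreal_ofReal]
  simp only [ENNReal.ofReal_sum_of_nonneg fun j (_ : j ∈ Finset.univ) => h0 j _]
  rw [volume_box hL, ENNReal.div_eq_inv_mul, ← mul_assoc, ← ENNReal.ofReal_natCast,
    ← ENNReal.ofReal_inv_of_pos hJ', ← ENNReal.ofReal_inv_of_pos (by positivity),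
    ← ENNReal.ofReal_mul (by positivity)]
  congr 2
  field_simp

lemma longTimeAvg_dissipation (hL : 0 < p.L) (hν : 0 < p.ν) (hμ : 0 < p.μ) (hτ : 0 < p.τ)
    (hJ : 0 < J) (h : IsWeakSolution p u₀ u Du) :
    longTimeAvg (dissipation p u Du) =
      ENNReal.ofReal (1 / (J * p.L ^ 3)) * longTimeAvg (totalDissipation p u Du) := by
  rw [← longTimeAvg_const_mul ENNReal.ofReal_ne_top]
  refine longTimeAvg_congr ?_
  filter_upwards [ae_all_iff.2 h.shear] with t ht
  have hu : ∀ j i, AEMeasurable (fun x => u j t x i) (volume.restrict (box p.L)) :=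
    fun j i => ((ht j).grad i).memLp.1.aemeasurable
  have hd : ∀ j i k, AEMeasurable (fun x => Du j t x i k) (volume.restrict (box p.L)) :=
    fun j i k => (((ht j).grad i).grad_memLp k).1.aemeasurable
  rw [dissipation, ensMeanENN_spaceAvg_box hL hJ]
  · rw [totalDissipation]
    simp only [sumGradSq, Finset.mul_sum, add_mul]
  · intro j
    unfold nuTurb gradSq ensMean normSq fluct ensMean
    fun_prop
  · intro j x
    have h1 := gradSq_nonneg (Du j t x)
    have h2 := nuTurb_nonneg hμ hτ u t x
    positivity

lemma longTimeAvg_meanGradSq (hL : 0 < p.L) (hJ : 0 < J) (h : IsWeakSolution p u₀ u Du) :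
    longTimeAvg (meanGradSq p Du) =
      ENNReal.ofReal (1 / (J * p.L ^ 3)) * longTimeAvg (totalGradSq p Du) := by
  rw [← longTimeAvg_const_mul ENNReal.ofReal_ne_top]
  refine longTimeAvg_congr ?_
  filter_upwards [ae_all_iff.2 h.shear] with t ht
  have hd : ∀ j i k, AEMeasurable (fun x => Du j t x i k) (volume.restrict (box p.L)) :=
    fun j i k => (((ht j).grad i).grad_memLp k).1.aemeasurable
  rw [meanGradSq, ensMeanENN_spaceAvg_box hL hJ]
  · rfl
  · intro j
    unfold gradSq
    fun_prop
  · exact fun j x => gradSq_nonneg _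

lemma longTimeAvg_totalGradSq_pos (hL : 0 < p.L) (hU : 0 < p.U) (hJ : 0 < J)
    (h : IsWeakSolution p u₀ u Du) : 0 < longTimeAvg (totalGradSq p Du) := by
  have hJ' : (0 : ℝ) < J := by exact_mod_cast hJ
  have h1 : ENNReal.ofReal (J * (p.U ^ 2 * p.L)) ≤ longTimeAvg (totalGradSq p Du) := by
    rw [← longTimeAvg_const (ENNReal.ofReal (J * (p.U ^ 2 * p.L)))]
    refine longTimeAvg_mono ?_
    filter_upwards [ae_all_iff.2 h.shear] with t ht
    exact le_totalGradSq hL hU ht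
  exact (ENNReal.ofReal_pos.2 (by positivity)).trans_le h1

lemma mul_longTimeAvg_totalGradSq_le (hν : 0 < p.ν) (hμ : 0 < p.μ) (hτ : 0 < p.τ) :
    ENNReal.ofReal p.ν * longTimeAvg (totalGradSq p Du)
      ≤ longTimeAvg (totalDissipation p u Du) := by
  rw [← longTimeAvg_const_mul ENNReal.ofReal_ne_top]
  exact longTimeAvg_mono (ae_of_all _ fun t => mul_totalGradSq_le hν hμ hτ)

/-- With `κ = ν` the gradient term costs a sixth of the dissipation, and
`weightedFluct_le_dissipation` costs another sixth. As both are subtracted from a half at finite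
`T`, a sixth of the dissipation grows at most linearly in `T`. -/
lemma longTimeAvg_totalDissipation_lt_top (hL : 0 < p.L) (hU : 0 < p.U) (hν : 0 < p.ν)
    (hμ : 0 < p.μ) (hτ : 0 < p.τ) (hJ : 0 < J) (h : IsWeakSolution p u₀ u Du)
    (hen : EnergyInequality p u₀ u Du) : longTimeAvg (totalDissipation p u Du) < ⊤ := by
  have hJ' : (0 : ℝ) < J := by exact_mod_cast hJ
  set l := min p.L (p.ν / (8 * p.U)) with hl_def
  have hl : 0 < l := lt_min hL (by positivity)
  have hlκ : 8 * (p.U * l) ≤ p.ν := by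
    have : l ≤ p.ν / (8 * p.U) := min_le_right _ _
    rw [le_div_iff₀ (by positivity)] at this
    linarith
  obtain ⟨K, hK, hmain⟩ := half_lintegral_totalDissipation_le hL hU hν hμ hτ h hen hl
    (min_le_left _ _) hν hlκ
  set c := J * p.L ^ 2 * (2 * p.ν * p.U ^ 2 / (3 * l) + p.U ^ 4 * l / (2 * p.ν)) with hc
  -- Chosen so that `(μτ/2) · (4U²/(3l)) · δJ/(μτ) = 1/6`.
  set δ := l / (4 * p.U ^ 2 * J) with hδ_def
  have hδ : 0 < δ := by positivity
  have hc0 : 0 ≤ c := by positivity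
  set c' := p.μ * p.τ / 2 * (4 * p.U ^ 2 / (3 * l) * (p.L ^ 3 / δ)) with hc'
  have hc'0 : 0 ≤ c' := by positivity
  have hT : ∀ T, 0 < T → ENNReal.ofReal (1 / 6) * ∫⁻ t in Ioc 0 T, totalDissipation p u Du t ≤
      ENNReal.ofReal (K + T * (c + c')) + 0 * (∫⁻ t in Ioc (0 : ℝ) T, 0)
        + 0 * ∫⁻ t in Ioc (0 : ℝ) T, 0 := by
    intro T hT0
    have hgood : ∀ᵐ t ∂(volume.restrict (Ioc (0 : ℝ) T)),
        ∀ j, IsShearField p.L p.U (u j t) (Du j t) :=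
      ae_restrict_of_ae_restrict_of_subset Ioc_subset_Ioi_self (ae_all_iff.2 h.shear)
    -- For finite `T` the dissipation is integrable by the definition of a weak solution, so it may
    -- be cancelled in `ℝ≥0∞`.
    have hfin : ∫⁻ t in Ioc 0 T, totalDissipation p u Du t ≠ ⊤ := by
      have e := ofReal_integral_cylinder (h.integrableOn_sumDissipation hμ hτ T) fun q =>
        mul_nonneg (add_nonneg hν.le (nuTurb_nonneg hμ hτ u q.1 q.2))
          (sumGradSq_nonneg Du q.1 q.2)
      simp only [totalDissipation]
      rw [← e]
      exact ENNReal.ofReal_ne_top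
    set E := ∫⁻ t in Ioc 0 T, totalDissipation p u Du t with hE
    have hQ : ENNReal.ofReal (p.μ * p.τ / 2) * (∫⁻ t in Ioc 0 T, weightedFluct p l u t) ≤
        ENNReal.ofReal (1 / 6) * E + ENNReal.ofReal (T * c') := by
      have hq : ∫⁻ t in Ioc 0 T, weightedFluct p l u t ≤ ∫⁻ t in Ioc 0 T,
          ENNReal.ofReal (4 * p.U ^ 2 / (3 * l)) *
          (ENNReal.ofReal (δ * (J / (p.μ * p.τ))) * totalDissipation p u Du t
            + ENNReal.ofReal (p.L ^ 3 / δ)) := by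
        refine lintegral_mono_ae ?_
        filter_upwards [hgood] with t ht
        exact weightedFluct_le_dissipation hL hν hμ hτ hJ ht hl (min_le_left _ _) hδ
      refine (mul_le_mul_right hq _).trans (le_of_eq ?_)
      rw [lintegral_const_mul' _ _ ENNReal.ofReal_ne_top, lintegral_add_right _ measurable_const,
        lintegral_const_mul' _ _ ENNReal.ofReal_ne_top, lintegral_const,
        Measure.restrict_apply_univ, Real.volume_Ioc, sub_zero, mul_add, mul_add, ← mul_assoc,
        ← mul_assoc, ← ENNReal.ofReal_mul (by positivity), ← ENNReal.ofReal_mul (by positivity),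
        ← ENNReal.ofReal_mul (by positivity), ← ENNReal.ofReal_mul (by positivity),
        ← ENNReal.ofReal_mul (by positivity)]
      congr 2
      · rw [hδ_def]
        congr 1
        field_simp
        norm_num
      · rw [hc']
        ring
    have hG : ENNReal.ofReal (p.ν / 6) * (∫⁻ t in Ioc 0 T, totalGradSq p Du t)
        ≤ ENNReal.ofReal (1 / 6) * E := by
      have : p.ν / 6 = 1 / 6 * p.ν := by ring
      rw [this, ENNReal.ofReal_mul (by norm_num), mul_assoc]
      refine mul_le_mul_right ?_ _
      rw [← lintegral_const_mul' _ _ ENNReal.ofReal_ne_top]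
      exact lintegral_mono fun t => mul_totalGradSq_le hν hμ hτ
    have h1 := (hmain T hT0).trans (add_le_add (add_le_add le_rfl hQ) hG)
    have h2 : ENNReal.ofReal (1 / 3) * E ≤ ENNReal.ofReal (K + T * c)
        + (ENNReal.ofReal (1 / 6) * E + ENNReal.ofReal (T * c')) := cancel_sixth hfin h1
    have e3 : ENNReal.ofReal (1 / 3) = ENNReal.ofReal (1 / 6) + ENNReal.ofReal (1 / 6) := by
      rw [← ENNReal.ofReal_add (by norm_num) (by norm_num)]
      norm_num
    rw [e3, add_mul, add_left_comm] at h2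
    have h3 := (ENNReal.add_le_add_iff_left
      (ENNReal.mul_ne_top ENNReal.ofReal_ne_top hfin)).1 h2
    rw [← ENNReal.ofReal_add (by positivity) (by positivity)] at h3
    simp only [zero_mul, add_zero]
    refine h3.trans (ENNReal.ofReal_le_ofReal (le_of_eq ?_))
    ring
  have hfinal := longTimeAvg_le_of_integrated ENNReal.ofReal_ne_top ENNReal.zero_ne_top
    ENNReal.zero_ne_top hT
  simp only [zero_mul, add_zero] at hfinal
  by_contra htop
  rw [not_lt, top_le_iff] at htop
  rw [htop, ENNReal.mul_top (by simp)] at hfinal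
  exact absurd hfinal (not_le.2 ENNReal.ofReal_lt_top)

/-- The volume `βL³` is proportional to `ν_eff`, so the factor `ν_eff` cancels and the prefactor is
explicit. -/
lemma wallFluct_eq (hL : 0 < p.L) (hU : 0 < p.U) (hJ : 0 < J) (hn : 0 < nuEff p u Du)
    (hβ : beta p u Du ≤ 1) :
    wallFluct p u Du = ENNReal.ofReal (8 * p.U / (J * p.L ^ 2)) *
      longTimeAvg fun t => ∫⁻ x in slab p.L (beta p u Du * p.L),
        ENNReal.ofReal (sumFluctDzSq Du t x) := by
  have hJ' : (0 : ℝ) < J := by exact_mod_cast hJ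
  have hb : beta p u Du = nuEff p u Du / (8 * (p.U * p.L)) := by
    rw [beta, reEff, inv_div]
    ring
  have hb0 : 0 < beta p u Du := by rw [hb]; positivity
  rw [← longTimeAvg_const_mul ENNReal.ofReal_ne_top, wallFluct]
  refine congrArg longTimeAvg (funext fun t => ?_)
  rw [spaceAvg, volume_nearWall hL,
    ← Measure.restrict_congr_set (slab_ae_eq_nearWall hL hβ)]
  have : ∀ x, ENNReal.ofReal (nuEff p u Du * ensMean fun j => normSq (fluctDz Du j t x))
      = ENNReal.ofReal (nuEff p u Du / J) * ENNReal.ofReal (sumFluctDzSq Du t x) := by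
    intro x
    rw [← ENNReal.ofReal_mul (by positivity), ensMean, sumFluctDzSq]
    congr 1
    ring
  simp only [this]
  rw [lintegral_const_mul' _ _ ENNReal.ofReal_ne_top, ← mul_assoc,
    ← ENNReal.ofReal_inv_of_pos (by positivity), ← ENNReal.ofReal_mul (by positivity)]
  congr 2
  rw [hb]
  field_simp

lemma wallFluct_le_wallGrad (p : Params) (u : Fin J → ℝ → Vec → Vec)
    (Du : Fin J → ℝ → Vec → Grad) : wallFluct p u Du ≤ wallGrad p u Du := by
  refine longTimeAvg_mono (ae_of_all _ fun t => ?_)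
  refine mul_le_mul_right (lintegral_mono fun x => ENNReal.ofReal_le_ofReal ?_) _
  refine mul_le_mul_of_nonneg_left ?_ ENNReal.toReal_nonneg
  exact div_le_div_of_nonneg_right (sum_normSq_fluctDz_le Du t x) (Nat.cast_nonneg _)

end

/-! ### The numerical constant. -/

lemma C26_sq : C26 ^ 2 = 256 / (27 * Real.pi ^ 2) := by
  have g3 : Real.Gamma 3 = 2 := by
    rw [show (3 : ℝ) = (2 : ℕ) + 1 by norm_num, Real.Gamma_nat_eq_factorial]
    norm_num
  have g5 : Real.Gamma (5 / 2) = 3 / 4 * √Real.pi := by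
    have h1 := Real.Gamma_add_one (s := 1 / 2) (by norm_num)
    have h2 := Real.Gamma_add_one (s := 3 / 2) (by norm_num)
    norm_num at h1 h2
    rw [h2, h1, Real.Gamma_one_half_eq]
    ring
  have hpi := Real.pi_pos
  have hs : √Real.pi ^ 2 = Real.pi := Real.sq_sqrt hpi.le
  have h13 : ((1 / 3 : ℝ) ^ (1 / 2 : ℝ)) ^ 2 = 1 / 3 := by
    rw [← Real.sqrt_eq_rpow, Real.sq_sqrt (by norm_num)]
  have e : C26 = (1 / 3 : ℝ) ^ (1 / 2 : ℝ) *
      (2 * Real.Gamma 3 / (Real.Gamma (1 / 2) * Real.Gamma (5 / 2))) := by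
    rw [C26, hardyConst]
    norm_num
  rw [e, mul_pow, h13, g3, g5, Real.Gamma_one_half_eq, div_pow, mul_pow, mul_pow, mul_pow, hs]
  field_simp
  norm_num

/-- The argument yields `1/16` in front of the near wall term. With `3^{1/3} ≥ 1` it is enough that
`C₂₆² ≥ 3/8`, which follows already from `π < 4`. -/
lemma one_div_sixteen_le : 1 / 16 ≤ (3 : ℝ) ^ (1 / 3 : ℝ) / 6 * C26 ^ 2 := by
  have h1 : (1 : ℝ) ≤ (3 : ℝ) ^ (1 / 3 : ℝ) := Real.one_le_rpow (by norm_num) (by norm_num)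
  have hpi := Real.pi_pos
  have h2 : 3 / 8 ≤ C26 ^ 2 := by
    rw [C26_sq, div_le_div_iff₀ (by norm_num) (by positivity)]
    nlinarith [Real.pi_lt_four]
  nlinarith

end EEV

/-! ### The two bounds. -/

theorem mainTheorem2 (p : EEV.Params) (hL : 0 < p.L) (hU : 0 < p.U) (hν : 0 < p.ν)
    (hμ : 0 < p.μ) (hτ : 0 < p.τ) (J : ℕ) (hJ : 0 < J)
    (u₀ : Fin J → EEV.Vec → EEV.Vec) (u : Fin J → ℝ → EEV.Vec → EEV.Vec)
    (Du : Fin J → ℝ → EEV.Vec → EEV.Grad)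
    (hsol : EEV.IsWeakSolution p u₀ u Du) (hen : EEV.EnergyInequality p u₀ u Du) :
    (EEV.longTimeAvg (EEV.dissipation p u Du) < ⊤ ∧
      0 < EEV.longTimeAvg (EEV.meanGradSq p Du) ∧
      EEV.longTimeAvg (EEV.meanGradSq p Du) < ⊤) ∧
    (EEV.beta p u Du ≤ 1 →
      EEV.longTimeAvg (EEV.dissipation p u Du) ≤
        ENNReal.ofReal ((5 / 2 + 16 * (p.ν / EEV.nuEff p u Du)) * (p.U ^ 3 / p.L))
          + ENNReal.ofReal ((3 : ℝ) ^ (1 / 3 : ℝ) / 6 * EEV.C26 ^ 2 * p.μ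
              * (p.τ / EEV.turnover p)) * EEV.wallFluct p u Du ∧
      EEV.longTimeAvg (EEV.dissipation p u Du) ≤
        ENNReal.ofReal ((5 / 2 + 16 * (p.ν / EEV.nuEff p u Du)) * (p.U ^ 3 / p.L))
          + ENNReal.ofReal ((3 : ℝ) ^ (1 / 3 : ℝ) / 6 * EEV.C26 ^ 2 * p.μ
              * (p.τ / EEV.turnover p)) * EEV.wallGrad p u Du) := by
  have hJ' : (0 : ℝ) < J := by exact_mod_cast hJ
  have hDtop := EEV.longTimeAvg_totalDissipation_lt_top hL hU hν hμ hτ hJ hsol hen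
  have hGpos := EEV.longTimeAvg_totalGradSq_pos hL hU hJ hsol
  have hGD := EEV.mul_longTimeAvg_totalGradSq_le (p := p) (u := u) (Du := Du) hν hμ hτ
  have hd0 : ENNReal.ofReal (1 / (J * p.L ^ 3)) ≠ 0 := by
    rw [Ne, ENNReal.ofReal_eq_zero, not_le]
    positivity
  have hν0 : ENNReal.ofReal p.ν ≠ 0 := by
    rw [Ne, ENNReal.ofReal_eq_zero, not_le]
    exact hν
  have hGtop : EEV.longTimeAvg (EEV.totalGradSq p Du) < ⊤ := by
    by_contra htop
    rw [not_lt, top_le_iff] at htop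
    rw [htop, ENNReal.mul_top hν0, top_le_iff] at hGD
    exact hDtop.ne hGD
  rw [EEV.longTimeAvg_dissipation hL hν hμ hτ hJ hsol, EEV.longTimeAvg_meanGradSq hL hJ hsol]
  refine ⟨⟨ENNReal.mul_lt_top ENNReal.ofReal_lt_top hDtop,
    ENNReal.mul_pos hd0 hGpos.ne', ENNReal.mul_lt_top ENNReal.ofReal_lt_top hGtop⟩, fun hβ => ?_⟩
  have hratio : EEV.nuEff p u Du = (EEV.longTimeAvg (EEV.totalDissipation p u Du)
      / EEV.longTimeAvg (EEV.totalGradSq p Du)).toReal := by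
    rw [EEV.nuEff, EEV.longTimeAvg_dissipation hL hν hμ hτ hJ hsol,
      EEV.longTimeAvg_meanGradSq hL hJ hsol,
      ENNReal.mul_div_mul_left _ _ hd0 ENNReal.ofReal_ne_top]
  set D := EEV.longTimeAvg (EEV.totalDissipation p u Du) with hD
  set G := EEV.longTimeAvg (EEV.totalGradSq p Du) with hG
  have hDpos : 0 < D := (ENNReal.mul_pos hν0 hGpos.ne').trans_le hGD
  have hn : 0 < EEV.nuEff p u Du := by
    rw [hratio]
    exact ENNReal.toReal_pos (ENNReal.div_pos hDpos.ne' hGtop.ne).ne'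
      (ENNReal.div_lt_top hDtop.ne hGpos.ne').ne
  have hnG : ENNReal.ofReal (EEV.nuEff p u Du) * G = D := by
    rw [hratio, ENNReal.ofReal_toReal (ENNReal.div_lt_top hDtop.ne hGpos.ne').ne]
    exact ENNReal.div_mul_cancel hGpos.ne' hGtop.ne
  set n := EEV.nuEff p u Du with hn_def
  set l := EEV.beta p u Du * p.L with hl_def
  have hl_eq : l = n / (8 * p.U) := by
    rw [hl_def, EEV.beta, EEV.reEff, inv_div, ← hn_def]
    field_simp
  have hl : 0 < l := by rw [hl_eq]; positivity
  have hlL : l ≤ p.L := by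
    rw [hl_def]
    exact mul_le_of_le_one_left hL.le hβ
  -- This holds with equality: `β` is the largest relative thickness that the energy budget allows
  -- for `κ = ν_eff`.
  have hlκ : 8 * (p.U * l) ≤ n := by
    rw [hl_eq]
    exact le_of_eq (by field_simp)
  obtain ⟨K, hK, hmain⟩ := EEV.half_lintegral_totalDissipation_le hL hU hν hμ hτ hsol hen hl
    hlL hn hlκ
  have hlim := EEV.longTimeAvg_le_of_integrated ENNReal.ofReal_ne_top ENNReal.ofReal_ne_top
    ENNReal.ofReal_ne_top hmain
  set F := EEV.longTimeAvg fun t => ∫⁻ x in EEV.slab p.L l,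
    ENNReal.ofReal (EEV.sumFluctDzSq Du t x) with hF
  have hQ : EEV.longTimeAvg (EEV.weightedFluct p l u) ≤ ENNReal.ofReal (p.U ^ 2 / 3) * F := by
    rw [hF, ← EEV.longTimeAvg_const_mul ENNReal.ofReal_ne_top]
    refine EEV.longTimeAvg_mono ?_
    filter_upwards [ae_all_iff.2 hsol.shear] with t ht
    exact EEV.weightedFluct_le_slab hL ht hl hlL
  -- Here the definition of `ν_eff` enters: `ν_eff G = D` turns the gradient term into a sixth of
  -- the dissipation.
  have hG6 : ENNReal.ofReal (n / 6) * G = ENNReal.ofReal (1 / 6) * D := by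
    rw [← hnG, ← mul_assoc, ← ENNReal.ofReal_mul (by norm_num)]
    congr 2
    ring
  have hthird := EEV.cancel_sixth hDtop.ne
    ((hlim.trans (add_le_add (add_le_add le_rfl (mul_le_mul_right hQ _)) hG6.le)))
  have hfluct : ENNReal.ofReal (1 / (J * p.L ^ 3)) * D ≤
        ENNReal.ofReal ((5 / 2 + 16 * (p.ν / n)) * (p.U ^ 3 / p.L))
          + ENNReal.ofReal ((3 : ℝ) ^ (1 / 3 : ℝ) / 6 * EEV.C26 ^ 2 * p.μ
              * (p.τ / EEV.turnover p)) * EEV.wallFluct p u Du := by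
    have h3 : ENNReal.ofReal (1 / (J * p.L ^ 3)) * D
        = ENNReal.ofReal (3 / (J * p.L ^ 3)) * (ENNReal.ofReal (1 / 3) * D) := by
      rw [← mul_assoc, ← ENNReal.ofReal_mul (by positivity)]
      congr 2
      ring
    rw [h3]
    refine (mul_le_mul_right hthird _).trans ?_
    rw [mul_add, EEV.wallFluct_eq hL hU hJ hn hβ]
    refine add_le_add ?_ ?_
    · rw [← ENNReal.ofReal_mul (by positivity)]
      apply ENNReal.ofReal_le_ofReal
      -- With `l = ν_eff/(8U)` the molecular term gives exactly `16 ν/ν_eff`, and the lid transport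
      -- gives `3/16`, which is below the stated `5/2`.
      have e : 3 / (J * p.L ^ 3) * (J * p.L ^ 2 *
          (2 * p.ν * p.U ^ 2 / (3 * l) + p.U ^ 4 * l / (2 * n)))
          = (3 / 16 + 16 * (p.ν / n)) * (p.U ^ 3 / p.L) := by
        rw [hl_eq]
        field_simp
        ring
      rw [e]
      have : 0 ≤ p.U ^ 3 / p.L := by positivity
      exact mul_le_mul_of_nonneg_right (by norm_num) this
    · change _ ≤ _ * (_ * F)
      rw [← mul_assoc, ← mul_assoc, ← mul_assoc, mul_assoc (ENNReal.ofReal _)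
        (ENNReal.ofReal _) (ENNReal.ofReal _), ← ENNReal.ofReal_mul (by positivity),
        ← ENNReal.ofReal_mul (by positivity), ← ENNReal.ofReal_mul (by
          rw [EEV.turnover]
          positivity)]
      refine mul_le_mul_left (ENNReal.ofReal_le_ofReal ?_) _
      have hx : 0 ≤ 8 * (p.U ^ 2 * p.μ * p.τ / (J * p.L ^ 3)) := by positivity
      have e1 : 3 / (J * p.L ^ 3) * (p.μ * p.τ / 2 * (p.U ^ 2 / 3))
          = 1 / 16 * (8 * (p.U ^ 2 * p.μ * p.τ / (J * p.L ^ 3))) := by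
        field_simp
        norm_num
      have e2 : (3 : ℝ) ^ (1 / 3 : ℝ) / 6 * EEV.C26 ^ 2 * p.μ * (p.τ / EEV.turnover p)
          * (8 * p.U / (J * p.L ^ 2)) = (3 : ℝ) ^ (1 / 3 : ℝ) / 6 * EEV.C26 ^ 2
            * (8 * (p.U ^ 2 * p.μ * p.τ / (J * p.L ^ 3))) := by
        rw [EEV.turnover]
        field_simp
      rw [e1, e2]
      exact mul_le_mul_of_nonneg_right EEV.one_div_sixteen_le hx
  exact ⟨hfluct, hfluct.trans (add_le_add le_rfl
    (mul_le_mul_right (EEV.wallFluct_le_wallGrad p u Du) _))⟩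

end
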